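/- **Setting.** Let $G$ be a graph with vertex set $\{1,\dots,n\}$ and let $w(v)\in(0,\infty)$ be vertex weights. Let $X$ be the clique complex of $G$, let $k\ge 0$, let $X_k$ be the set of $k$-simplices (cliques with $k+1$ vertices; the empty set is the $(-1)$-simplex), and let $X_k^\pm$ be the set of oriented $k$-simplices $\sigma$, given by a vertex set and a sign $s(\sigma)\in\{0,1\}$ ($0$ for the orientation of the increasing ordering). Removing the $j$-th vertex ($j=0,1,\dots$, in increasing order) of $\sigma$ induces on the face the sign $s(\sigma)+j \bmod 2$. Write $\bar\sigma$ for $\sigma$ with the opposite orientation, $\sigma\sim_\uparrow\sigma'$ if $\sigma,\sigma'$ have a common $(k+1)$-dimensional coface in $X$ on which they induce the same orientation, and $\sigma\sim_\downarrow\sigma'$ if they have a common $(k-1)$-dimensional face on which they induce the same orientation. For adjacent $\sigma\ne\sigma'$ let $\{v_\sigma\}=\sigma\setminus\sigma'$ and $\{v_{\sigma'}\}=\sigma'\setminus\sigma$; let $\mathrm{up}(\sigma)$ be the set of vertices $u$ for which $\sigma\cup\{u\}$ is a $(k+1)$-simplex. Put $$K^{up}=\max_{\sigma\in X_k}\sum_{i\notin\sigma}\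 \sum_{j\in\sigma\cup\{i\}}w(i)w(j),\qquad K^{down}=\max_{\sigma\in X_k}\sum_{i\in\sigma}\ \sum_{j\notin\sigma\setminus\{i\}}w(i)w(j),$$ $$K=\max_{\sigma\in X_k}\Big(\sum_{i=1}^n w(i)^2+\sum_{i\notin\sigma}\sum_{j\in\sigma}w(i)w(j)\Big).$$ The up, down and harmonic walks are the Markov chains on $X_k^\pm\cup\{\Theta\}$ with absorbing state $\Theta$ and the following transition probabilities between $\sigma,\sigma'\in X_k^\pm$ (the rest of each row goes to $\Theta$, and $0/0$ is read as $0$): - $P^{up}_{\sigma,\sigma}=\sum_{u\in \mathrm{up}(\sigma)}w(u)^2/K^{up}$; for $\sigma\ne\sigma'$, $P^{up}_{\sigma,\sigma'}=w(v_\sigma)w(v_{\sigma'})/K^{up}$ if $\sigma\sim_\uparrow\sigma'$, and $0$ otherwise; - $P^{down}_{\sigma,\sigma}=\sum_{v\in\sigma}w(v)^2/K^{down}$; for $\sigma\ne\sigma'$, $P^{down}_{\sigma,\sigma'}=w(v_\sigma)w(v_{\sigma'})/K^{down}$ if $\sigma\sim_\downarrow\sigma'$, and $0$ otherwise; - $P_{\sigma,\sigma}=\big(\sum_{u\in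 \mathrm{up}(\sigma)}w(u)^2+\sum_{v\in\sigma}w(v)^2\big)/K$; for $\sigma\ne\sigma'$, $P_{\sigma,\sigma'}=w(v_\sigma)w(v_{\sigma'})/K$ if $\sigma\sim_\downarrow\sigma'$ and $\sigma\not\sim_\uparrow\overline{\sigma'}$, and $0$ otherwise. Let $|\sigma\rangle=|x_\sigma,s(\sigma),0\rangle$ on $n+2$ qubits, where $x_\sigma\in\{0,1\}^n$ is the indicator vector of the vertex set of $\sigma$. Circuits consist of arbitrary one-qubit unitaries, CNOT and Toffoli gates, each of cost $1$, and of coherent adjacency queries $|u\rangle|v\rangle|b\rangle\mapsto|u\rangle|v\rangle|b\oplus A_{uv}\rangle$ ($A$ the adjacency matrix of $G$; $u,v$ in binary), each of cost $n$; they may use work qubits that start and end in $|0\rangle$. **Theorem.** There are absolute constants $C,c$ and numbers $m=m(n)\le C\log(n+2)$ such that the following holds for all $n$, $k\ge0$, weights $w$ and $0<\epsilon\le\frac12$. For every given value of the normalization factor $K^{up}$ (respectively $K^{down}$, $K$) there is a circuit of cost at most $$C\,n^2\,\log(1/\epsilon)\,\log(n+2)^c=\tilde{\mathcal O}(n^2\log(1/\epsilon)),$$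 depending only on $n,k,w,\epsilon$ and that value, which, for every graph $G$ on $n$ vertices whose normalization factor has that value, implements (with queries to $G$) a unitary $U_k^{\uparrow\downarrow}$ (respectively $U_k^{\downarrow\uparrow}$, $U_k^h$) on two registers of $n+2$ qubits and two registers of $m$ qubits, such that for all $\sigma,\sigma'\in X_k^\pm$ - $\left|P^{up}_{\sigma,\sigma'}-\langle\sigma'|\langle0^{n+2}|\langle0^m,0^m|\,(U_k^{\uparrow\downarrow})^\dagger\cdot\mathrm{SWAP}\cdot U_k^{\uparrow\downarrow}\,|\sigma\rangle|0^{n+2}\rangle|0^m,0^m\rangle\right|\le\epsilon$, - respectively $\left|P^{down}_{\sigma,\sigma'}-\langle\sigma'|\langle0^{n+2}|\langle0^m,0^m|\,(U_k^{\downarrow\uparrow})^\dagger\cdot\mathrm{SWAP}\cdot U_k^{\downarrow\uparrow}\,|\sigma\rangle|0^{n+2}\rangle|0^m,0^m\rangle\right|\le\epsilon$, - respectively $\left|P_{\sigma,\sigma'}-\langle\sigma'|\langle0^{n+2}|\langle0^m,0^m|\,(U_k^{h})^\dagger\cdot\mathrm{SWAP}\cdot U_k^{h}\,|\sigma\rangle|0^{n+2}\rangle|0^m,0^m\rangle\right|\le\epsilon$,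 where $\mathrm{SWAP}$ exchanges the two $(n+2)$-qubit registers and the two $m$-qubit registers. No restriction is placed on the precision of the transition probabilities; in particular this covers the case in which they are given to $t=\mathcal O(\log(1/\epsilon)+\log n)$ bits. -/

import Mathlib

/-! ### Oriented simplices of a clique complex

The vertices are `0 < 1 < ⋯ < n - 1`, and a simplex of the clique complex of a graph `G` is a clique
of `G` (the empty clique is the simplex of dimension `-1`). -/

/-- `s` is a `k`-simplex of the clique complex of `G`: a clique with `k + 1` vertices. -/
def IsSimplex {n : ℕ} (G : SimpleGraph (Fin n)) (k : ℕ) (s : Finset (Fin n)) : Prop :=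
  G.IsNClique (k + 1) s

/-- An oriented simplex on the vertex set `Fin n`: its set of vertices and its sign `s(σ)`, which is
`false` for the positive orientation (the one of the increasing ordering of the vertices) and `true`
for the negative one. -/
abbrev OrientedSimplex (n : ℕ) : Type := Finset (Fin n) × Bool

namespace OrientedSimplex

variable {n : ℕ}

/-- The same simplex with the opposite orientation. -/
def opp (σ : OrientedSimplex n) : OrientedSimplex n := (σ.1, !σ.2)

/-- The face of `σ` opposite to its vertex `v`, with the orientation induced by `σ`: if `v` is the
vertex number `j` (counted from `0`) in increasing order, then removing it multiplies the sign by
`(-1) ^ j`. -/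
def face (σ : OrientedSimplex n) (v : Fin n) : OrientedSimplex n :=
  (σ.1.erase v, xor σ.2 (decide (Odd (σ.1.filter (fun u => u < v)).card)))

/-- `σ` is a face of `τ` carrying the orientation induced by `τ`; equivalently, `τ` is a coface of
`σ` carrying the orientation induced by `σ`. -/
def IsOrientedFace (σ τ : OrientedSimplex n) : Prop := ∃ v ∈ τ.1, τ.face v = σ

/-- Up-adjacency of oriented `k`-simplices: there is a common `(k+1)`-dimensional coface in the
clique complex on which both induce the same orientation. -/
def UpAdj (G : SimpleGraph (Fin n)) (k : ℕ) (σ σ' : OrientedSimplex n) : Prop :=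
  ∃ τ : OrientedSimplex n, IsSimplex G (k + 1) τ.1 ∧ IsOrientedFace σ τ ∧ IsOrientedFace σ' τ

/-- Down-adjacency of oriented simplices: there is a common face of codimension one on which both
induce the same orientation. -/
def DownAdj (σ σ' : OrientedSimplex n) : Prop :=
  ∃ ρ : OrientedSimplex n, IsOrientedFace ρ σ ∧ IsOrientedFace ρ σ'

end OrientedSimplex

/-! ### The three random walks -/

section Walks

variable {n : ℕ}

/-- The vertices `u` for which `s ∪ {u}` is a `(k+1)`-simplex. -/
noncomputable def upVertices (G : SimpleGraph (Fin n)) (k : ℕ) (s : Finset (Fin n)) :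
    Finset (Fin n) :=
  open scoped Classical in Finset.univ.filter (fun u => IsSimplex G (k + 1) (insert u s))

/-- `w(v_σ) w(v_σ')` for adjacent `σ`, `σ'` with different vertex sets: the vertices that are removed
to obtain the common face are given by `σ \ σ' = {v_σ}` and `σ' \ σ = {v_σ'}`. -/
def exchangeWeight (w : Fin n → ℝ) (σ σ' : OrientedSimplex n) : ℝ :=
  (∏ v ∈ σ.1 \ σ'.1, w v) * ∏ v ∈ σ'.1 \ σ.1, w v

/-- The normalization factor of the up walk: the maximum over the `k`-simplices `s` of the sum of
`w i * w j` over the vertices `i` outside `s` and the vertices `j` of `s ∪ {i}`. -/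
noncomputable def normUp (G : SimpleGraph (Fin n)) (k : ℕ) (w : Fin n → ℝ) : ℝ :=
  ⨆ s : {s : Finset (Fin n) // IsSimplex G k s}, ∑ i ∈ s.1ᶜ, ∑ j ∈ insert i s.1, w i * w j

/-- The normalization factor of the down walk: the maximum over the `k`-simplices `s` of the sum of
`w i * w j` over the vertices `i` of `s` and the vertices `j` outside `s \ {i}`. -/
noncomputable def normDown (G : SimpleGraph (Fin n)) (k : ℕ) (w : Fin n → ℝ) : ℝ :=
  ⨆ s : {s : Finset (Fin n) // IsSimplex G k s}, ∑ i ∈ s.1, ∑ j ∈ (s.1.erase i)ᶜ, w i * w j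

/-- The normalization factor of the harmonic walk. -/
noncomputable def normHarm (G : SimpleGraph (Fin n)) (k : ℕ) (w : Fin n → ℝ) : ℝ :=
  ⨆ s : {s : Finset (Fin n) // IsSimplex G k s},
    ((∑ i, w i ^ 2) + ∑ i ∈ s.1ᶜ, ∑ j ∈ s.1, w i * w j)

/-- A matrix on oriented `k`-simplices, completed by an absorbing state `Θ = none`, which is entered
with the probability that is missing from the row sum. -/
noncomputable def withAbsorbing (G : SimpleGraph (Fin n)) (k : ℕ)
    (Q : OrientedSimplex n → OrientedSimplex n → ℝ) :
    Option (OrientedSimplex n) → Option (OrientedSimplex n) → ℝ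
  | some σ, some σ' => Q σ σ'
  | some σ, none =>
      open scoped Classical in
      1 - ∑ σ' ∈ Finset.univ.filter (fun σ' : OrientedSimplex n => IsSimplex G k σ'.1), Q σ σ'
  | none, some _ => 0
  | none, none => 1

open scoped Classical in
/-- The transition matrix of the up walk on the oriented `k`-simplices and `Θ`. -/
noncomputable def upWalk (G : SimpleGraph (Fin n)) (k : ℕ) (w : Fin n → ℝ) :
    Option (OrientedSimplex n) → Option (OrientedSimplex n) → ℝ :=
  withAbsorbing G k fun σ σ' =>
    if σ = σ' then (∑ u ∈ upVertices G k σ.1, w u ^ 2) / normUp G k w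
    else if σ.UpAdj G k σ' then exchangeWeight w σ σ' / normUp G k w
    else 0

open scoped Classical in
/-- The transition matrix of the down walk on the oriented `k`-simplices and `Θ`. -/
noncomputable def downWalk (G : SimpleGraph (Fin n)) (k : ℕ) (w : Fin n → ℝ) :
    Option (OrientedSimplex n) → Option (OrientedSimplex n) → ℝ :=
  withAbsorbing G k fun σ σ' =>
    if σ = σ' then (∑ v ∈ σ.1, w v ^ 2) / normDown G k w
    else if σ.DownAdj σ' then exchangeWeight w σ σ' / normDown G k w
    else 0

open scoped Classical in
/-- The transition matrix of the harmonic walk on the oriented `k`-simplices and `Θ`. -/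
noncomputable def harmWalk (G : SimpleGraph (Fin n)) (k : ℕ) (w : Fin n → ℝ) :
    Option (OrientedSimplex n) → Option (OrientedSimplex n) → ℝ :=
  withAbsorbing G k fun σ σ' =>
    if σ = σ' then
      ((∑ u ∈ upVertices G k σ.1, w u ^ 2) + ∑ v ∈ σ.1, w v ^ 2) / normHarm G k w
    else if σ.DownAdj σ' ∧ ¬ σ.UpAdj G k σ'.opp then exchangeWeight w σ σ' / normHarm G k w
    else 0

end Walks

/-! ### Quantum circuits with access to the adjacency matrix of a graph

For a finite set `ι` of qubits, the computational basis states are the functions `ι → Bool`, and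
operators are matrices `A` with entries `A x y = ⟨x| A |y⟩`. -/

/-- The number of qubits of a register that holds a vertex in binary. -/
def vertexBits (n : ℕ) : ℕ := Nat.clog 2 n

/-- Gates on the qubits `ι`: arbitrary one-qubit unitaries, CNOT, Toffoli, and coherent queries
`|u⟩|v⟩|b⟩ ↦ |u⟩|v⟩|b ⊕ A_{uv}⟩` to the adjacency matrix `A` of a graph with `n` vertices, where the
qubits listed by `a` and `b` hold the vertices `u` and `v`. -/
inductive Gate (n : ℕ) (ι : Type) : Type
  | single (q : ι) (V : Matrix.unitaryGroup Bool ℂ) : Gate n ι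
  | cnot (c t : ι) (h : c ≠ t) : Gate n ι
  | toffoli (c₁ c₂ t : ι) (h : c₁ ≠ c₂) (h₁ : c₁ ≠ t) (h₂ : c₂ ≠ t) : Gate n ι
  | query (a b : Fin (vertexBits n) → ι) (t : ι) (hab : Function.Injective (Sum.elim a b))
      (ha : ∀ i, a i ≠ t) (hb : ∀ i, b i ≠ t) : Gate n ι

section Circuits

variable {n : ℕ} {ι : Type} [DecidableEq ι]

/-- In the basis state `x`, the qubits listed by `a` hold the vertex `v` in binary. -/
def HoldsVertex (a : Fin (vertexBits n) → ι) (x : ι → Bool) (v : Fin n) : Prop :=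
  ∀ i, x (a i) = v.val.testBit i.val

/-- The matrix of the classical map that flips the qubit `t` of `y` if `f y` holds. -/
def flipMatrix [Fintype ι] (t : ι) (f : (ι → Bool) → Bool) : Matrix (ι → Bool) (ι → Bool) ℂ :=
  fun x y => if x = Function.update y t (xor (y t) (f y)) then 1 else 0

open scoped Classical in
/-- The operator of a gate, when queries are answered for the graph `G`. -/
noncomputable def Gate.toMatrix [Fintype ι] (G : SimpleGraph (Fin n)) :
    Gate n ι → Matrix (ι → Bool) (ι → Bool) ℂ
  | .single q V => fun x y => if ∀ i, i ≠ q → x i = y i then V.1 (x q) (y q) else 0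
  | .cnot c t _ => flipMatrix t (fun y => y c)
  | .toffoli c₁ c₂ t _ _ _ => flipMatrix t (fun y => y c₁ && y c₂)
  | .query a b t _ _ _ =>
      flipMatrix t (fun y => decide (∃ u v, G.Adj u v ∧ HoldsVertex a y u ∧ HoldsVertex b y v))

/-- The cost of a gate: `1` for an elementary gate, and `n` for a query. -/
def Gate.cost : Gate n ι → ℕ
  | .single _ _ => 1
  | .cnot _ _ _ => 1
  | .toffoli _ _ _ _ _ _ => 1
  | .query _ _ _ _ _ _ => n

/-- A circuit is a list of gates; the head of the list is applied first. -/
abbrev QCircuit (n : ℕ) (ι : Type) : Type := List (Gate n ι)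

/-- The operator of a circuit, when queries are answered for the graph `G`. -/
noncomputable def QCircuit.eval [Fintype ι] (G : SimpleGraph (Fin n)) :
    QCircuit n ι → Matrix (ι → Bool) (ι → Bool) ℂ
  | [] => 1
  | g :: c => QCircuit.eval G c * g.toMatrix G

/-- The total cost of the gates of a circuit. -/
def QCircuit.cost (c : QCircuit n ι) : ℕ := (c.map Gate.cost).sum

/-- A circuit on the qubits `ι` and `a` further work qubits implements the operator `U` on `ι` if it
maps `|y⟩|0^a⟩` to `(U |y⟩)|0^a⟩` for every basis state `y`: the work qubits start and end in `0`. -/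
def QCircuit.Implements [Fintype ι] {a : ℕ} (c : QCircuit n (ι ⊕ Fin a)) (G : SimpleGraph (Fin n))
    (U : Matrix (ι → Bool) (ι → Bool) ℂ) : Prop :=
  ∀ (x : ι ⊕ Fin a → Bool) (y : ι → Bool),
    QCircuit.eval G c x (Sum.elim y fun _ => false) =
      if ∀ i, x (Sum.inr i) = false then U (fun q => x (Sum.inl q)) y else 0

end Circuits

/-! ### The registers of the quantum walks -/

/-- The `n + 2` qubits of a simplex register: one for each vertex, the sign qubit, and the qubit that
marks the absorbing state. -/
abbrev SimplexQubit (n : ℕ) : Type := Fin n ⊕ Fin 2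

/-- The qubits of a walk unitary: two simplex registers of `n + 2` qubits, and two index registers of
`m` qubits. -/
abbrev WalkQubit (n m : ℕ) : Type := (SimplexQubit n ⊕ SimplexQubit n) ⊕ (Fin m ⊕ Fin m)

/-- The basis state `|x_σ, s(σ), 0⟩` of the simplex register. -/
def simplexKet {n : ℕ} (σ : OrientedSimplex n) : SimplexQubit n → Bool :=
  Sum.elim (fun v => decide (v ∈ σ.1)) ![σ.2, false]

/-- The basis state `|σ⟩|0^(n+2)⟩|0^m, 0^m⟩` of all registers. -/
def initialKet {n : ℕ} (m : ℕ) (σ : OrientedSimplex n) : WalkQubit n m → Bool :=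
  Sum.elim (Sum.elim (simplexKet σ) fun _ => false) fun _ => false

/-- `SWAP`, exchanging the two simplex registers and the two index registers. -/
def swapMatrix (n m : ℕ) : Matrix (WalkQubit n m → Bool) (WalkQubit n m → Bool) ℂ :=
  fun x y => if x = y ∘ Sum.map Sum.swap Sum.swap then 1 else 0

/-- `U† · SWAP · U` reproduces, up to `ε`, all the entries of the matrix `P` at the oriented
`k`-simplices of the clique complex of `G`. -/
def ReproducesWalk {n : ℕ} (m : ℕ) (G : SimpleGraph (Fin n)) (k : ℕ) (ε : ℝ)
    (U : Matrix (WalkQubit n m → Bool) (WalkQubit n m → Bool) ℂ)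
    (P : Option (OrientedSimplex n) → Option (OrientedSimplex n) → ℝ) : Prop :=
  ∀ σ σ' : OrientedSimplex n, IsSimplex G k σ.1 → IsSimplex G k σ'.1 →
    ‖(P (some σ) (some σ') : ℂ) -
      (U.conjTranspose * swapMatrix n m * U) (initialKet m σ') (initialKet m σ)‖ ≤ ε

/-! Encoding. Every move of the three walks exchanges an old vertex `j` of σ for a new vertex `i`,
and the holding probability is a sum over diagonal pairs `i = j`. So the walks are indexed by pairs
`p = (i, j)` with weight `q p = w i * w j / K`. Which pairs are admissible for σ (`Mode.mem`)
depends only on the vertex set of σ, not on the graph, and K is the maximal total weight of the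
admissible pairs; hence the `q p` sum to at most 1 (`Mode.sum_mem_div_le`). Let ψ_σ be the
superposition with amplitude √(q p) on |σ⟩|σ_p⟩|i, flags⟩|j, flags⟩, where σ_p is the simplex after
the exchange with its induced sign, completed by rest states. After SWAP the term (i, j) of ψ_σ can
only meet the term (j, i) of ψ_σ', and it does so exactly when σ' = σ_p and neither term is flagged
as not contributing (`flip_pairKet_iff`). Rest states and flagged terms carry a flag in the first
index register whose mirror image in the second one is never set, so SWAP makes them orthogonal to
everything. As q is symmetric, ⟨ψ_σ'|SWAP|ψ_σ⟩ is the sum of q p over the contributing pairs: a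
single pair if σ ≠ σ', the diagonal pairs if σ = σ'. By `Mode.walk_eq_sum` this is the transition
probability.

Reflection. It is enough to have a circuit c that maps |σ⟩|0⟩ to V σ = (|σ⟩ + ψ_σ)/√2. Conjugating
by c the sign flip of all states |σ⟩|0⟩ gives U = 1 - 2 ∑ |V σ⟩⟨V σ| (`exists_householder`), and
U|σ⟩ = |σ⟩ - √2 V σ = -ψ_σ; the sign cancels in U† SWAP U. So c has to be understood on clean inputs
only, whereas U is unitary and restores the work qubits for every input.

Preparation. The weights are rounded down to N p / 2^s. A uniform superposition of v < 2^s is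
scanned through all n² pairs: each admissible pair takes the initial interval of length N p and
shifts the rest down (`run_splitC_sum`), at polylogarithmic cost per pair. Then the offset inside
each interval has to be erased, and the length T of the leftover interval depends on σ. The device
is `run_hadC_xor`: the numbers v ⊕ N with v < N fill the blocks [2^b, 2^(b+1)), where b runs over
the bits of N, so Hadamard gates below the leading bit contract ∑ |v ⊕ N⟩ to ∑ √2^b |2^b⟩, by one
circuit for all N. For a chosen pair N p is a constant, and this state is rotated to √(N p)|0⟩
(`run_unprepC`). For the leftover, the position b is moved to the unused target register as a label
(`run_compressC`), where it may stay because rest states never matter. This needs 2^n labels; if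
there are fewer, a table of all 2^n vertex sets is short enough (`prepares_tableC`).

Writing and testing. Prefix parities computed once make the sign of an exchange cheap for each pair.
Only the new vertex i has to be compared with the other vertices, which takes 4n queries of cost n,
including all uncomputations. The signs of the exchange along a common coface and along a common
face are opposite (`Mode.sgn_up`); this is how the condition of the harmonic walk becomes a
condition on the coface alone.

Error. At most n pairs contribute to an entry, each with error at most 2^(-s), so s = ⌈log₂ n⌉ +
⌈log₂ (1/ε)⌉ is enough. -/

/-! ### States and the action of circuits on basis states -/

/-- Finitely supported superpositions of basis states; the set of qubits may be infinite. -/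
abbrev Vec (ι : Type) : Type := (ι → Bool) →₀ ℂ

/-- The basis state `|y⟩`. -/
noncomputable def ket {ι : Type} (y : ι → Bool) : Vec ι := Finsupp.single y 1

section Semantics

variable {n : ℕ} {ι : Type} [DecidableEq ι]

/-- The assignment `y` with the qubit `t` flipped if `b` holds. -/
def toggle (y : ι → Bool) (t : ι) (b : Bool) : ι → Bool := Function.update y t (xor (y t) b)

theorem toggle_apply (y : ι → Bool) (t : ι) (b : Bool) (q : ι) :
    toggle y t b q = if q = t then xor (y t) b else y q := by
  simp [toggle, Function.update_apply]

@[simp] theorem toggle_false (y : ι → Bool) (t : ι) : toggle y t false = y := by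
  simp [toggle]

theorem toggle_toggle (y : ι → Bool) (t : ι) (b b' : Bool) :
    toggle (toggle y t b) t b' = toggle y t (xor b b') := by
  simp [toggle]

open scoped Classical in
/-- The answer to a query in the basis state `y`. -/
noncomputable def answer (G : SimpleGraph (Fin n)) (a b : Fin (vertexBits n) → ι)
    (y : ι → Bool) : Bool :=
  decide (∃ u v, G.Adj u v ∧ HoldsVertex a y u ∧ HoldsVertex b y v)

/-- The image of a basis state under a gate. -/
noncomputable def Gate.onKet (G : SimpleGraph (Fin n)) : Gate n ι → (ι → Bool) → Vec ι
  | .single q V, y => V.1 false (y q) • ket (Function.update y q false) +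
      V.1 true (y q) • ket (Function.update y q true)
  | .cnot c t _, y => ket (toggle y t (y c))
  | .toffoli c₁ c₂ t _ _ _, y => ket (toggle y t (y c₁ && y c₂))
  | .query a b t _ _ _, y => ket (toggle y t (answer G a b y))

/-- The linear map of a circuit on superpositions of basis states. -/
noncomputable def run (G : SimpleGraph (Fin n)) : QCircuit n ι → Vec ι →ₗ[ℂ] Vec ι
  | [] => LinearMap.id
  | g :: c => run G c ∘ₗ Finsupp.linearCombination ℂ (g.onKet G)

variable (G : SimpleGraph (Fin n))

@[simp] theorem run_nil (φ : Vec ι) : run G [] φ = φ := rfl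

theorem run_cons (g : Gate n ι) (c : QCircuit n ι) (φ : Vec ι) :
    run G (g :: c) φ = run G c (run G [g] φ) := rfl

@[simp] theorem run_singleton_ket (g : Gate n ι) (y : ι → Bool) :
    run G [g] (ket y) = g.onKet G y := by
  simp [run, ket]

@[simp] theorem run_append (c d : QCircuit n ι) (φ : Vec ι) :
    run G (c ++ d) φ = run G d (run G c φ) := by
  induction c generalizing φ with
  | nil => rfl
  | cons g c ih => rw [List.cons_append, run_cons, run_cons G g c, ih]

theorem run_eq_of_ket {c d : QCircuit n ι} (h : ∀ y, run G c (ket y) = run G d (ket y)) :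
    run G c = run G d := by
  ext y : 1
  refine LinearMap.ext_ring ?_
  simpa [ket] using h y

omit [DecidableEq ι] in
theorem ket_apply (x y : ι → Bool) [Decidable (x = y)] : ket y x = if x = y then 1 else 0 := by
  classical
  rw [ket, Finsupp.single_apply]
  simp [eq_comm]

theorem vec_eq_sum [Fintype ι] (φ : Vec ι) : φ = ∑ z, φ z • ket z := by
  classical
  ext x
  rw [Finsupp.finsetSum_apply]
  simp [ket_apply]

theorem Gate.onKet_apply [Fintype ι] (g : Gate n ι) (x y : ι → Bool) :
    g.onKet G y x = g.toMatrix G x y := by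
  cases g with
  | single q V =>
    simp only [Gate.onKet, Gate.toMatrix, Finsupp.add_apply, Finsupp.smul_apply, ket_apply,
      smul_eq_mul]
    by_cases h : ∀ i, i ≠ q → x i = y i
    · have key : ∀ b, x = Function.update y q b ↔ x q = b := by
        intro b
        constructor
        · intro e; rw [e]; simp
        · intro e; funext i
          by_cases hi : i = q
          · subst hi; simp [e]
          · simp [hi, h i hi]
      simp only [key, if_pos h]
      cases x q <;> simp
    · have key : ∀ b, x ≠ Function.update y q b := by
        rintro b e
        exact h fun i hi => by rw [e]; simp [hi]
      simp [key, h]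
  | cnot c t h => simp [Gate.onKet, Gate.toMatrix, ket_apply, flipMatrix, toggle]
  | toffoli c₁ c₂ t _ _ _ => simp [Gate.onKet, Gate.toMatrix, ket_apply, flipMatrix, toggle]
  | query a b t _ _ _ => simp [Gate.onKet, Gate.toMatrix, ket_apply, flipMatrix, toggle, answer]

/-- The bridge between the two semantics: superpositions allow computations with an unlimited supply
of named qubits, matrices occur in the statement of the theorem. -/
theorem run_ket_apply [Fintype ι] (c : QCircuit n ι) (x y : ι → Bool) :
    run G c (ket y) x = QCircuit.eval G c x y := by
  induction c generalizing y with
  | nil => simp [QCircuit.eval, ket_apply, Matrix.one_apply]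
  | cons g c ih =>
    rw [run_cons, run_singleton_ket, QCircuit.eval, vec_eq_sum (g.onKet G y), map_sum,
      Finsupp.finsetSum_apply, Matrix.mul_apply]
    refine Finset.sum_congr rfl fun z _ => ?_
    rw [map_smul, Finsupp.smul_apply, ih, Gate.onKet_apply, smul_eq_mul, mul_comm]

/-! ### Inverse circuits -/

/-- The inverse gate. -/
def Gate.inv : Gate n ι → Gate n ι
  | .single q V => .single q V⁻¹
  | g => g

/-- The inverse circuit. -/
def QCircuit.inv (c : QCircuit n ι) : QCircuit n ι := (c.map Gate.inv).reverse

omit [DecidableEq ι] in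
theorem QCircuit.inv_cons (g : Gate n ι) (c : QCircuit n ι) :
    QCircuit.inv (g :: c) = QCircuit.inv c ++ [g.inv] := by
  simp [QCircuit.inv]

omit [DecidableEq ι] in
theorem Gate.cost_inv (g : Gate n ι) : g.inv.cost = g.cost := by
  cases g <;> rfl

theorem answer_toggle {a b : Fin (vertexBits n) → ι} {t : ι} (ha : ∀ i, a i ≠ t)
    (hb : ∀ i, b i ≠ t) (y : ι → Bool) (c : Bool) :
    answer G a b (toggle y t c) = answer G a b y := by
  have h : ∀ {a : Fin (vertexBits n) → ι} (_ : ∀ i, a i ≠ t) (v : Fin n),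
      HoldsVertex a (toggle y t c) v ↔ HoldsVertex a y v := by
    intro a ha v
    simp [HoldsVertex, toggle, ha]
  unfold answer
  rw [decide_eq_decide]
  simp only [h ha, h hb]

theorem toggle_ne {q t : ι} (h : q ≠ t) (y : ι → Bool) (b : Bool) : toggle y t b q = y q := by
  simp [toggle, h]

theorem run_gate_inv (g : Gate n ι) (φ : Vec ι) : run G [g.inv] (run G [g] φ) = φ := by
  have key : run G ([g] ++ [g.inv]) = run G [] := by
    refine run_eq_of_ket G fun y => ?_
    rw [run_append, run_singleton_ket, run_nil]
    cases g with
    | single q V =>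
      have hV := Matrix.UnitaryGroup.star_mul_self V
      have h := fun i j => congrFun (congrFun hV i) j
      simp only [Matrix.mul_apply, Fintype.sum_bool, Matrix.one_apply] at h
      simp only [Gate.onKet, map_add, map_smul, Gate.inv, run_singleton_ket, Function.update_self,
        Function.update_idem, Matrix.UnitaryGroup.inv_val, smul_add, smul_smul]
      rcases hb : y q with _ | _
      · have e : Function.update y q false = y := by rw [← hb]; simp
        have h1 := h false false
        have h2 := h true false
        simp only [if_true, Bool.true_eq_false, if_false] at h1 h2
        rw [e]
        calc _ = (star (V.1) false true * V.1 true false + star (V.1) false false * V.1 false false) • ket y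
              + (star (V.1) true true * V.1 true false + star (V.1) true false * V.1 false false) • ket (Function.update y q true) := by
                module
          _ = _ := by rw [h1, h2]; simp
      · have e : Function.update y q true = y := by rw [← hb]; simp
        have h1 := h true true
        have h2 := h false true
        simp only [if_true, Bool.false_eq_true, if_false] at h1 h2
        rw [e]
        calc _ = (star (V.1) true true * V.1 true true + star (V.1) true false * V.1 false true) • ket y
              + (star (V.1) false true * V.1 true true + star (V.1) false false * V.1 false true) • ket (Function.update y q false) := by
                module
          _ = _ := by rw [h1, h2]; simp
    | cnot c t h =>
      simp [Gate.onKet, Gate.inv, toggle_ne h, toggle_toggle]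
    | toffoli c₁ c₂ t h h₁ h₂ =>
      simp [Gate.onKet, Gate.inv, toggle_ne h₁, toggle_ne h₂, toggle_toggle]
    | query a b t hab ha hb =>
      simp [Gate.onKet, Gate.inv, answer_toggle G ha hb, toggle_toggle]
  have := LinearMap.congr_fun key φ
  rwa [run_append, run_nil] at this

theorem run_inv (c : QCircuit n ι) (φ : Vec ι) : run G c.inv (run G c φ) = φ := by
  induction c generalizing φ with
  | nil => rfl
  | cons g c ih => rw [QCircuit.inv_cons, run_cons, run_append, ih, run_gate_inv]

/-- Most uncomputations below by an inverse circuit have this form: to run a circuit backwards on ψ,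
it suffices to exhibit a state that it maps to ψ. -/
theorem run_inv_of_eq {c : QCircuit n ι} {φ ψ : Vec ι} (h : run G c φ = ψ) :
    run G c.inv ψ = φ := by
  rw [← h, run_inv]

theorem Gate.toMatrix_inv [Fintype ι] (g : Gate n ι) :
    g.inv.toMatrix G = (g.toMatrix G).conjTranspose := by
  have flip : ∀ (t : ι) (f : (ι → Bool) → Bool), (∀ y b, f (toggle y t b) = f y) →
      flipMatrix t f = (flipMatrix t f).conjTranspose := by
    intro t f hf
    ext x y
    have : (x = toggle y t (f y)) ↔ (y = toggle x t (f x)) := by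
      constructor <;> (intro h; rw [h, hf, toggle_toggle]; simp)
    simp only [toggle] at this
    simp only [flipMatrix, Matrix.conjTranspose_apply, this]
    split_ifs <;> simp
  cases g with
  | single q V =>
    ext x y
    rw [Matrix.conjTranspose_apply]
    simp only [Gate.inv, Gate.toMatrix, Matrix.UnitaryGroup.inv_val]
    simp only [eq_comm (a := x _)]
    split_ifs <;> simp [Matrix.star_apply]
  | cnot c t h => exact flip _ _ fun y b => by simp [toggle_ne h]
  | toffoli c₁ c₂ t h h₁ h₂ => exact flip _ _ fun y b => by simp [toggle_ne h₁, toggle_ne h₂]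
  | query a b t hab ha hb =>
    exact flip _ (answer G a b) fun y c => answer_toggle G ha hb y c

theorem eval_append [Fintype ι] (c d : QCircuit n ι) :
    QCircuit.eval G (c ++ d) = QCircuit.eval G d * QCircuit.eval G c := by
  induction c with
  | nil => simp [QCircuit.eval]
  | cons g c ih => simp [QCircuit.eval, ih, Matrix.mul_assoc]

theorem eval_inv [Fintype ι] (c : QCircuit n ι) :
    QCircuit.eval G c.inv = (QCircuit.eval G c).conjTranspose := by
  induction c with
  | nil => simp [QCircuit.eval, QCircuit.inv]
  | cons g c ih =>
    rw [QCircuit.inv_cons, eval_append, ih]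
    simp [QCircuit.eval, Gate.toMatrix_inv]

theorem conjTranspose_eval_mul_eval [Fintype ι] (c : QCircuit n ι) :
    (QCircuit.eval G c).conjTranspose * QCircuit.eval G c = 1 := by
  rw [← eval_inv, ← eval_append]
  ext x y
  rw [← run_ket_apply, run_append, run_inv, ket_apply, Matrix.one_apply]

/-! ### Costs -/

omit [DecidableEq ι] in
@[simp] theorem cost_nil : QCircuit.cost ([] : QCircuit n ι) = 0 := rfl

omit [DecidableEq ι] in
@[simp] theorem cost_append (c d : QCircuit n ι) :
    QCircuit.cost (c ++ d) = QCircuit.cost c + QCircuit.cost d := by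
  simp [QCircuit.cost]

omit [DecidableEq ι] in
theorem cost_cons (g : Gate n ι) (c : QCircuit n ι) :
    QCircuit.cost (g :: c) = g.cost + QCircuit.cost c := by
  simp [QCircuit.cost]

omit [DecidableEq ι] in
theorem cost_inv (c : QCircuit n ι) : QCircuit.cost c.inv = QCircuit.cost c := by
  induction c with
  | nil => rfl
  | cons g c ih => rw [QCircuit.inv_cons, cost_append, ih, cost_cons, cost_cons, Gate.cost_inv]; simp [add_comm]

end Semantics

/-! ### Elementary circuits -/

section Elementary

variable {n : ℕ} {ι : Type} [DecidableEq ι] (G : SimpleGraph (Fin n))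

/-- The NOT gate. -/
def notUnitary : Matrix.unitaryGroup Bool ℂ :=
  ⟨Matrix.of fun a b => if a = b then 0 else 1, by
    rw [Matrix.mem_unitaryGroup_iff]
    ext a b
    cases a <;> cases b <;> simp [Matrix.mul_apply, Matrix.star_apply]⟩

/-- The rotation by the angle `φ`. -/
noncomputable def rotUnitary (φ : ℝ) : Matrix.unitaryGroup Bool ℂ :=
  ⟨Matrix.of fun a b => if a = b then (Real.cos φ : ℂ)
    else if a then (Real.sin φ : ℂ) else -(Real.sin φ : ℂ), by
    rw [Matrix.mem_unitaryGroup_iff]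
    have h : (Real.cos φ : ℂ) * Real.cos φ + Real.sin φ * Real.sin φ = 1 := by
      have := Real.cos_sq_add_sin_sq φ
      norm_cast
      rw [← this]; ring
    ext a b
    cases a <;> cases b <;>
      simp [Matrix.mul_apply, Matrix.star_apply, Complex.conj_ofReal, -Complex.ofReal_cos,
        -Complex.ofReal_sin]
    · rw [add_comm]; exact h
    · ring
    · ring
    · exact h⟩

/-- NOT on the qubit `q`. -/
def notC (q : ι) : QCircuit n ι := [.single q notUnitary]

/-- CNOT from `c` to `t`. -/
def cxC (c t : ι) : QCircuit n ι := if h : c ≠ t then [.cnot c t h] else []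

/-- A Toffoli gate. -/
def ccxC (c₁ c₂ t : ι) : QCircuit n ι :=
  if h : c₁ ≠ c₂ ∧ c₁ ≠ t ∧ c₂ ≠ t then [.toffoli c₁ c₂ t h.1 h.2.1 h.2.2] else []

/-- NOT on `q` unless `s` holds. -/
def polC (q : ι) (s : Bool) : QCircuit n ι := if s then [] else notC q

/-- A Toffoli gate that fires if `c₁` is `s₁` and `c₂` is `s₂`. -/
def litC (c₁ : ι) (s₁ : Bool) (c₂ : ι) (s₂ : Bool) (t : ι) : QCircuit n ι :=
  polC c₁ s₁ ++ polC c₂ s₂ ++ ccxC c₁ c₂ t ++ polC c₂ s₂ ++ polC c₁ s₁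

/-- The reflection with the matrix `!![cos α, sin α; sin α, -cos α]` on the qubit `q`, controlled
by `c`. -/
noncomputable def reflC (c q : ι) (α : ℝ) : QCircuit n ι :=
  [.single q (rotUnitary (-((α - Real.pi / 2) / 2)))] ++ cxC c q ++
    [.single q (rotUnitary ((α - Real.pi / 2) / 2))]

@[simp] theorem run_notC (q : ι) (y : ι → Bool) :
    run G (notC q) (ket y) = ket (toggle y q true) := by
  simp only [notC, run_singleton_ket, Gate.onKet, notUnitary]
  cases h : y q <;> simp [toggle, h]

theorem run_cxC {c t : ι} (h : c ≠ t) (y : ι → Bool) :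
    run G (cxC c t) (ket y) = ket (toggle y t (y c)) := by
  simp [cxC, h, Gate.onKet]

theorem run_ccxC {c₁ c₂ t : ι} (h : c₁ ≠ c₂) (h₁ : c₁ ≠ t) (h₂ : c₂ ≠ t) (y : ι → Bool) :
    run G (ccxC c₁ c₂ t) (ket y) = ket (toggle y t (y c₁ && y c₂)) := by
  simp [ccxC, h, h₁, h₂, Gate.onKet]

theorem run_polC (q : ι) (s : Bool) (y : ι → Bool) :
    run G (polC q s) (ket y) = ket (toggle y q (!s)) := by
  cases s <;> simp [polC]

theorem run_litC {c₁ c₂ t : ι} (h : c₁ ≠ c₂) (h₁ : c₁ ≠ t) (h₂ : c₂ ≠ t) (s₁ s₂ : Bool)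
    (y : ι → Bool) :
    run G (litC c₁ s₁ c₂ s₂ t) (ket y) = ket (toggle y t (y c₁ == s₁ && y c₂ == s₂)) := by
  simp only [litC, run_append, run_polC, run_ccxC G h h₁ h₂]
  congr 1
  funext q
  simp only [toggle_apply]
  by_cases q1 : q = c₁
  · subst q1; simp [h, h₁]
  by_cases q2 : q = c₂
  · subst q2; simp [h.symm, h₂]
  by_cases q3 : q = t
  · subst q3; simp [h, h.symm, h₁.symm, h₂.symm]
    cases s₁ <;> cases s₂ <;> simp
  · simp [q1, q2, q3]

omit [DecidableEq ι] in
theorem ket_congr {y z : ι → Bool} (h : ∀ q, y q = z q) : ket y = ket z := by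
  rw [funext h]

/-- NOT is the reflection with α = π/2, and conjugation by the rotation by φ adds 2φ to the angle;
hence φ = (α - π/2)/2. If the control is off, the two rotations cancel. The angle π/4 gives a
controlled Hadamard gate. -/
theorem run_reflC {c q : ι} (h : c ≠ q) (α : ℝ) (y : ι → Bool) :
    run G (reflC c q α) (ket y) =
      if y c then (if y q then (Real.sin α : ℂ) • ket (Function.update y q false) -
          (Real.cos α : ℂ) • ket y
        else (Real.cos α : ℂ) • ket y + (Real.sin α : ℂ) • ket (Function.update y q true))
      else ket y := by
  set φ := (α - Real.pi / 2) / 2 with hφ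
  have hα : α = 2 * φ + Real.pi / 2 := by rw [hφ]; ring
  obtain ⟨C, hC⟩ : ∃ C : ℂ, C = (Real.cos φ : ℂ) := ⟨_, rfl⟩
  obtain ⟨S, hS⟩ : ∃ S : ℂ, S = (Real.sin φ : ℂ) := ⟨_, rfl⟩
  have e1 : (Real.cos α : ℂ) = -(2 * S * C) := by
    rw [hα, Real.cos_add_pi_div_two, Real.sin_two_mul, hC, hS]
    norm_cast
  have e2 : (Real.sin α : ℂ) = C * C - S * S := by
    rw [hα, Real.sin_add_pi_div_two, Real.cos_two_mul', hC, hS, pow_two, pow_two]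
    norm_cast
  have e3 : C * C + S * S = 1 := by
    have := Real.cos_sq_add_sin_sq φ
    rw [hC, hS]
    norm_cast
    rw [← this]; ring
  rw [reflC, ← hφ]
  simp only [run_append, run_singleton_ket, Gate.onKet, rotUnitary, map_add, map_smul,
    run_cxC G h, Function.update_of_ne h, toggle, Function.update_self, Function.update_idem,
    Real.cos_neg, Real.sin_neg, Matrix.of_apply, e1, e2, Complex.ofReal_neg, ← hC, ← hS]
  rcases hc : y c with _ | _ <;> rcases hq : y q with _ | _
  all_goals
    have e : Function.update y q (y q) = y := Function.update_eq_self q y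
    rw [hq] at e
    simp only [e, reduceCtorEq, if_true, if_false, Bool.false_xor, Bool.xor_false, Bool.true_xor,
      Bool.not_true, neg_neg, Bool.false_eq_true]
  · calc _ = (C * C + S * S) • ket y := by module
      _ = _ := by rw [e3, one_smul]
  · calc _ = (C * C + S * S) • ket y := by module
      _ = _ := by rw [e3, one_smul]
  · module
  · module

/-- Conditional NOT gates from `c` to all the qubits in a list. -/
def fanC (c : ι) (ts : List ι) : QCircuit n ι := ts.flatMap (cxC c)

theorem run_fanC (c : ι) (ts : List ι) (hc : c ∉ ts) (hn : ts.Nodup) (y : ι → Bool) :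
    run G (fanC c ts) (ket y) = ket fun q => xor (y q) (y c && decide (q ∈ ts)) := by
  induction ts generalizing y with
  | nil => simp [fanC]
  | cons t ts ih =>
    simp only [List.mem_cons, not_or] at hc
    rw [List.nodup_cons] at hn
    have : fanC (n := n) c (t :: ts) = cxC c t ++ fanC c ts := rfl
    rw [this, run_append, run_cxC G hc.1, ih hc.2 hn.2]
    refine ket_congr fun q => ?_
    rw [toggle_apply, toggle_ne hc.1]
    by_cases h : q = t
    · subst h; simp [hn.1]
    · simp [h]

/-- NOT gates on all the qubits in a list. -/
def notsC (ts : List ι) : QCircuit n ι := ts.flatMap notC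

theorem run_notsC (ts : List ι) (hn : ts.Nodup) (y : ι → Bool) :
    run G (notsC ts) (ket y) = ket fun q => xor (y q) (decide (q ∈ ts)) := by
  induction ts generalizing y with
  | nil => simp [notsC]
  | cons t ts ih =>
    rw [List.nodup_cons] at hn
    have : notsC (n := n) (t :: ts) = notC t ++ notsC ts := rfl
    rw [this, run_append, run_notC G, ih hn.2]
    refine ket_congr fun q => ?_
    rw [toggle_apply]
    by_cases h : q = t
    · subst h; simp [hn.1]
    · simp [h]

/-- Flips `t` if `acc` is set and all the qubits in the list have the listed values; the work qubits
are `anc k, anc (k + 1), …`. -/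
def andC (anc : ℕ → ι) : List (ι × Bool) → ℕ → ι → ι → QCircuit n ι
  | [], _, acc, t => cxC acc t
  | p :: l, k, acc, t =>
    litC acc true p.1 p.2 (anc k) ++ andC anc l (k + 1) (anc k) t ++
      litC acc true p.1 p.2 (anc k)

/-- While the inner circuit runs, `anc k` holds the conjunction of `acc` with the first literal. The
inner circuit changes only `t`, which is no control of this Toffoli gate, so the second copy of the
gate clears `anc k`. -/
theorem run_andC {anc : ℕ → ι} (hanc : Function.Injective anc) (l : List (ι × Bool)) (k : ℕ)
    (acc t : ι) (hat : acc ≠ t) (ha : ∀ j, k ≤ j → acc ≠ anc j) (ht : ∀ j, k ≤ j → t ≠ anc j)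
    (hl : ∀ p ∈ l, p.1 ≠ acc ∧ p.1 ≠ t ∧ ∀ j, k ≤ j → p.1 ≠ anc j)
    (y : ι → Bool) (hy : ∀ j, k ≤ j → y (anc j) = false) :
    run G (andC anc l k acc t) (ket y) =
      ket (toggle y t (y acc && l.all fun p => y p.1 == p.2)) := by
  induction l generalizing k acc y with
  | nil => simp [andC, run_cxC G hat]
  | cons p l ih =>
    obtain ⟨hp1, hp2, hp3⟩ := hl p (by simp)
    have h1 := run_litC G hp1.symm (ha k le_rfl) (hp3 k le_rfl) true p.2
    rw [andC, run_append, run_append, h1, ih (k + 1) (anc k) (ht k le_rfl).symm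
      (fun j hj h => by have := hanc h; omega) (fun j hj => ht j (by omega))
      (fun q hq => ?_) _ (fun j hj => ?_), h1]
    · refine ket_congr fun q => ?_
      have ht' := ht k le_rfl
      have ha' := ha k le_rfl
      have hp' := hp3 k le_rfl
      have hall : (l.all fun q => toggle y (anc k) (y acc == true && y p.1 == p.2) q.1 == q.2) =
          l.all fun q => y q.1 == q.2 := by
        rw [Bool.eq_iff_iff, List.all_eq_true, List.all_eq_true]
        refine forall₂_congr fun q hq => ?_
        rw [toggle_ne ((hl q (by simp [hq])).2.2 k le_rfl)]
      rw [hall]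
      by_cases e1 : q = anc k
      · subst e1
        simp [toggle_apply, ht'.symm, hat, ha', hp2, hp', hy k le_rfl]
      · by_cases e2 : q = t
        · subst e2
          simp [toggle_apply, e1, hy k le_rfl, Bool.and_assoc]
        · simp [toggle_apply, e1, e2]
    · obtain ⟨q1, q2, q3⟩ := hl q (by simp [hq])
      exact ⟨q3 k le_rfl, q2, fun j hj => q3 j (by omega)⟩
    · rw [toggle_ne (fun h => by have := hanc h; omega), hy j (by omega)]

/-- Distributes the amplitude of a token to the qubits of a list: if the token `tok` has the amplitude
`ρ`, then it moves to the listed qubits with the listed amplitudes. -/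
noncomputable def chainC (g tok : ι) : List (ι × ℝ) → ℝ → QCircuit n ι
  | [], _ => []
  | p :: l, ρ =>
    reflC tok p.1 (Real.arcsin (p.2 / ρ)) ++ ccxC g p.1 tok ++
      chainC g tok l (Real.sqrt (ρ ^ 2 - p.2 ^ 2))

/-- Without the token the reflections are off, and a Toffoli gate can only fire if both `g` and a
listed qubit are set. The first alternative covers branches that belong to another `g`, the second
one branches in which the token is already spent and the remaining targets are empty. -/
theorem run_chainC_idle {g tok : ι} (hgt : g ≠ tok) (l : List (ι × ℝ)) (ρ : ℝ)
    (hl : ∀ p ∈ l, p.1 ≠ g ∧ p.1 ≠ tok) (y : ι → Bool) (ht : y tok = false)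
    (hy : y g = false ∨ ∀ p ∈ l, y p.1 = false) :
    run G (chainC g tok l ρ) (ket y) = ket y := by
  induction l generalizing ρ with
  | nil => rfl
  | cons p l ih =>
    obtain ⟨h1, h2⟩ := hl p (by simp)
    have h3 : (y g && y p.1) = false := by
      rcases hy with hy | hy
      · simp [hy]
      · simp [hy p (by simp)]
    rw [chainC, run_append, run_append, run_reflC G h2.symm, ht, if_neg (by simp),
      run_ccxC G h1.symm hgt h2, h3, toggle_false]
    exact ih _ (fun q hq => hl q (by simp [hq])) (hy.imp_right fun hy q hq => hy q (by simp [hq]))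

/-- The reflection with sine `p.2 / ρ` moves the amplitude `p.2` to the target, the Toffoli gate
removes the token from that branch, and by Pythagoras √(ρ² - p.2²) is left for the tail. The factor
`ρ` on the left makes the induction valid also when the amplitude is exhausted and `p.2 / ρ` is 0/0.
-/
theorem run_chainC {g tok : ι} (hgt : g ≠ tok) (l : List (ι × ℝ)) (ρ : ℝ) (hρ : 0 ≤ ρ)
    (hl : ∀ p ∈ l, 0 ≤ p.2 ∧ p.1 ≠ g ∧ p.1 ≠ tok) (hs : (l.map fun p => p.2 ^ 2).sum ≤ ρ ^ 2)
    (hn : (l.map Prod.fst).Nodup) (y : ι → Bool) (hy : ∀ p ∈ l, y p.1 = false)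
    (hg : y g = true) (ht : y tok = true) :
    (ρ : ℂ) • run G (chainC g tok l ρ) (ket y) =
      (l.map fun p => (p.2 : ℂ) • ket (Function.update (Function.update y tok false) p.1 true)).sum +
        (Real.sqrt (ρ ^ 2 - (l.map fun p => p.2 ^ 2).sum) : ℂ) • ket y := by
  induction l generalizing ρ with
  | nil => simp [chainC, Real.sqrt_sq hρ]
  | cons p l ih =>
    obtain ⟨hp0, hpg, hpt⟩ := hl p (by simp)
    simp only [List.map_cons, List.sum_cons] at hs ⊢
    rw [List.map_cons, List.nodup_cons] at hn
    have hrest : 0 ≤ (l.map fun p => p.2 ^ 2).sum := by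
      refine List.sum_nonneg fun x hx => ?_
      obtain ⟨q, _, rfl⟩ := List.mem_map.1 hx
      positivity
    have hle : p.2 ^ 2 ≤ ρ ^ 2 := by linarith
    have hpρ : p.2 ≤ ρ := by nlinarith
    have hsq : Real.sqrt (ρ ^ 2 - p.2 ^ 2) ^ 2 = ρ ^ 2 - p.2 ^ 2 := Real.sq_sqrt (by linarith)
    have hsin : ρ * Real.sin (Real.arcsin (p.2 / ρ)) = p.2 := by
      rcases hρ.eq_or_lt with h0 | h0
      · rw [← h0, zero_mul]; linarith
      · rw [Real.sin_arcsin (by have := div_nonneg hp0 hρ; linarith) ((div_le_one h0).2 hpρ)]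
        field_simp
    have hcos : ρ * Real.cos (Real.arcsin (p.2 / ρ)) = Real.sqrt (ρ ^ 2 - p.2 ^ 2) := by
      rw [Real.cos_arcsin]
      rcases hρ.eq_or_lt with h0 | h0
      · rw [← h0, zero_mul, eq_comm, Real.sqrt_eq_zero']
        nlinarith
      · nth_rw 1 [← Real.sqrt_sq hρ]
        rw [← Real.sqrt_mul (by positivity)]
        congr 1
        field_simp
    have hyp : y p.1 = false := hy p (by simp)
    have ih' := ih (Real.sqrt (ρ ^ 2 - p.2 ^ 2)) (Real.sqrt_nonneg _)
      (fun q hq => hl q (by simp [hq])) (by rw [hsq]; linarith) hn.2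
      (fun q hq => hy q (by simp [hq]))
    have hsub : ρ ^ 2 - p.2 ^ 2 - (l.map fun p => p.2 ^ 2).sum =
        ρ ^ 2 - (p.2 ^ 2 + (l.map fun p => p.2 ^ 2).sum) := by ring
    rw [hsq, hsub] at ih'
    have e1 : toggle (Function.update y p.1 true) tok
        (Function.update y p.1 true g && Function.update y p.1 true p.1) =
        Function.update (Function.update y tok false) p.1 true := by
      rw [toggle, Function.update_of_ne hpg.symm, Function.update_of_ne hpt.symm, hg, ht,
        Function.update_self, Function.update_comm hpt]
      simp
    have hidle : run G (chainC g tok l (Real.sqrt (ρ ^ 2 - p.2 ^ 2)))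
        (ket (Function.update (Function.update y tok false) p.1 true)) =
        ket (Function.update (Function.update y tok false) p.1 true) := by
      refine run_chainC_idle G hgt l _ (fun q hq => (hl q (by simp [hq])).2) _ ?_ (Or.inr ?_)
      · simp [Function.update_of_ne hpt.symm]
      · intro q hq
        have : q.1 ≠ p.1 := fun h => hn.1 (h ▸ List.mem_map_of_mem hq)
        rw [Function.update_of_ne this, Function.update_of_ne (hl q (by simp [hq])).2.2]
        exact hy q (by simp [hq])
    rw [chainC, run_append, run_append, run_reflC G hpt.symm, ht, if_pos rfl, hyp,
      if_neg (by simp), map_add, map_smul, map_smul, run_ccxC G hpg.symm hgt hpt,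
      run_ccxC G hpg.symm hgt hpt, e1, hyp, Bool.and_false, toggle_false, map_add, map_smul,
      map_smul, hidle, smul_add, smul_smul, smul_smul, ← Complex.ofReal_mul, ← Complex.ofReal_mul,
      hsin, hcos, ih']
    abel

/-! Costs of the elementary circuits. -/

omit [DecidableEq ι] in
@[simp] theorem cost_notC (q : ι) : QCircuit.cost (notC (n := n) q) = 1 := rfl

theorem cost_cxC (c t : ι) : QCircuit.cost (cxC (n := n) c t) ≤ 1 := by
  unfold cxC; split_ifs <;> simp [QCircuit.cost, Gate.cost]

theorem cost_ccxC (c₁ c₂ t : ι) : QCircuit.cost (ccxC (n := n) c₁ c₂ t) ≤ 1 := by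
  unfold ccxC; split_ifs <;> simp [QCircuit.cost, Gate.cost]

omit [DecidableEq ι] in
theorem cost_polC (q : ι) (s : Bool) : QCircuit.cost (polC (n := n) q s) ≤ 1 := by
  unfold polC; split_ifs <;> simp

theorem cost_litC (c₁ : ι) (s₁ : Bool) (c₂ : ι) (s₂ : Bool) (t : ι) :
    QCircuit.cost (litC (n := n) c₁ s₁ c₂ s₂ t) ≤ 5 := by
  have h1 := cost_polC (n := n) c₁ s₁
  have h2 := cost_polC (n := n) c₂ s₂
  have h3 := cost_ccxC (n := n) c₁ c₂ t
  simp only [litC, cost_append]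
  omega

theorem cost_reflC (c q : ι) (α : ℝ) : QCircuit.cost (reflC (n := n) c q α) ≤ 3 := by
  have := cost_cxC (n := n) c q
  simp only [reflC, cost_append, cost_cons, cost_nil, Gate.cost]
  omega

omit [DecidableEq ι] in
theorem cost_flatMap_le {β : Type*} (l : List β) (f : β → QCircuit n ι) (K : ℕ)
    (h : ∀ b ∈ l, QCircuit.cost (f b) ≤ K) : QCircuit.cost (l.flatMap f) ≤ l.length * K := by
  induction l with
  | nil => simp
  | cons b l ih =>
    have h1 := h b (by simp)
    have h2 := ih fun c hc => h c (by simp [hc])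
    rw [List.flatMap_cons, cost_append, List.length_cons, add_mul]
    omega

theorem cost_fanC (c : ι) (ts : List ι) : QCircuit.cost (fanC (n := n) c ts) ≤ ts.length := by
  simpa [fanC] using cost_flatMap_le ts (cxC (n := n) c) 1 fun t _ => cost_cxC c t

omit [DecidableEq ι] in
theorem cost_notsC (ts : List ι) : QCircuit.cost (notsC (n := n) ts) ≤ ts.length := by
  simpa [notsC] using cost_flatMap_le ts (notC (n := n)) 1 fun t _ => (cost_notC t).le

theorem cost_andC (anc : ℕ → ι) (l : List (ι × Bool)) (k : ℕ) (acc t : ι) :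
    QCircuit.cost (andC (n := n) anc l k acc t) ≤ 10 * l.length + 1 := by
  induction l generalizing k acc with
  | nil => simpa [andC] using cost_cxC acc t
  | cons p l ih =>
    have h1 := cost_litC (n := n) acc true p.1 p.2 (anc k)
    have h2 := ih (k + 1) (anc k)
    simp only [andC, cost_append, List.length_cons]
    omega

theorem cost_chainC (g tok : ι) (l : List (ι × ℝ)) (ρ : ℝ) :
    QCircuit.cost (chainC (n := n) g tok l ρ) ≤ 4 * l.length := by
  induction l generalizing ρ with
  | nil => simp [chainC]
  | cons p l ih =>
    have h1 := cost_reflC (n := n) tok p.1 (Real.arcsin (p.2 / ρ))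
    have h2 := cost_ccxC (n := n) g p.1 tok
    have h3 := ih (Real.sqrt (ρ ^ 2 - p.2 ^ 2))
    simp only [chainC, cost_append, List.length_cons]
    omega

end Elementary

/-! ### Changing the set of qubits -/

section Embedding

variable {n : ℕ} {ι κ : Type} [DecidableEq ι] [DecidableEq κ] (G : SimpleGraph (Fin n))

/-- The gate with its qubits renamed. -/
def Gate.map (j : ι → κ) (hj : Function.Injective j) : Gate n ι → Gate n κ
  | .single q V => .single (j q) V
  | .cnot c t h => .cnot (j c) (j t) (hj.ne h)
  | .toffoli c₁ c₂ t h h₁ h₂ => .toffoli (j c₁) (j c₂) (j t) (hj.ne h) (hj.ne h₁) (hj.ne h₂)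
  | .query a b t hab ha hb => .query (j ∘ a) (j ∘ b) (j t)
      (by rw [← Sum.comp_elim]; exact hj.comp hab) (fun i => hj.ne (ha i)) (fun i => hj.ne (hb i))

/-- The circuit with its qubits renamed. -/
def QCircuit.rename (j : ι → κ) (hj : Function.Injective j) (c : QCircuit n ι) : QCircuit n κ :=
  c.map (Gate.map j hj)

/-- Superpositions of states of the qubits `ι`, as superpositions of states of more qubits, the others
of which are in the state `y₀`. -/
noncomputable def lift (j : ι → κ) (y₀ : κ → Bool) : Vec ι →ₗ[ℂ] Vec κ :=
  Finsupp.lmapDomain ℂ ℂ fun y => Function.extend j y y₀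

omit [DecidableEq ι] [DecidableEq κ] in
@[simp] theorem lift_ket (j : ι → κ) (y₀ : κ → Bool) (y : ι → Bool) :
    lift j y₀ (ket y) = ket (Function.extend j y y₀) := by
  simp [lift, ket, Finsupp.mapDomain_single]

omit [DecidableEq ι] [DecidableEq κ] in
theorem extend_injective_left {j : ι → κ} (hj : Function.Injective j) (y₀ : κ → Bool) :
    Function.Injective fun y : ι → Bool => Function.extend j y y₀ := by
  intro y z h
  funext i
  have := congrFun h (j i)
  simpa [hj.extend_apply] using this

omit [DecidableEq ι] [DecidableEq κ] in
theorem lift_apply {j : ι → κ} (hj : Function.Injective j) (y₀ : κ → Bool) (φ : Vec ι)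
    (x : ι → Bool) : lift j y₀ φ (Function.extend j x y₀) = φ x :=
  Finsupp.mapDomain_apply (extend_injective_left hj y₀) φ x

omit [DecidableEq ι] [DecidableEq κ] in
theorem lift_apply_of_notMem {j : ι → κ} {y₀ : κ → Bool} (φ : Vec ι) {x : κ → Bool} {q : κ}
    (hq : ∀ i, j i ≠ q) (hx : x q ≠ y₀ q) : lift j y₀ φ x = 0 := by
  refine Finsupp.mapDomain_of_notMem_range φ x ?_
  rintro ⟨z, rfl⟩
  refine hx (Function.extend_apply' _ _ _ ?_)
  rintro ⟨i, hi⟩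
  exact hq i hi

theorem extend_update {j : ι → κ} (hj : Function.Injective j) (y : ι → Bool) (y₀ : κ → Bool) (q : ι)
    (b : Bool) :
    Function.extend j (Function.update y q b) y₀ = Function.update (Function.extend j y y₀) (j q) b := by
  funext k
  by_cases hk : ∃ i, j i = k
  · obtain ⟨i, rfl⟩ := hk
    simp [hj.extend_apply, Function.update_apply, hj.eq_iff]
  · have : k ≠ j q := fun h => hk ⟨q, h.symm⟩
    rw [Function.extend_apply' _ _ _ hk, Function.update_of_ne this, Function.extend_apply' _ _ _ hk]

theorem extend_toggle {j : ι → κ} (hj : Function.Injective j) (y : ι → Bool) (y₀ : κ → Bool) (q : ι)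
    (b : Bool) :
    Function.extend j (toggle y q b) y₀ = toggle (Function.extend j y y₀) (j q) b := by
  rw [toggle, extend_update hj, toggle, hj.extend_apply]

theorem Gate.onKet_map {j : ι → κ} (hj : Function.Injective j) (y₀ : κ → Bool) (g : Gate n ι)
    (y : ι → Bool) :
    (g.map j hj).onKet G (Function.extend j y y₀) = lift j y₀ (g.onKet G y) := by
  cases g with
  | single q V => simp [Gate.map, Gate.onKet, hj.extend_apply, extend_update hj]
  | cnot c t h => simp [Gate.map, Gate.onKet, hj.extend_apply, extend_toggle hj]
  | toffoli c₁ c₂ t h h₁ h₂ => simp [Gate.map, Gate.onKet, hj.extend_apply, extend_toggle hj]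
  | query a b t hab ha hb =>
    have : answer G (j ∘ a) (j ∘ b) (Function.extend j y y₀) = answer G a b y := by
      unfold answer
      rw [decide_eq_decide]
      simp [HoldsVertex, hj.extend_apply]
    simp [Gate.map, Gate.onKet, this, extend_toggle hj]

theorem run_rename {j : ι → κ} (hj : Function.Injective j) (y₀ : κ → Bool) (c : QCircuit n ι)
    (φ : Vec ι) : run G (c.rename j hj) (lift j y₀ φ) = lift j y₀ (run G c φ) := by
  induction c generalizing φ with
  | nil => rfl
  | cons g c ih =>
    have h1 : run G [g.map j hj] ∘ₗ lift j y₀ = lift j y₀ ∘ₗ run G [g] := by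
      ext y : 1
      refine LinearMap.ext_ring ?_
      have := Gate.onKet_map G hj y₀ g y
      rw [← run_singleton_ket, ← run_singleton_ket, ← lift_ket] at this
      exact this
    have h2 := LinearMap.congr_fun h1 φ
    simp only [LinearMap.comp_apply] at h2
    rw [QCircuit.rename, List.map_cons, run_cons, h2, run_cons G g c]
    exact ih _

omit [DecidableEq ι] [DecidableEq κ] in
theorem cost_rename {j : ι → κ} (hj : Function.Injective j) (c : QCircuit n ι) :
    QCircuit.cost (c.rename j hj) = QCircuit.cost c := by
  induction c with
  | nil => rfl
  | cons g c ih =>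
    rw [QCircuit.rename, List.map_cons, cost_cons, cost_cons g c]
    congr 1
    cases g <;> rfl

/-- The qubits on which a gate acts. -/
def Gate.qubits : Gate n κ → Finset κ
  | .single q _ => {q}
  | .cnot c t _ => {c, t}
  | .toffoli c₁ c₂ t _ _ _ => {c₁, c₂, t}
  | .query a b t _ _ _ => Finset.univ.image a ∪ Finset.univ.image b ∪ {t}

/-- The qubits on which a circuit acts. -/
def QCircuit.qubits : QCircuit n κ → Finset κ
  | [] => ∅
  | g :: c => g.qubits ∪ QCircuit.qubits c

/-- A query touches `2 * vertexBits n + 1` qubits; this bounds their number by three times its cost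
`n`. -/
theorem clog_two_le (n : ℕ) (hn : 1 ≤ n) : Nat.clog 2 n + 1 ≤ n := by
  have h := Nat.clog_le_of_le_pow (b := 2) (x := n) (y := n - 1)
    (by have := @Nat.lt_two_pow_self (n - 1); omega)
  omega

/-- The sign flip in a reflection tests every work qubit, so their number has to be controlled by
the cost. -/
theorem card_qubits_le (hn : 1 ≤ n) (c : QCircuit n κ) :
    (QCircuit.qubits c).card ≤ 3 * QCircuit.cost c := by
  induction c with
  | nil => simp [QCircuit.qubits]
  | cons g c ih =>
    have h : g.qubits.card ≤ 3 * g.cost := by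
      cases g with
      | single q V => simp [Gate.qubits, Gate.cost]
      | cnot c t h => exact (Finset.card_le_two).trans (by simp [Gate.cost])
      | toffoli c₁ c₂ t h h₁ h₂ => exact Finset.card_le_three
      | query a b t hab ha hb =>
        have h1 := Finset.card_union_le (Finset.univ.image a ∪ Finset.univ.image b) {t}
        have h2 := Finset.card_union_le (Finset.univ.image a) (Finset.univ.image b)
        have h3 := Finset.card_image_le (s := Finset.univ) (f := a)
        have h4 := Finset.card_image_le (s := Finset.univ) (f := b)
        have h5 := clog_two_le n hn
        rw [Finset.card_univ, Fintype.card_fin] at h3 h4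
        have hv : vertexBits n = Nat.clog 2 n := rfl
        rw [Finset.card_singleton] at h1
        simp only [Gate.qubits, Gate.cost]
        omega
    have := Finset.card_union_le g.qubits (QCircuit.qubits c)
    rw [QCircuit.qubits, cost_cons]
    omega

omit [DecidableEq ι] in
theorem Gate.exists_map {j : ι → κ} (hj : Function.Injective j) (g : Gate n κ)
    (h : ∀ q ∈ g.qubits, ∃ i, j i = q) : ∃ g₀ : Gate n ι, g₀.map j hj = g := by
  cases g with
  | single q V =>
    obtain ⟨q, rfl⟩ := h q (by simp [Gate.qubits])
    exact ⟨.single q V, rfl⟩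
  | cnot c t hct =>
    obtain ⟨c, rfl⟩ := h c (by simp [Gate.qubits])
    obtain ⟨t, rfl⟩ := h t (by simp [Gate.qubits])
    exact ⟨.cnot c t (fun e => hct (congrArg j e)), rfl⟩
  | toffoli c₁ c₂ t h0 h₁ h₂ =>
    obtain ⟨c₁, rfl⟩ := h c₁ (by simp [Gate.qubits])
    obtain ⟨c₂, rfl⟩ := h c₂ (by simp [Gate.qubits])
    obtain ⟨t, rfl⟩ := h t (by simp [Gate.qubits])
    exact ⟨.toffoli c₁ c₂ t (fun e => h0 (congrArg j e)) (fun e => h₁ (congrArg j e))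
      (fun e => h₂ (congrArg j e)), rfl⟩
  | query a b t hab ha hb =>
    have h1 : ∀ i, ∃ q, j q = a i := fun i => h _ (by simp [Gate.qubits])
    have h2 : ∀ i, ∃ q, j q = b i := fun i => h _ (by simp [Gate.qubits])
    obtain ⟨t, rfl⟩ := h t (by simp [Gate.qubits])
    choose a' ha' using h1
    choose b' hb' using h2
    obtain rfl : j ∘ a' = a := funext ha'
    obtain rfl : j ∘ b' = b := funext hb'
    refine ⟨.query a' b' t ?_ (fun i e => ha i (congrArg j e)) (fun i e => hb i (congrArg j e)), rfl⟩
    rw [← Sum.comp_elim] at hab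
    exact hab.of_comp

omit [DecidableEq ι] in
theorem QCircuit.exists_rename {j : ι → κ} (hj : Function.Injective j) (c : QCircuit n κ)
    (h : ∀ q ∈ QCircuit.qubits c, ∃ i, j i = q) :
    ∃ c₀ : QCircuit n ι, c₀.rename j hj = c := by
  induction c with
  | nil => exact ⟨[], rfl⟩
  | cons g c ih =>
    obtain ⟨g₀, h₀⟩ := g.exists_map hj fun q hq => h q (by simp [QCircuit.qubits, hq])
    obtain ⟨c₀, h₁⟩ := ih fun q hq => h q (by simp [QCircuit.qubits, hq])
    exact ⟨g₀ :: c₀, by rw [← h₀, ← h₁]; rfl⟩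

omit [DecidableEq ι] in
/-- Every circuit uses only finitely many work qubits. -/
theorem QCircuit.exists_finite (hn : 1 ≤ n) {jw : ι → κ} (hj : Function.Injective jw)
    (c : QCircuit n κ) :
    ∃ (a : ℕ) (c₀ : QCircuit n (ι ⊕ Fin a)) (j : ι ⊕ Fin a → κ) (hj' : Function.Injective j),
      c₀.rename j hj' = c ∧ (∀ i, j (Sum.inl i) = jw i) ∧ a ≤ 3 * QCircuit.cost c := by
  classical
  obtain ⟨S, hS⟩ : ∃ S : Finset κ, S = (QCircuit.qubits c).filter fun q => ∀ i, jw i ≠ q :=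
    ⟨_, rfl⟩
  have hinj : Function.Injective (Sum.elim jw fun b => ((S.equivFin.symm b : S) : κ)) := by
    refine hj.sumElim (Subtype.val_injective.comp S.equivFin.symm.injective) fun i b h => ?_
    have := (S.equivFin.symm b).2
    simp only [hS, Finset.mem_filter] at this
    exact this.2 i (by simpa only [hS] using h)
  obtain ⟨c₀, h₀⟩ := QCircuit.exists_rename hinj c fun q hq => by
    by_cases h : ∃ i, jw i = q
    · obtain ⟨i, hi⟩ := h
      exact ⟨Sum.inl i, hi⟩
    · have : q ∈ S := by
        rw [hS, Finset.mem_filter]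
        exact ⟨hq, fun i hi => h ⟨i, hi⟩⟩
      exact ⟨Sum.inr (S.equivFin ⟨q, this⟩), by simp⟩
  exact ⟨S.card, c₀, _, hinj, h₀, fun i => rfl,
    (hS ▸ Finset.card_filter_le _ _).trans (card_qubits_le hn c)⟩

omit [DecidableEq ι] [DecidableEq κ] in
theorem extend_sumElim {a : ℕ} {jw : ι → κ} {j : ι ⊕ Fin a → κ} (hj : Function.Injective j)
    (h : ∀ i, j (Sum.inl i) = jw i) (y : ι → Bool) :
    Function.extend j (Sum.elim y fun _ => false) (fun _ => false) =
      Function.extend jw y fun _ => false := by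
  have hw : Function.Injective jw := by
    intro x z e
    rw [← h, ← h] at e
    exact Sum.inl_injective (hj e)
  funext k
  by_cases hk : ∃ i, j i = k
  · obtain ⟨i, rfl⟩ := hk
    rw [hj.extend_apply]
    rcases i with i | b
    · rw [h, hw.extend_apply, Sum.elim_inl]
    · rw [Function.extend_apply', Sum.elim_inr]
      rintro ⟨i, hi⟩
      rw [← h] at hi
      simpa using hj hi
  · rw [Function.extend_apply' _ _ _ hk, Function.extend_apply']
    rintro ⟨i, hi⟩
    exact hk ⟨Sum.inl i, by rw [h, hi]⟩

theorem eval_of_rename [Fintype ι] {a : ℕ} {jw : ι → κ} (hw : Function.Injective jw)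
    {j : ι ⊕ Fin a → κ} (hj : Function.Injective j)
    (h : ∀ i, j (Sum.inl i) = jw i) (c₀ : QCircuit n (ι ⊕ Fin a)) (y : ι → Bool) (φ : Vec ι)
    (hφ : run G (c₀.rename j hj) (ket (Function.extend jw y fun _ => false)) =
      lift jw (fun _ => false) φ) (x : ι ⊕ Fin a → Bool) :
    QCircuit.eval G c₀ x (Sum.elim y fun _ => false) =
      if ∀ i, x (Sum.inr i) = false then φ (fun q => x (Sum.inl q)) else 0 := by
  rw [← extend_sumElim hj h, ← lift_ket, run_rename] at hφ
  rw [← run_ket_apply, ← lift_apply hj (fun _ => false), hφ]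
  split_ifs with hx
  · have : x = Sum.elim (fun q => x (Sum.inl q)) fun _ => false := by
      funext q
      rcases q with q | i
      · rfl
      · exact hx i
    rw [this, extend_sumElim hj h, lift_apply hw]
    rfl
  · push Not at hx
    obtain ⟨i, hi⟩ := hx
    refine lift_apply_of_notMem φ (q := j (Sum.inr i)) (fun k hk => ?_) ?_
    · rw [← h] at hk
      simpa using hj hk
    · rw [hj.extend_apply]
      exact hi

/-- A circuit that returns the work qubits to `0` implements a unitary. -/
theorem QCircuit.Implements.of_rename [Fintype ι] {a : ℕ} {jw : ι → κ} (hw : Function.Injective jw)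
    {j : ι ⊕ Fin a → κ} (hj : Function.Injective j)
    (h : ∀ i, j (Sum.inl i) = jw i) (c₀ : QCircuit n (ι ⊕ Fin a)) (φ : (ι → Bool) → Vec ι)
    (hφ : ∀ y, run G (c₀.rename j hj) (ket (Function.extend jw y fun _ => false)) =
      lift jw (fun _ => false) (φ y)) :
    Matrix.of (fun x y => φ y x) ∈ Matrix.unitaryGroup (ι → Bool) ℂ ∧
      c₀.Implements G (Matrix.of fun x y => φ y x) := by
  have key := fun y => eval_of_rename G hw hj h c₀ y (φ y) (hφ y)
  refine ⟨?_, fun x y => key y x⟩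
  -- The columns of this matrix are columns of the unitary of the whole circuit, with only zero
  -- entries (nonzero work qubits) left out; so their inner products are unchanged.
  rw [Matrix.mem_unitaryGroup_iff']
  ext y z
  have hE := congrFun (congrFun (conjTranspose_eval_mul_eval G c₀) (Sum.elim y fun _ => false))
    (Sum.elim z fun _ => false)
  have hone : (1 : Matrix (ι ⊕ Fin a → Bool) (ι ⊕ Fin a → Bool) ℂ) (Sum.elim y fun _ => false)
      (Sum.elim z fun _ => false) = (1 : Matrix (ι → Bool) (ι → Bool) ℂ) y z := by
    rw [Matrix.one_apply, Matrix.one_apply]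
    congr 1
    rw [eq_iff_iff]
    refine ⟨fun e => funext fun q => ?_, fun e => by rw [e]⟩
    simpa using congrFun e (Sum.inl q)
  rw [hone] at hE
  rw [← hE, Matrix.mul_apply, Matrix.mul_apply]
  simp only [Matrix.star_apply, Matrix.conjTranspose_apply, key, Matrix.of_apply]
  refine Finset.sum_of_injOn (fun x : ι → Bool => Sum.elim x fun _ => false) ?_ (by simp) ?_ ?_
  · intro x _ x' _ e
    funext q
    simpa using congrFun e (Sum.inl q)
  · intro x _ hx
    rw [if_neg, star_zero, zero_mul]
    intro h0
    refine hx ⟨fun q => x (Sum.inl q), by simp, ?_⟩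
    funext q
    rcases q with q | i
    · rfl
    · exact (h0 i).symm
  · intro x _
    simp

/-! ### Reflections about a family of states -/

/-- Flips the sign of the basis state in which all the qubits of the list are `0`. -/
noncomputable def signC (l : List ι) : QCircuit n (ι ⊕ ℕ) :=
  notC (Sum.inr 0) ++ notC (Sum.inr 1) ++ reflC (Sum.inr 0) (Sum.inr 1) (Real.pi / 4) ++
    andC (fun k => Sum.inr (k + 2)) (l.map fun q => (Sum.inl q, false)) 0 (Sum.inr 0) (Sum.inr 1) ++
    reflC (Sum.inr 0) (Sum.inr 1) (Real.pi / 4) ++ notC (Sum.inr 1) ++ notC (Sum.inr 0)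

/-- Phase kickback: the auxiliary qubit 1 is brought to (|0⟩ - |1⟩)/√2 by a Hadamard gate, which is
controlled by the auxiliary qubit 0 in state 1. The conjunction then flips the auxiliary qubit 1,
which produces the sign. -/
theorem run_signC (l : List ι) (y : ι → Bool) :
    run G (signC l) (ket (Sum.elim y fun _ => false)) =
      (if ∀ q ∈ l, y q = false then (-1 : ℂ) else 1) • ket (Sum.elim y fun _ => false) := by
  obtain ⟨z, hz⟩ : ∃ z : ι ⊕ ℕ → Bool, z = Sum.elim y fun _ => false := ⟨_, rfl⟩
  have hzl : ∀ q, z (Sum.inl q) = y q := fun q => by rw [hz]; rfl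
  have hzr : ∀ k, z (Sum.inr k) = false := fun q => by rw [hz]; rfl
  rw [← hz]
  clear hz
  obtain ⟨s, hs⟩ : ∃ s : ℂ, s = (Real.sin (Real.pi / 4) : ℂ) := ⟨_, rfl⟩
  have hc : (Real.cos (Real.pi / 4) : ℂ) = s := by
    rw [hs, Real.cos_pi_div_four, Real.sin_pi_div_four]
  have hss : s * s + s * s = 1 := by
    rw [hs, Real.sin_pi_div_four]
    norm_cast
    rw [← mul_div_mul_comm, Real.mul_self_sqrt (by norm_num)]; norm_num
  obtain ⟨y1, hy1⟩ : ∃ y1 : ι ⊕ ℕ → Bool,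
      y1 = Function.update z (Sum.inr 0) true := ⟨_, rfl⟩
  have h10 : y1 (Sum.inr 0) = true := by simp [hy1]
  have hset0 : Function.update (Function.update y1 (Sum.inr 1) true) (Sum.inr 1) false = y1 := by
    rw [Function.update_idem, Function.update_eq_self_iff, hy1]
    simp [hzr]
  have hand : ∀ b, run G (andC (fun k => Sum.inr (k + 2))
      (l.map fun q => ((Sum.inl q : ι ⊕ ℕ), false)) 0 (Sum.inr 0) (Sum.inr 1))
      (ket (Function.update y1 (Sum.inr 1) b)) =
      ket (Function.update y1 (Sum.inr 1) (xor b (decide (∀ q ∈ l, y q = false)))) := by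
    intro b
    rw [run_andC]
    · refine ket_congr fun q => ?_
      have : ((Function.update y1 (Sum.inr 1) b (Sum.inr 0)) &&
          ((l.map fun q => ((Sum.inl q : ι ⊕ ℕ), false)).all
            fun p => Function.update y1 (Sum.inr 1) b p.1 == p.2)) =
          decide (∀ q ∈ l, y q = false) := by
        rw [Bool.eq_iff_iff]
        simp [hy1, hzl]
      rw [this]
      simp [toggle]
    · intro a b h
      simpa using h
    · simp
    · intro j _; simp
    · intro j _; simp
    · intro p hp
      obtain ⟨q, _, rfl⟩ := List.mem_map.1 hp
      simp
    · intro j _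
      simp [hy1, hzr]
  have e0 : toggle (toggle z (Sum.inr 0) true) (Sum.inr 1) true =
      Function.update y1 (Sum.inr 1) true := by
    simp [toggle, hy1, hzr]
  have e1 : toggle (toggle (Function.update y1 (Sum.inr 1) true) (Sum.inr 1) true) (Sum.inr 0) true =
      z := by
    funext q
    rcases q with q | _ | _ | k <;> simp [toggle_apply, hy1, hzl, hzr]
  have hr : ∀ b, run G (reflC (Sum.inr 0) (Sum.inr 1) (Real.pi / 4))
      (ket (Function.update y1 (Sum.inr 1) b)) =
      s • ket (Function.update y1 (Sum.inr 1) false) +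
        (if b then -s else s) • ket (Function.update y1 (Sum.inr 1) true) := by
    intro b
    rw [run_reflC G (by simp), Function.update_of_ne (by simp), h10, if_pos rfl,
      Function.update_self, hc, ← hs]
    cases b
    · simp
    · simp [sub_eq_add_neg]
  simp only [signC, run_append, run_notC, e0, hr, if_true, map_add, map_smul, hand]
  by_cases hl : ∀ q ∈ l, y q = false
  · rw [if_pos hl, decide_eq_true hl]
    simp only [Bool.xor_true, Bool.not_false, Bool.not_true, if_true,
      if_false, e1, Bool.false_eq_true]
    calc _ = (-(s * s + s * s)) • ket z := by module
      _ = _ := by rw [hss]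
  · rw [if_neg hl, decide_eq_false hl]
    simp only [Bool.xor_false, if_true, if_false,
      e1, Bool.false_eq_true]
    calc _ = (s * s + s * s) • ket z := by module
      _ = _ := by rw [hss]

theorem cost_signC (l : List ι) : QCircuit.cost (signC (n := n) l) ≤ 10 * l.length + 11 := by
  have h1 := cost_reflC (n := n) (Sum.inr 0 : ι ⊕ ℕ) (Sum.inr 1) (Real.pi / 4)
  have h2 := cost_andC (n := n) (fun k => (Sum.inr (k + 2) : ι ⊕ ℕ))
    (l.map fun q => (Sum.inl q, false)) 0 (Sum.inr 0) (Sum.inr 1)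
  rw [List.length_map] at h2
  simp only [signC, cost_append, cost_notC]
  omega

end Embedding

section Reflection

variable {n : ℕ} {ι κ : Type} [DecidableEq ι] [DecidableEq κ] [Fintype ι]

/-- The assignment `y` with the qubits outside `D` reset to `0`. -/
def keepOnly (D : ι → Bool) (y : ι → Bool) : ι → Bool := fun q => D q && y q

/-- The unitary `1 - 2 ∑ |V σ⟩⟨V σ|`, where `σ` ranges over the basis states that vanish
outside `D`. -/
noncomputable def householder (D : ι → Bool) (V : (ι → Bool) → Vec ι) :
    Matrix (ι → Bool) (ι → Bool) ℂ :=
  Matrix.of fun x y => (if x = y then 1 else 0) -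
    2 * V (keepOnly D y) x * star (V (keepOnly D y) y)

/-- If a circuit prepares the state `V σ` from a basis state `σ` that vanishes outside `D`, without
changing the qubits in `D`, then the reflection about these states is implemented by a circuit. -/
theorem exists_householder (hn : 1 ≤ n) {jw : ι → κ} (hw : Function.Injective jw)
    (c : QCircuit n κ) (D : ι → Bool) :
    ∃ (a : ℕ) (circ : QCircuit n (ι ⊕ Fin a)),
      QCircuit.cost circ ≤ 32 * QCircuit.cost c + 10 * Fintype.card ι + 11 ∧
      ∀ (G : SimpleGraph (Fin n)) (V : (ι → Bool) → Vec ι),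
        (∀ σ, keepOnly D σ = σ → run G c (ket (Function.extend jw σ fun _ => false)) =
          lift jw (fun _ => false) (V σ)) →
        (∀ σ x, keepOnly D σ = σ → V σ x ≠ 0 → keepOnly D x = σ) →
        householder D V ∈ Matrix.unitaryGroup (ι → Bool) ℂ ∧
          circ.Implements G (householder D V) := by
  -- The circuit runs twice, forwards and backwards, and the sign flip costs 10 for each of at most
  -- `3 * cost` work qubits; this is the constant 32 = 2 + 10 * 3.
  obtain ⟨a, c₀, j, hj, rfl, hjw, ha⟩ := QCircuit.exists_finite hn hw c
  rw [cost_rename] at ha ⊢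
  have hinl : Function.Injective (Sum.inl : ι ⊕ Fin a → (ι ⊕ Fin a) ⊕ ℕ) := Sum.inl_injective
  set l : List (ι ⊕ Fin a) := (Finset.univ.filter fun q : ι ⊕ Fin a =>
    Sum.elim D (fun _ => false) q = false).toList with hl
  -- The basis states that are 0 on the list `l` are exactly the inputs |σ⟩|0⟩ from which the states
  -- V σ are prepared, so conjugating the sign flip by the circuit gives 1 - 2 ∑ |V σ⟩⟨V σ| on the
  -- states with clean work qubits.
  set R : QCircuit n ((ι ⊕ Fin a) ⊕ ℕ) :=
    c₀.inv.rename Sum.inl hinl ++ signC l ++ c₀.rename Sum.inl hinl with hR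
  have hw' : Function.Injective fun q : ι => (Sum.inl (Sum.inl q) : (ι ⊕ Fin a) ⊕ ℕ) :=
    Sum.inl_injective.comp Sum.inl_injective
  obtain ⟨b, circ, j', hj', hcirc, hjw', -⟩ := QCircuit.exists_finite hn hw' R
  refine ⟨b, circ, ?_, fun G V hV hsupp => ?_⟩
  · rw [← cost_rename hj', hcirc, hR, cost_append, cost_append, cost_rename, cost_rename, cost_inv]
    have h1 := cost_signC (n := n) l
    have h2 : l.length ≤ Fintype.card ι + a := by
      rw [hl, Finset.length_toList]
      refine (Finset.card_filter_le _ _).trans ?_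
      simp
    omega
  · have hext : ∀ y : ι → Bool, Function.extend (fun q : ι => (Sum.inl (Sum.inl q) : (ι ⊕ Fin a) ⊕ ℕ))
        y (fun _ => false) =
        Function.extend Sum.inl (Sum.elim y fun _ => false) (fun _ => false) := by
      intro y
      funext q
      rcases q with (q | q) | q
      · rw [hinl.extend_apply]
        exact hw'.extend_apply _ _ q
      · rw [hinl.extend_apply, Function.extend_apply' _ _ _ (by simp), Sum.elim_inr]
      · rw [Function.extend_apply' _ _ _ (by simp), Function.extend_apply' _ _ _ (by simp)]
    have hlift : ∀ φ : Vec ι,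
        lift (fun q : ι => (Sum.inl (Sum.inl q) : (ι ⊕ Fin a) ⊕ ℕ)) (fun _ => false) φ =
        lift Sum.inl (fun _ => false) (lift Sum.inl (fun _ => false) φ : Vec (ι ⊕ Fin a)) := by
      intro φ
      rw [vec_eq_sum φ, map_sum, map_sum, map_sum]
      refine Finset.sum_congr rfl fun z _ => ?_
      rw [map_smul, map_smul, map_smul, lift_ket, lift_ket, lift_ket, hext]
      congr 3
      funext q
      rcases q with q | q
      · rw [Sum.inl_injective.extend_apply, Sum.elim_inl]
      · rw [Function.extend_apply' _ _ _ (by simp), Sum.elim_inr]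
    have hE := fun (σ : ι → Bool) hσ => eval_of_rename G hw hj hjw c₀ σ (V σ) (hV σ hσ)
    set P : (ι ⊕ Fin a → Bool) → Prop := fun z => ∀ q ∈ l, z q = false with hP
    have hPz : ∀ σ : ι → Bool, keepOnly D σ = σ → P (Sum.elim σ fun _ => false) := by
      intro σ hσ q hq
      rw [hl, Finset.mem_toList, Finset.mem_filter] at hq
      rcases q with q | q
      · rw [Sum.elim_inl, ← hσ, keepOnly, show D q = false from hq.2, Bool.false_and]
      · rfl
    have hPz' : ∀ z, P z → ∃ σ : ι → Bool, keepOnly D σ = σ ∧ z = Sum.elim σ fun _ => false := by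
      intro z hz
      refine ⟨fun q => z (Sum.inl q), funext fun q => ?_, funext fun q => ?_⟩
      · rw [keepOnly]
        rcases hD : D q with _ | _
        · have : z (Sum.inl q) = false := hz _ (by simp [hl, hD])
          simp [this]
        · simp
      · rcases q with q | q
        · rfl
        · exact hz _ (by simp [hl])
    have main : ∀ y : ι → Bool, run G (circ.rename j' hj')
        (ket (Function.extend (fun q : ι => (Sum.inl (Sum.inl q) : (ι ⊕ Fin a) ⊕ ℕ)) y
          fun _ => false)) =
        lift (fun q : ι => (Sum.inl (Sum.inl q) : (ι ⊕ Fin a) ⊕ ℕ)) (fun _ => false)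
          (ket y - (2 * star (V (keepOnly D y) y)) • V (keepOnly D y)) := by
      intro y
      classical
      have hkk : keepOnly D (keepOnly D y) = keepOnly D y := by
        funext q
        simp [keepOnly]
      set y' : ι ⊕ Fin a → Bool := Sum.elim y fun _ => false with hy'
      set φ : Vec (ι ⊕ Fin a) := run G c₀.inv (ket y') with hφ
      have hφ0 : ∀ z, φ z = star (QCircuit.eval G c₀ y' z) := by
        intro z
        rw [hφ, run_ket_apply, eval_inv, Matrix.conjTranspose_apply]
      have hcφ : run G c₀ φ = ket y' := by
        have h := run_inv G c₀.inv (ket y')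
        rwa [show c₀.inv.inv = c₀ from ?_] at h
        rw [QCircuit.inv, QCircuit.inv, List.map_reverse, List.reverse_reverse, List.map_map]
        conv_rhs => rw [← List.map_id c₀]
        refine List.map_congr_left fun g _ => ?_
        cases g <;> simp [Gate.inv]
      have hsign : ∀ z : ι ⊕ Fin a → Bool, run G (signC l) (lift Sum.inl (fun _ => false) (ket z)) =
          (if P z then (-1 : ℂ) else 1) • lift Sum.inl (fun _ => false) (ket z) := by
        intro z
        have : Function.extend Sum.inl z (fun _ => false) =
            (Sum.elim z fun _ => false : (ι ⊕ Fin a) ⊕ ℕ → Bool) := by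
          funext q
          rcases q with q | q
          · rw [hinl.extend_apply, Sum.elim_inl]
          · rw [Function.extend_apply' _ _ _ (by simp), Sum.elim_inr]
        rw [lift_ket, this, run_signC]
        by_cases hz : P z
        · rw [if_pos hz, if_pos hz]
        · rw [if_neg hz, if_neg hz]
      have hsum : run G (signC l) (lift Sum.inl (fun _ => false) φ) =
          lift Sum.inl (fun _ => false) (φ - (2 : ℂ) • ∑ z, if P z then φ z • ket z else 0) := by
        conv_lhs => rw [vec_eq_sum φ]
        conv_rhs => rw [vec_eq_sum φ]
        simp only [map_sum, map_sub, map_smul, Finset.smul_sum, hsign]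
        rw [← Finset.sum_sub_distrib]
        refine Finset.sum_congr rfl fun z _ => ?_
        rw [← vec_eq_sum φ]
        split_ifs
        · rw [map_smul]; module
        · simp
      -- With φ the image of |y⟩ under the inverse circuit, its amplitude at |σ⟩|0⟩ is the conjugate
      -- of V σ at y. Since V σ is supported on states that agree with σ on `D`, only σ = `keepOnly
      -- D y` survives.
      have hdiag : run G c₀ (∑ z, if P z then φ z • ket z else 0) =
          star (V (keepOnly D y) y) • lift Sum.inl (fun _ => false) (V (keepOnly D y)) := by
        have hzero : ∀ z, P z → z ≠ (Sum.elim (keepOnly D y) fun _ => false) → φ z = 0 := by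
          intro z hz hne
          obtain ⟨σ, hσ, rfl⟩ := hPz' z hz
          rw [hφ0, hE σ hσ, if_pos (by simp [hy'])]
          by_contra h0
          have h1 : V σ y ≠ 0 := fun h => h0 (by simp [hy', h])
          exact hne (by rw [hsupp σ y hσ h1])
        rw [Finset.sum_eq_single (Sum.elim (keepOnly D y) fun _ => false)]
        · rw [if_pos (hPz _ hkk), map_smul, hφ0, hE _ hkk, if_pos (by simp [hy'])]
          congr 1
          ext x
          rw [run_ket_apply, hE _ hkk]
          split_ifs with hx
          · have : x = Function.extend Sum.inl (fun q => x (Sum.inl q)) (fun _ => false) := by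
              funext q
              rcases q with q | q
              · rw [Sum.inl_injective.extend_apply]
              · rw [Function.extend_apply' _ _ _ (by simp), hx]
            conv_rhs => rw [this]
            rw [lift_apply Sum.inl_injective]
          · push Not at hx
            obtain ⟨i, hi⟩ := hx
            exact (lift_apply_of_notMem _ (q := Sum.inr i) (by simp) hi).symm
        · intro z _ hz
          split_ifs with hPz
          · rw [hzero z hPz hz, zero_smul]
          · rfl
        · simp
      rw [hcirc, hR, hext, ← lift_ket, ← hy', run_append, run_append, run_rename, ← hφ, hsum,
        run_rename, map_sub, map_smul, hcφ, hdiag, hlift, smul_smul]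
      congr 1
      rw [map_sub, map_smul, lift_ket]
      congr 2
      funext q
      rcases q with q | q
      · rw [Sum.inl_injective.extend_apply, hy', Sum.elim_inl]
      · rw [Function.extend_apply' _ _ _ (by simp), hy', Sum.elim_inr]
    have := QCircuit.Implements.of_rename G hw' hj' hjw' circ _ main
    convert this using 2
    all_goals
      ext x y
      simp only [householder, Matrix.of_apply, Finsupp.sub_apply, Finsupp.smul_apply, ket_apply,
        smul_eq_mul]
      ring

end Reflection

/-! ### Registers -/

/-- The qubits of the circuits below: the qubits of the simplex registers (`x`, `xs` and `y`, `ys`) and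
of the index registers (`i1`, `f1`, `g1`, `h1`, `d1` and `i2`, `f2`, `g2`, `h2`, `d2`), and work
qubits. -/
inductive Qb (n : ℕ) : Type
  | x (v : Fin n) | xs (k : Fin 2) | y (v : Fin n) | ys (k : Fin 2)
  | i1 (b : ℕ) | i2 (b : ℕ) | f1 | g1 | h1 | d1 | f2 | g2 | h2 | d2
  | a (p : Fin n × Fin n) | e (p : Fin n × Fin n)
  | r (b : ℕ) | t (b : ℕ) | m (b : ℕ) | c (b : ℕ) | o (b : ℕ) | anc (b : ℕ) | par (b : ℕ)
  | vert (b : ℕ) | viol (v : Fin n) | tok | tmp | ok | qa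
  deriving DecidableEq

section Registers

variable {n : ℕ} (G : SimpleGraph (Fin n))

/-- The state `y` with the number `v` in the register `R`. -/
noncomputable def put {ι : Type} (R : ℕ → ι) (v : ℕ) (y : ι → Bool) : ι → Bool :=
  Function.extend R (fun b => v.testBit b) y

theorem put_self {ι : Type} {R : ℕ → ι} (hR : Function.Injective R) (v : ℕ) (y : ι → Bool) (b : ℕ) :
    put R v y (R b) = v.testBit b := hR.extend_apply _ _ b

@[simp] theorem put_of_ne {ι : Type} {R : ℕ → ι} (v : ℕ) (y : ι → Bool) {q : ι}
    (h : ∀ b, R b ≠ q) : put R v y q = y q :=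
  Function.extend_apply' _ _ _ fun ⟨b, hb⟩ => h b hb

/-- The number in the bits `b, …, b + k - 1` of the register `R`. -/
def regVal {ι : Type} (y : ι → Bool) (R : ℕ → ι) : ℕ → ℕ → ℕ
  | 0, _ => 0
  | k + 1, b => (y (R b)).toNat + 2 * regVal y R k (b + 1)

theorem regVal_congr {ι : Type} {y z : ι → Bool} {R : ℕ → ι} {k b : ℕ}
    (h : ∀ i, b ≤ i → i < b + k → y (R i) = z (R i)) : regVal y R k b = regVal z R k b := by
  induction k generalizing b with
  | zero => rfl
  | succ k ih =>
    rw [regVal, regVal, h b le_rfl (by omega), ih fun i h1 h2 => h i (by omega) (by omega)]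

theorem regVal_of_testBit {ι : Type} {y : ι → Bool} {R : ℕ → ι} {v : ℕ}
    (h : ∀ i, y (R i) = v.testBit i) (k b : ℕ) : regVal y R k b = v / 2 ^ b % 2 ^ k := by
  induction k generalizing b with
  | zero => simp [regVal, Nat.mod_one]
  | succ k ih =>
    rw [regVal, h, ih, pow_succ' 2 k, Nat.mod_mul, pow_succ 2 b, Nat.div_div_eq_div_mul,
      Nat.testBit_eq_decide_div_mod_eq]
    congr 1
    rcases Nat.mod_two_eq_zero_or_one (v / 2 ^ b) with h | h <;> simp [h]

theorem testBit_regVal {ι : Type} (y : ι → Bool) (R : ℕ → ι) (k b i : ℕ) (hi : i < k) :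
    (regVal y R k b).testBit i = y (R (b + i)) := by
  induction k generalizing b i with
  | zero => omega
  | succ k ih =>
    rw [regVal]
    rcases i with _ | i
    · rw [Nat.testBit_zero]
      cases y (R b) <;> simp [Nat.add_mod]
    · rw [Nat.testBit_succ]
      have : ((y (R b)).toNat + 2 * regVal y R k (b + 1)) / 2 = regVal y R k (b + 1) := by
        cases y (R b) <;> simp <;> omega
      rw [this, ih _ _ (by omega)]
      congr 2
      omega

theorem regVal_lt {ι : Type} (y : ι → Bool) (R : ℕ → ι) (k b : ℕ) : regVal y R k b < 2 ^ k := by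
  induction k generalizing b with
  | zero => simp [regVal]
  | succ k ih =>
    have := ih (b + 1)
    have h1 := Bool.toNat_lt (y (R b))
    rw [regVal, pow_succ]
    omega

/-! ### Subtraction -/

/-- The borrow of the subtraction of the register `m` from `R` at the bit `b`. -/
def borrowC (R : ℕ → Qb n) (b : ℕ) : QCircuit n (Qb n) :=
  litC (R b) false (.m b) true (.c (b + 1)) ++ litC (R b) false (.c b) true (.c (b + 1)) ++
    ccxC (.m b) (.c b) (.c (b + 1))

/-- Subtracts the bits `b, …, b + k - 1` of the register `m` from those of `R`, with the borrow
`c b`. -/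
def subC (R : ℕ → Qb n) : ℕ → ℕ → QCircuit n (Qb n)
  | 0, _ => []
  | k + 1, b => borrowC R b ++ subC R k (b + 1) ++ borrowC R b ++ cxC (.m b) (R b) ++ cxC (.c b) (R b)

variable {R : ℕ → Qb n}

theorem run_borrowC (hc : ∀ i j, R i ≠ .c j) (hm : ∀ i j, R i ≠ .m j) (b : ℕ) (y : Qb n → Bool) :
    run G (borrowC R b) (ket y) = ket (toggle y (.c (b + 1))
      ((!y (R b) && y (.m b)) ^^ (!y (R b) && y (.c b)) ^^ (y (.m b) && y (.c b)))) := by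
  rw [borrowC, run_append, run_append, run_litC G (hm _ _) (hc _ _) (by simp),
    run_litC G (hc _ _) (hc _ _) (by simp), run_ccxC G (by simp) (by simp) (by simp),
    toggle_toggle, toggle_toggle]
  congr 2
  simp [toggle_apply, hc]

/-- Schoolbook subtraction. The recursion changes only higher bits of `R`, so the borrow out of bit
`b` can be recomputed and cleared before `R b` itself is overwritten. The number `d` is the borrow
out of the top bit. -/
theorem run_subC (hR : Function.Injective R) (hc : ∀ i j, R i ≠ .c j) (hm : ∀ i j, R i ≠ .m j)
    (k b : ℕ) (y : Qb n → Bool) (hy : ∀ i, b < i → y (.c i) = false) :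
    ∃ y' : Qb n → Bool, run G (subC R k b) (ket y) = ket y' ∧
      (∀ q, (∀ i, b ≤ i → i < b + k → R i ≠ q) → y' q = y q) ∧
      ∃ d, regVal y' R k b + regVal y .m k b + (y (.c b)).toNat = regVal y R k b + 2 ^ k * d := by
  induction k generalizing b y with
  | zero => exact ⟨y, by simp [subC], by simp, (y (.c b)).toNat, by simp [regVal]⟩
  | succ k ih =>
    obtain ⟨B, hB⟩ : ∃ B, B = ((!y (R b) && y (.m b)) ^^ (!y (R b) && y (.c b)) ^^
      (y (.m b) && y (.c b))) := ⟨_, rfl⟩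
    obtain ⟨y', h1, h2, d, h3⟩ := ih (b + 1) (toggle y (.c (b + 1)) B) (fun i hi => by
      rw [toggle_ne (by simp; omega), hy i (by omega)])
    have e1 : y' (R b) = y (R b) := by
      rw [h2 _ fun i h _ e => by have := hR e; omega, toggle_ne (hc _ _)]
    have e2 : y' (.m b) = y (.m b) := by
      rw [h2 _ fun i h _ e => hm _ _ e, toggle_ne (by simp)]
    have e3 : y' (.c b) = y (.c b) := by
      rw [h2 _ fun i h _ e => hc _ _ e, toggle_ne (by simp)]
    have e4 : y' (.c (b + 1)) = B := by
      rw [h2 _ fun i h _ e => hc _ _ e, toggle, Function.update_self, hy _ (by omega), Bool.false_xor]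
    refine ⟨toggle (toggle (toggle y' (.c (b + 1)) B) (R b) (y (.m b))) (R b) (y (.c b)), ?_, ?_, d, ?_⟩
    · rw [subC, run_append, run_append, run_append, run_append, run_borrowC G hc hm, ← hB, h1,
        run_borrowC G hc hm, e1, e2, e3, ← hB, run_cxC G (hm _ _).symm, toggle_ne (by simp), e2,
        run_cxC G (hc _ _).symm, toggle_ne (hc _ _).symm, toggle_ne (by simp), e3]
    · intro q hq
      have hq1 : q ≠ R b := (hq b le_rfl (by omega)).symm
      rw [toggle_ne hq1, toggle_ne hq1]
      by_cases hq2 : q = .c (b + 1)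
      · rw [hq2, toggle, Function.update_self, e4, hy _ (by omega), Bool.xor_self]
      · rw [toggle_ne hq2, h2 _ fun i h h' => hq i (by omega) (by omega), toggle_ne hq2]
    · have f1 : toggle (toggle (toggle y' (.c (b + 1)) B) (R b) (y (.m b))) (R b) (y (.c b)) (R b) =
          (y (R b) ^^ (y (.m b) ^^ y (.c b))) := by
        rw [toggle_toggle, toggle, Function.update_self, toggle_ne (hc _ _), e1]
      have f2 : regVal (toggle (toggle (toggle y' (.c (b + 1)) B) (R b) (y (.m b))) (R b) (y (.c b)))
          R k (b + 1) = regVal y' R k (b + 1) := by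
        refine regVal_congr fun i hi _ => ?_
        have : R i ≠ R b := fun e => by have := hR e; omega
        rw [toggle_ne this, toggle_ne this, toggle_ne (hc _ _)]
      have f3 : regVal (toggle y (.c (b + 1)) B) .m k (b + 1) = regVal y .m k (b + 1) :=
        regVal_congr fun i _ _ => toggle_ne (by simp) _ _
      have f4 : regVal (toggle y (.c (b + 1)) B) R k (b + 1) = regVal y R k (b + 1) :=
        regVal_congr fun i _ _ => toggle_ne (hc _ _) _ _
      have f5 : toggle y (.c (b + 1)) B (.c (b + 1)) = B := by
        rw [toggle, Function.update_self, hy _ (by omega), Bool.false_xor]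
      rw [f3, f4, f5] at h3
      rw [regVal, regVal, regVal, f1, f2, pow_succ]
      have hBn : 2 * B.toNat + (y (R b)).toNat = (y (.m b)).toNat + (y (.c b)).toNat +
          (y (R b) ^^ (y (.m b) ^^ y (.c b))).toNat := by
        rw [hB]
        cases y (R b) <;> cases y (.m b) <;> cases y (.c b) <;> rfl
      have : 2 ^ k * 2 * d = 2 * (2 ^ k * d) := by ring
      omega

/-- Subtracts the number `N` from the register `R` of `W` bits, if `tmp` is set. -/
def subConstC (R : ℕ → Qb n) (W N : ℕ) : QCircuit n (Qb n) :=
  fanC .tmp (((List.range W).filter fun b => N.testBit b).map Qb.m) ++ subC R W 0 ++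
    fanC .tmp (((List.range W).filter fun b => N.testBit b).map Qb.m)

theorem testBit_of_le {W N b : ℕ} (hN : N < 2 ^ W) (hb : W ≤ b) : N.testBit b = false :=
  Nat.testBit_lt_two_pow (hN.trans_le (Nat.pow_le_pow_right (by norm_num) hb))

theorem mem_bits {α : Type} {R : ℕ → α} (hR : Function.Injective R) {W N : ℕ} (hN : N < 2 ^ W)
    (b : ℕ) : R b ∈ ((List.range W).filter fun b => N.testBit b).map R ↔ N.testBit b = true := by
  rw [List.mem_map_of_injective hR, List.mem_filter, List.mem_range, and_iff_right_iff_imp]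
  intro h
  by_contra hb
  rw [testBit_of_le hN (by omega)] at h
  cases h

theorem nodup_bits {α : Type} {R : ℕ → α} (hR : Function.Injective R) (W : ℕ) (f : ℕ → Bool) :
    (((List.range W).filter f).map R).Nodup :=
  (List.nodup_range.filter _).map hR

theorem m_injective : Function.Injective (Qb.m (n := n)) := fun i j h => by simpa using h

theorem run_mask {W N : ℕ} (hN : N < 2 ^ W) (v : ℕ) (y : Qb n → Bool) (hy : y .tmp = true) :
    run G (fanC .tmp (((List.range W).filter fun b => N.testBit b).map Qb.m)) (ket (put .m v y)) =
      ket (put .m (v ^^^ N) y) := by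
  rw [run_fanC G _ _ (by simp) (nodup_bits m_injective _ _)]
  refine ket_congr fun q => ?_
  rw [put_of_ne v y (q := .tmp) (by simp), hy, Bool.true_and]
  by_cases hq : ∃ b, q = .m b
  · obtain ⟨b, rfl⟩ := hq
    rw [put_self m_injective, put_self m_injective, Nat.testBit_xor]
    congr 1
    rw [Bool.eq_iff_iff, decide_eq_true_iff, mem_bits m_injective hN]
  · push Not at hq
    rw [put_of_ne _ _ fun b => (hq b).symm, put_of_ne _ _ fun b => (hq b).symm, decide_eq_false,
      Bool.xor_false]
    rintro h
    obtain ⟨b, _, hb⟩ := List.mem_map.1 h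
    exact hq b hb.symm

theorem put_zero {ι : Type} {R : ℕ → ι} (hR : Function.Injective R) {y : ι → Bool}
    (h : ∀ b, y (R b) = false) : put R 0 y = y := by
  funext q
  by_cases h1 : ∃ b, R b = q
  · obtain ⟨b, rfl⟩ := h1
    rw [put_self hR, h, Nat.zero_testBit]
  · push Not at h1
    rw [put_of_ne _ _ h1]

/-- The subtraction itself is unconditional; the condition sits in the loading of `N` into `m`, so 0
is subtracted when `tmp` is not set. -/
theorem run_subConstC (hR : Function.Injective R) (hc : ∀ i j, R i ≠ .c j) (hm : ∀ i j, R i ≠ .m j)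
    (htmp : ∀ i, R i ≠ .tmp) {W N v : ℕ} (hN : N < 2 ^ W) (hv : v < 2 ^ W) (y : Qb n → Bool)
    (hyc : ∀ i, y (.c i) = false) (hym : ∀ i, y (.m i) = false) :
    run G (subConstC R W N) (ket (put R v y)) =
      ket (put R (if y .tmp then (v + 2 ^ W - N) % 2 ^ W else v) y) := by
  have key : ∀ u, u < 2 ^ W → run G (subC R W 0) (ket (put .m u (put R v y))) =
      ket (put .m u (put R ((v + 2 ^ W - u) % 2 ^ W) y)) := by
    intro u hu
    obtain ⟨y', h1, h2, d, h3⟩ := run_subC G hR hc hm W 0 (put .m u (put R v y)) fun i _ => by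
      rw [put_of_ne _ _ (by simp), put_of_ne _ _ fun b => hc b i, hyc]
    have g1 : regVal (put .m u (put R v y)) .m W 0 = u := by
      rw [regVal_of_testBit (v := u) (fun i => put_self m_injective _ _ _), pow_zero, Nat.div_one,
        Nat.mod_eq_of_lt hu]
    have g2 : regVal (put .m u (put R v y)) R W 0 = v := by
      rw [regVal_of_testBit (v := v) (fun i => ?_), pow_zero, Nat.div_one, Nat.mod_eq_of_lt hv]
      rw [put_of_ne _ _ fun b => (hm i b).symm, put_self hR]
    have g3 : put .m u (put R v y) (.c 0) = false := by
      rw [put_of_ne _ _ (by simp), put_of_ne _ _ fun b => hc b 0, hyc]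
    rw [g1, g2, g3, Bool.toNat_false, add_zero] at h3
    have g4 := regVal_lt y' R W 0
    have g5 : regVal y' R W 0 = (v + 2 ^ W - u) % 2 ^ W := by
      rw [← Nat.mod_eq_of_lt g4]
      refine Nat.ModEq.add_right_cancel' u ?_
      rw [h3, show v + 2 ^ W - u + u = v + 2 ^ W by omega]
      simp [Nat.ModEq]
    rw [h1]
    refine ket_congr fun q => ?_
    by_cases hq : ∃ b, R b = q
    · obtain ⟨b, rfl⟩ := hq
      rw [put_of_ne _ _ fun j => (hm b j).symm, put_self hR, ← g5]
      by_cases hb : b < W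
      · rw [testBit_regVal y' R W 0 b hb, zero_add]
      · rw [testBit_of_le g4 (by omega), h2 _ fun i _ h e => hb (by have := hR e; omega),
          put_of_ne _ _ fun j => (hm b j).symm, put_self hR, testBit_of_le hv (by omega)]
    · push Not at hq
      rw [h2 q fun i _ _ => hq i]
      by_cases hq' : ∃ b, Qb.m b = q
      · obtain ⟨b, rfl⟩ := hq'
        rw [put_self m_injective, put_self m_injective]
      · push Not at hq'
        rw [put_of_ne _ _ hq', put_of_ne _ _ hq, put_of_ne _ _ hq', put_of_ne _ _ hq]
  have hz : ∀ w, put .m 0 (put R w y) = put R w y := fun w => put_zero m_injective fun b => by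
    rw [put_of_ne _ _ fun j => hm j b, hym]
  have hz' : ∀ w, put R w y .tmp = y .tmp := fun w => put_of_ne _ _ htmp
  rw [subConstC, run_append, run_append]
  by_cases ht : y .tmp = true
  · rw [if_pos ht, ← hz v, run_mask G hN _ _ ((hz' v).trans ht), Nat.zero_xor, key N hN,
      run_mask G hN _ _ ((hz' _).trans ht), Nat.xor_self, hz]
  · rw [Bool.not_eq_true] at ht
    have h0 : ∀ w, run G (fanC .tmp (((List.range W).filter fun b => N.testBit b).map Qb.m))
        (ket (put R w y)) = ket (put R w y) := by
      intro w
      rw [run_fanC G _ _ (by simp) (nodup_bits m_injective _ _), hz', ht]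
      simp
    have h1 := key 0 (by positivity)
    rw [hz, hz, Nat.sub_zero, Nat.add_mod_right, Nat.mod_eq_of_lt hv] at h1
    rw [h0, h1, h0, ht, if_neg (by simp)]

theorem cost_subC (R : ℕ → Qb n) (k b : ℕ) : QCircuit.cost (subC R k b) ≤ 24 * k := by
  induction k generalizing b with
  | zero => simp [subC]
  | succ k ih =>
    have h1 := cost_litC (n := n) (R b) false (.m b) true (.c (b + 1))
    have h2 := cost_litC (n := n) (R b) false (.c b) true (.c (b + 1))
    have h3 := cost_ccxC (n := n) (.m b) (.c b) (.c (b + 1) : Qb n)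
    have h4 := cost_cxC (n := n) (.m b) (R b)
    have h5 := cost_cxC (n := n) (.c b) (R b)
    have h6 := ih (b + 1)
    simp only [subC, borrowC, cost_append]
    omega

theorem cost_subConstC (R : ℕ → Qb n) (W N : ℕ) : QCircuit.cost (subConstC R W N) ≤ 26 * W := by
  have h1 := cost_fanC (n := n) (Qb.tmp (n := n)) (((List.range W).filter fun b => N.testBit b).map Qb.m)
  have h2 := cost_subC R W 0
  have h3 := List.length_filter_le (fun b => N.testBit b) (List.range W)
  rw [List.length_map] at h1
  rw [List.length_range] at h3
  simp only [subConstC, cost_append]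
  omega

end Registers

/-! ### Controlled Hadamard gates below the leading bit -/

section Hadamards

variable {n : ℕ} (G : SimpleGraph (Fin n))

/-- Adds `o (k + 1) ∨ r k` to `o k`. -/
def orC (k : ℕ) : QCircuit n (Qb n) :=
  litC (.o (k + 1)) false (.r k) false (.o k) ++ notC (.o k)

/-- Applies a Hadamard gate to each of the lowest `k` bits of `r` below the leading bit. -/
noncomputable def hadC : ℕ → QCircuit n (Qb n)
  | 0 => []
  | k + 1 => orC k ++ hadC k ++ orC k ++ reflC (.o (k + 1)) (.r k) (Real.pi / 4)

theorem run_orC (k : ℕ) (y : Qb n → Bool) :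
    run G (orC k) (ket y) = ket (toggle y (.o k) (y (.o (k + 1)) || y (.r k))) := by
  rw [orC, run_append, run_litC G (by simp) (by simp) (by simp), run_notC, toggle_toggle]
  congr 2
  cases y (.o (k + 1)) <;> cases y (.r k) <;> rfl

theorem r_injective : Function.Injective (Qb.r (n := n)) := fun i j h => by simpa using h

theorem toggle_put {ι : Type} [DecidableEq ι] {R : ℕ → ι} {t : ι} (h : ∀ b, R b ≠ t) (v : ℕ)
    (y : ι → Bool) (b : Bool) : toggle (put R v y) t b = put R v (toggle y t b) := by
  funext q
  rw [toggle_apply, put_of_ne _ _ h]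
  split_ifs with hq
  · subst hq
    rw [put_of_ne _ _ h, toggle, Function.update_self]
  · by_cases hq' : ∃ b, R b = q
    · obtain ⟨b, rfl⟩ := hq'
      classical
      rw [put, put, Function.extend_def, Function.extend_def]
      simp
    · push Not at hq'
      rw [put_of_ne _ _ hq', put_of_ne _ _ hq', toggle_ne hq]

theorem run_hadC_idle (k : ℕ) (y : Qb n → Bool) (ho : ∀ i, y (.o i) = false)
    (hr : ∀ i, i < k → y (.r i) = false) : run G (hadC k) (ket y) = ket y := by
  induction k with
  | zero => rfl
  | succ k ih =>
    rw [hadC, run_append, run_append, run_append, run_orC, ho, hr k (by omega), Bool.or_false,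
      toggle_false, ih fun i hi => hr i (by omega), run_orC, ho, hr k (by omega), Bool.or_false,
      toggle_false, run_reflC G (by simp), ho, if_neg (by simp)]

theorem sum_range_two_pow_succ {M : Type*} [AddCommMonoid M] (k : ℕ) (f : ℕ → M) :
    ∑ w ∈ Finset.range (2 ^ (k + 1)), f w =
      ∑ w ∈ Finset.range (2 ^ k), f w + ∑ w ∈ Finset.range (2 ^ k), f (2 ^ k + w) := by
  rw [pow_succ, mul_two, Finset.sum_range_add]

/-- Once `o k` is set, the leading bit is at least `k`, all lower `o` are switched on whatever `r`
contains, and all `k` Hadamard gates act. Each of them maps |0⟩ + |1⟩ to √2 |0⟩. -/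
theorem run_hadC_uniform (k u : ℕ) (y : Qb n → Bool) (ho : ∀ i, i < k → y (.o i) = false)
    (hk : y (.o k) = true) :
    run G (hadC k) (∑ w ∈ Finset.range (2 ^ k), ket (put .r (2 ^ k * u + w) y)) =
      ((Real.sqrt 2 : ℂ) ^ k) • ket (put .r (2 ^ k * u) y) := by
  induction k generalizing u y with
  | zero => simp [hadC]
  | succ k ih =>
    set y1 := toggle y (.o k) true with hy1
    have hor : ∀ v, run G (orC k) (ket (put .r v y)) = ket (put .r v y1) := by
      intro v
      rw [run_orC, put_of_ne _ _ (by simp), hk, Bool.true_or, toggle_put (by simp)]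
    have hor' : ∀ v, run G (orC k) (ket (put .r v y1)) = ket (put .r v y) := by
      intro v
      rw [run_orC, put_of_ne _ _ (by simp), hy1, toggle_ne (by simp), hk, Bool.true_or,
        toggle_put (by simp), toggle_toggle]
      simp
    have ih' := fun u => ih u y1 (fun i hi => by
      rw [hy1, toggle_ne (by simp; omega), ho i (by omega)])
      (by rw [hy1, toggle, Function.update_self, ho k (by omega)]; rfl)
    have e1 : ∀ w, 2 ^ (k + 1) * u + w = 2 ^ k * (2 * u) + w := fun w => by ring
    have e2 : ∀ w, 2 ^ (k + 1) * u + (2 ^ k + w) = 2 ^ k * (2 * u + 1) + w := fun w => by ring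
    have hs : (Real.sin (Real.pi / 4) : ℂ) + Real.cos (Real.pi / 4) = Real.sqrt 2 := by
      rw [Real.sin_pi_div_four, Real.cos_pi_div_four]
      push_cast
      ring
    have hb0 : put .r (2 ^ k * (2 * u)) y (.r k) = false := by
      rw [put_self r_injective, Nat.testBit_two_pow_mul]
      simp
    have hb1 : put .r (2 ^ k * (2 * u + 1)) y (.r k) = true := by
      rw [put_self r_injective, Nat.testBit_two_pow_mul]
      simp [Nat.testBit_zero]
    have hup : ∀ b : ℕ, b < 2 → ∀ b' : ℕ, b' < 2 → Function.update (put .r (2 ^ k * (2 * u + b)) y)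
        (.r k) (b'.testBit 0) = put .r (2 ^ k * (2 * u + b')) y := by
      intro b hb b' hb'
      funext q
      by_cases hq : q = .r k
      · subst hq
        rw [Function.update_self, put_self r_injective, Nat.testBit_two_pow_mul]
        have : b' = 0 ∨ b' = 1 := by omega
        rcases this with rfl | rfl <;> simp [Nat.testBit_zero]
      · rw [Function.update_of_ne hq]
        by_cases hq' : ∃ b, Qb.r b = q
        · obtain ⟨i, rfl⟩ := hq'
          rw [put_self r_injective, put_self r_injective, Nat.testBit_two_pow_mul,
            Nat.testBit_two_pow_mul]
          by_cases hi : k ≤ i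
          · have hne : i ≠ k := fun h => hq (by rw [h])
            obtain ⟨j, hj⟩ : ∃ j, i - k = j + 1 := ⟨i - k - 1, by omega⟩
            rw [hj, Nat.testBit_succ, Nat.testBit_succ]
            congr 2
            omega
          · simp [hi]
        · push Not at hq'
          rw [put_of_ne _ _ hq', put_of_ne _ _ hq']
    have h01 : Function.update (put .r (2 ^ k * (2 * u)) y) (.r k) true =
        put .r (2 ^ k * (2 * u + 1)) y := by simpa using hup 0 (by omega) 1 (by omega)
    have h10 : Function.update (put .r (2 ^ k * (2 * u + 1)) y) (.r k) false =
        put .r (2 ^ k * (2 * u)) y := by simpa using hup 1 (by omega) 0 (by omega)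
    have hok : ∀ v, put .r v y (.o (k + 1)) = true := fun v => by rw [put_of_ne _ _ (by simp), hk]
    rw [sum_range_two_pow_succ]
    simp only [e2]
    simp only [e1]
    rw [hadC, run_append, run_append, run_append, map_add, map_sum, map_sum]
    simp only [hor]
    rw [map_add, ih', ih', map_add, map_smul, map_smul, hor', hor', map_add, map_smul, map_smul,
      run_reflC G (by simp), run_reflC G (by simp), hok, hok, if_pos rfl, if_pos rfl, hb0, hb1, if_neg (by simp), if_pos rfl, h01, h10, pow_succ, ← hs,
      show 2 ^ (k + 1) * u = 2 ^ k * (2 * u) by ring]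
    have hsc : (Real.sin (Real.pi / 4) : ℂ) = Real.cos (Real.pi / 4) := by
      rw [Real.sin_pi_div_four, Real.cos_pi_div_four]
    rw [hsc]
    module

theorem sum_range_two_pow_xor {M : Type*} [AddCommMonoid M] (k N : ℕ) (hN : N < 2 ^ k) (f : ℕ → M) :
    ∑ v ∈ Finset.range (2 ^ k), f (v ^^^ N) = ∑ v ∈ Finset.range (2 ^ k), f v := by
  refine Finset.sum_bij' (fun v _ => v ^^^ N) (fun v _ => v ^^^ N) ?_ ?_ ?_ ?_ ?_
  · intro v hv
    rw [Finset.mem_range] at hv ⊢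
    exact Nat.xor_lt_two_pow hv hN
  · intro v hv
    rw [Finset.mem_range] at hv ⊢
    exact Nat.xor_lt_two_pow hv hN
  all_goals simp

theorem two_pow_add_xor {k v N : ℕ} (hv : v < 2 ^ k) (hN : N < 2 ^ k) :
    (2 ^ k + v) ^^^ (2 ^ k + N) = v ^^^ N ∧ v ^^^ (2 ^ k + N) = 2 ^ k + (v ^^^ N) := by
  have h1 : ∀ w < 2 ^ k, ∀ j, (2 ^ k + w).testBit j = (decide (j = k) ^^ w.testBit j) := by
    intro w hw j
    have := Nat.testBit_two_pow_mul_add 1 hw j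
    rw [mul_one] at this
    rw [this]
    split_ifs with h
    · rw [decide_eq_false (by omega), Bool.false_xor]
    · rw [testBit_of_le hw (by omega), Bool.xor_false, Bool.eq_iff_iff]
      simp [Nat.testBit_one_eq_true_iff_self_eq_zero]
      omega
  constructor <;> refine Nat.eq_of_testBit_eq fun j => ?_
  · rw [Nat.testBit_xor, Nat.testBit_xor, h1 v hv, h1 N hN]
    cases decide (j = k) <;> simp
  · rw [Nat.testBit_xor, h1 N hN, h1 _ (Nat.xor_lt_two_pow hv hN), Nat.testBit_xor]
    cases decide (j = k) <;> simp

/-- The Hadamard gates below the leading bit turn `∑ |v ⊕ N⟩`, where `v < N`, into a superposition of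
powers of `2`. -/
theorem run_hadC_xor (k N : ℕ) (hN : N < 2 ^ k) (y : Qb n → Bool) (ho : ∀ i, y (.o i) = false) :
    run G (hadC k) (∑ v ∈ Finset.range N, ket (put .r (v ^^^ N) y)) =
      ∑ b ∈ Finset.range k, if N.testBit b then ((Real.sqrt 2 : ℂ) ^ b) • ket (put .r (2 ^ b) y)
        else 0 := by
  -- For v < N let b be the highest bit at which they differ. Then b is a bit of N, and v ⊕ N has
  -- leading bit b with arbitrary lower bits. So the values v ⊕ N fill the block [2^b, 2^(b+1)) once
  -- for every bit b of N, and the gates contract this block to √2^b |2^b⟩. The induction splits off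
  -- the top block.
  induction k generalizing N with
  | zero =>
    obtain rfl : N = 0 := by simpa using hN
    simp
  | succ k ih =>
    have hlow : ∀ N < 2 ^ k, run G (hadC (k + 1)) (∑ v ∈ Finset.range N, ket (put .r (v ^^^ N) y)) =
        ∑ b ∈ Finset.range k, if N.testBit b then ((Real.sqrt 2 : ℂ) ^ b) • ket (put .r (2 ^ b) y)
        else 0 := by
      intro N hN
      have h1 : ∀ v < 2 ^ k, run G (orC k) (ket (put .r v y)) = ket (put .r v y) := by
        intro v hv
        rw [run_orC, put_of_ne _ _ (by simp), ho, put_self r_injective, testBit_of_le hv le_rfl,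
          Bool.or_false, toggle_false]
      have h2 : ∀ v, run G (reflC (.o (k + 1)) (.r k) (Real.pi / 4)) (ket (put .r v y)) =
          ket (put .r v y) := by
        intro v
        rw [run_reflC G (by simp), put_of_ne _ _ (by simp), ho, if_neg (by simp)]
      rw [hadC, run_append, run_append, run_append, map_sum, Finset.sum_congr rfl fun v hv =>
        h1 _ (Nat.xor_lt_two_pow ((Finset.mem_range.1 hv).trans hN) hN), ih N hN, map_sum, map_sum]
      refine Finset.sum_congr rfl fun b hb => ?_
      split_ifs
      · rw [map_smul, h1 _ (Nat.pow_lt_pow_right (by norm_num) (Finset.mem_range.1 hb)), map_smul, h2]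
      · simp
    by_cases hk : N < 2 ^ k
    · rw [hlow N hk, Finset.sum_range_succ, testBit_of_le hk le_rfl]
      simp
    -- If bit `k` of the number is set, then v < 2^k contributes all of [2^k, 2^(k+1)) in permuted
    -- order, and v = 2^k + v' contributes v' ⊕ N for the remaining lower bits N.
    · obtain ⟨N, rfl⟩ : ∃ N', N = 2 ^ k + N' := ⟨N - 2 ^ k, by omega⟩
      have hN' : N < 2 ^ k := by rw [pow_succ] at hN; omega
      set y1 := toggle y (.o k) true with hy1
      have h1 : ∀ v < 2 ^ k, run G (orC k) (ket (put .r (2 ^ k + v) y)) =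
          ket (put .r (2 ^ k + v) y1) := by
        intro v hv
        have := Nat.testBit_two_pow_mul_add 1 hv k
        rw [mul_one] at this
        rw [run_orC, put_of_ne _ _ (by simp), ho, put_self r_injective, this, toggle_put (by simp)]
        simp [hy1]
      have h2 : run G (orC k) (ket (put .r (2 ^ k) y1)) = ket (put .r (2 ^ k) y) := by
        rw [run_orC, put_of_ne _ _ (by simp), hy1, toggle_ne (by simp), ho, put_self r_injective,
          toggle_put (by simp), toggle_toggle]
        simp
      have h3 := run_hadC_uniform G k 1 y1 (fun i hi => by
        rw [hy1, toggle_ne (by simp; omega), ho]) (by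
        rw [hy1, toggle, Function.update_self, ho]; rfl)
      simp only [mul_one] at h3
      have e1 : ∑ v ∈ Finset.range (2 ^ k), ket (put .r (v ^^^ (2 ^ k + N)) y) =
          ∑ v ∈ Finset.range (2 ^ k), ket (put .r (2 ^ k + v) y) := by
        rw [← sum_range_two_pow_xor k N hN' fun v => ket (put .r (2 ^ k + v) y)]
        refine Finset.sum_congr rfl fun v hv => ?_
        rw [(two_pow_add_xor (Finset.mem_range.1 hv) hN').2]
      have e2 : ∑ v ∈ Finset.range N, ket (put .r ((2 ^ k + v) ^^^ (2 ^ k + N)) y) =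
          ∑ v ∈ Finset.range N, ket (put .r (v ^^^ N) y) := by
        refine Finset.sum_congr rfl fun v hv => ?_
        rw [(two_pow_add_xor ((Finset.mem_range.1 hv).trans hN') hN').1]
      rw [Finset.sum_range_add, map_add, e1, e2, hlow N hN', hadC, run_append, run_append, run_append,
        map_sum, Finset.sum_congr rfl fun v hv => h1 v (Finset.mem_range.1 hv), h3, map_smul, h2,
        map_smul, run_reflC G (by simp), put_of_ne _ _ (by simp), ho, if_neg (by simp),
        Finset.sum_range_succ, add_comm]
      congr 1
      · refine Finset.sum_congr rfl fun b hb => ?_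
        have := Nat.testBit_two_pow_mul_add 1 hN' b
        rw [mul_one, if_pos (Finset.mem_range.1 hb)] at this
        rw [this]
      · have := Nat.testBit_two_pow_mul_add 1 hN' k
        rw [mul_one] at this
        rw [this]
        simp

theorem cost_hadC (k : ℕ) : QCircuit.cost (hadC (n := n) k) ≤ 15 * k := by
  induction k with
  | zero => simp [hadC]
  | succ k ih =>
    have h1 := cost_litC (n := n) (.o (k + 1) : Qb n) false (.r k) false (.o k)
    have h2 := cost_reflC (n := n) (.o (k + 1) : Qb n) (.r k) (Real.pi / 4)
    simp only [hadC, orC, cost_append, cost_notC]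
    omega

/-! ### Uniform superpositions -/

/-- Hadamard gates on the lowest `k` bits of `r`, controlled by `f1`. -/
noncomputable def uniformC : ℕ → QCircuit n (Qb n)
  | 0 => []
  | k + 1 => uniformC k ++ reflC .f1 (.r k) (Real.pi / 4)

theorem run_uniformC_idle (k : ℕ) (y : Qb n → Bool) (hf : y .f1 = false) :
    run G (uniformC k) (ket y) = ket y := by
  induction k with
  | zero => rfl
  | succ k ih => rw [uniformC, run_append, ih, run_reflC G (by simp), hf, if_neg (by simp)]

theorem run_uniformC (k : ℕ) (y : Qb n → Bool) (hf : y .f1 = true) (hr : ∀ b, y (.r b) = false) :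
    (Real.sqrt 2 : ℂ) ^ k • run G (uniformC k) (ket y) =
      ∑ v ∈ Finset.range (2 ^ k), ket (put .r v y) := by
  induction k with
  | zero => simp [uniformC, put_zero r_injective hr]
  | succ k ih =>
    have hs : (Real.sqrt 2 : ℂ) * Real.sin (Real.pi / 4) = 1 := by
      rw [Real.sin_pi_div_four]
      norm_cast
      rw [← mul_div_assoc, Real.mul_self_sqrt (by norm_num)]; norm_num
    have hsc : (Real.sin (Real.pi / 4) : ℂ) = Real.cos (Real.pi / 4) := by
      rw [Real.sin_pi_div_four, Real.cos_pi_div_four]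
    have hup : ∀ v < 2 ^ k, Function.update (put .r v y) (.r k) true = put .r (2 ^ k + v) y := by
      intro v hv
      have hb := fun j => Nat.testBit_two_pow_mul_add 1 hv j
      simp only [mul_one] at hb
      funext q
      by_cases hq : q = .r k
      · subst hq
        rw [Function.update_self, put_self r_injective, hb]
        simp
      · rw [Function.update_of_ne hq]
        by_cases hq' : ∃ b, Qb.r b = q
        · obtain ⟨i, rfl⟩ := hq'
          rw [put_self r_injective, put_self r_injective, hb]
          split_ifs with hi
          · rfl
          · have hne : i ≠ k := fun h => hq (by rw [h])
            rw [testBit_of_le hv (by omega), eq_comm, ← Bool.not_eq_true,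
              Nat.testBit_one_eq_true_iff_self_eq_zero]
            omega
        · push Not at hq'
          rw [put_of_ne _ _ hq', put_of_ne _ _ hq']
    rw [uniformC, run_append, pow_succ, mul_comm, mul_smul, ← map_smul, ih,
      sum_range_two_pow_succ, map_sum, Finset.smul_sum, ← Finset.sum_add_distrib]
    refine Finset.sum_congr rfl fun v hv => ?_
    rw [Finset.mem_range] at hv
    rw [run_reflC G (by simp), put_of_ne _ _ (by simp), hf, if_pos rfl, put_self r_injective,
      testBit_of_le hv le_rfl, if_neg (by simp), hup v hv, ← hsc, smul_add, smul_smul, smul_smul, hs,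
      one_smul, one_smul]

theorem cost_uniformC (k : ℕ) : QCircuit.cost (uniformC (n := n) k) ≤ 3 * k := by
  induction k with
  | zero => simp [uniformC]
  | succ k ih =>
    have h2 := cost_reflC (n := n) (.f1 : Qb n) (.r k) (Real.pi / 4)
    simp only [uniformC, cost_append]
    omega

end Hadamards

/-! ### The pairs of exchanged vertices -/

/-- The three walks. -/
inductive Mode : Type
  | up | down | harm

section Pairs

variable {n : ℕ} (G : SimpleGraph (Fin n))

/-- For the simplex with the indicator `x`, the pairs `(i, j)` of a new vertex `i` and an old vertex
`j`, and the diagonal pairs that contribute to the holding probability. -/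
def Mode.mem (μ : Mode) (x : Fin n → Bool) (p : Fin n × Fin n) : Bool :=
  if p.1 = p.2 then (match μ with | .up => !x p.1 | .down => x p.1 | .harm => true)
  else !x p.1 && x p.2

/-- Flips `a p` if `p` is admissible. -/
def memC (μ : Mode) (p : Fin n × Fin n) : QCircuit n (Qb n) :=
  if p.1 = p.2 then (match μ with
    | .up => cxC (.x p.1) (.a p) ++ notC (.a p)
    | .down => cxC (.x p.1) (.a p)
    | .harm => notC (.a p))
  else litC (.x p.1) false (.x p.2) true (.a p)

theorem run_memC (μ : Mode) (p : Fin n × Fin n) (y : Qb n → Bool) :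
    run G (memC μ p) (ket y) = ket (toggle y (.a p) (μ.mem (fun v => y (.x v)) p)) := by
  unfold memC Mode.mem
  split_ifs with h
  · cases μ
    · rw [run_append, run_cxC G (by simp), run_notC, toggle_toggle]
      simp
    · rw [run_cxC G (by simp)]
    · rw [run_notC]
  · rw [run_litC G (by simpa using h) (by simp) (by simp)]
    simp

/-- All the pairs of vertices. -/
noncomputable def pairs (n : ℕ) : List (Fin n × Fin n) := Finset.univ.toList

theorem nodup_pairs : (pairs n).Nodup := Finset.nodup_toList _

theorem length_pairs : (pairs n).length = n ^ 2 := by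
  simp [pairs, Finset.length_toList, pow_two]

theorem mem_pairs (p : Fin n × Fin n) : p ∈ pairs n := by simp [pairs]

theorem run_flatMap_memC (μ : Mode) (l : List (Fin n × Fin n)) (hl : l.Nodup) (y : Qb n → Bool) :
    run G (l.flatMap (memC μ)) (ket y) = ket fun q => match q with
      | .a p => xor (y (.a p)) (decide (p ∈ l) && μ.mem (fun v => y (.x v)) p)
      | q => y q := by
  induction l generalizing y with
  | nil =>
    refine ket_congr fun q => ?_
    cases q <;> simp
  | cons p l ih =>
    rw [List.nodup_cons] at hl
    rw [List.flatMap_cons, run_append, run_memC, ih hl.2]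
    refine ket_congr fun q => ?_
    cases q with
    | a p' =>
      simp only [toggle_apply, reduceCtorEq, if_false, Qb.a.injEq, List.mem_cons]
      by_cases h : p' = p
      · subst h
        simp [hl.1]
      · simp [h]
    | _ => simp [toggle_apply]

/-- Subtracts the sum of the numbers `N p` over the pairs with `a p` set from the register `t`. -/
def totalC (W : ℕ) (N : Fin n × Fin n → ℕ) (l : List (Fin n × Fin n)) : QCircuit n (Qb n) :=
  l.flatMap fun p => cxC (.a p) .tmp ++ subConstC .t W (N p) ++ cxC (.a p) .tmp

theorem t_injective : Function.Injective (Qb.t (n := n)) := fun i j h => by simpa using h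

/-- The sum may exceed the initial value, so only a congruence is claimed; the sign is read off
later from the top bit. -/
theorem run_totalC {W : ℕ} {N : Fin n × Fin n → ℕ} (hN : ∀ p, N p < 2 ^ W)
    (l : List (Fin n × Fin n)) (y : Qb n → Bool) (hc : ∀ i, y (.c i) = false)
    (hm : ∀ i, y (.m i) = false) (ht : y .tmp = false) (v : ℕ) (hv : v < 2 ^ W) :
    ∃ v' < 2 ^ W, run G (totalC W N l) (ket (put .t v y)) = ket (put .t v' y) ∧
      v' + (l.map fun p => if y (.a p) then N p else 0).sum ≡ v [MOD 2 ^ W] := by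
  induction l generalizing v with
  | nil => exact ⟨v, hv, rfl, by simp [Nat.ModEq]⟩
  | cons p l ih =>
    set y1 := toggle y .tmp (y (.a p)) with hy1
    have h1 : ∀ v, run G (cxC (.a p) .tmp) (ket (put .t v y)) = ket (put .t v y1) := by
      intro v
      rw [run_cxC G (by simp), put_of_ne _ _ (by simp), toggle_put (by simp)]
    have h2 : ∀ v, run G (cxC (.a p) .tmp) (ket (put .t v y1)) = ket (put .t v y) := by
      intro v
      rw [run_cxC G (by simp), put_of_ne _ _ (by simp), hy1, toggle_ne (by simp),
        toggle_put (by simp), toggle_toggle]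
      simp
    have h3 := run_subConstC G (R := Qb.t) t_injective (by simp) (by simp) (by simp) (hN p) hv y1
      (fun i => by rw [hy1, toggle_ne (by simp), hc]) (fun i => by rw [hy1, toggle_ne (by simp), hm])
    have h4 : y1 .tmp = y (.a p) := by rw [hy1, toggle, Function.update_self, ht, Bool.false_xor]
    obtain ⟨w, hw⟩ : ∃ w, w = if y1 .tmp then (v + 2 ^ W - N p) % 2 ^ W else v := ⟨_, rfl⟩
    have hw1 : w < 2 ^ W := by
      rw [hw]
      split_ifs
      · exact Nat.mod_lt _ (by positivity)
      · exact hv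
    obtain ⟨v', hv', h5, h6⟩ := ih w hw1
    refine ⟨v', hv', ?_, ?_⟩
    · rw [totalC, List.flatMap_cons, run_append, run_append, run_append, h1, h3, ← hw, h2]
      exact h5
    · rw [List.map_cons, List.sum_cons, add_left_comm]
      refine (Nat.ModEq.add_left _ h6).trans ?_
      rw [hw, h4]
      have := hN p
      split_ifs
      · refine (Nat.ModEq.add_left _ (Nat.mod_modEq _ _)).trans ?_
        rw [show N p + (v + 2 ^ W - N p) = v + 2 ^ W by omega]
        simp [Nat.ModEq]
      · simp [Nat.ModEq]

/-- Computes which pairs are admissible, the mass `2 ^ s - ∑ N p` that they leave, and whether it is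
nonnegative. -/
noncomputable def setupC (μ : Mode) (s W : ℕ) (N : Fin n × Fin n → ℕ) : QCircuit n (Qb n) :=
  (pairs n).flatMap (memC μ) ++ notC (.t s) ++ totalC W N (pairs n) ++ cxC (.t (W - 1)) .ok ++ notC .ok

/-- The state after `setupC`. -/
def setupState (μ : Mode) (T : ℕ) (b : Bool) (y : Qb n → Bool) : Qb n → Bool
  | .a p => μ.mem (fun v => y (.x v)) p
  | .t i => T.testBit i
  | .ok => b
  | q => y q

/-- The total mass of the admissible pairs. -/
def Mode.mass (μ : Mode) (N : Fin n × Fin n → ℕ) (x : Fin n → Bool) : ℕ :=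
  ∑ p, if μ.mem x p then N p else 0

theorem testBit_top {W v : ℕ} (hv : v < 2 ^ (W + 1)) : v.testBit W = decide (2 ^ W ≤ v) := by
  rw [Nat.testBit_eq_decide_div_mod_eq, decide_eq_decide]
  have h2 : v / 2 ^ W < 2 := by
    rw [Nat.div_lt_iff_lt_mul (by positivity)]
    rw [pow_succ] at hv
    omega
  rw [Nat.mod_eq_of_lt h2]
  constructor
  · intro h
    by_contra h3
    rw [Nat.div_eq_of_lt (by omega)] at h
    omega
  · intro h
    have := Nat.div_pos h (by positivity)
    omega

/-- The total mass is at most n² 2^s ≤ 2^W. Hence 2^s minus the mass, taken modulo 2^(W+1), has its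
top bit set exactly when it is negative. The value of `T` in that case is irrelevant, because `ok`
then disables the sampling. -/
theorem run_setupC (μ : Mode) {s W : ℕ} {N : Fin n × Fin n → ℕ} (hN : ∀ p, N p ≤ 2 ^ s)
    (hW : n ^ 2 * 2 ^ s ≤ 2 ^ W) (hs : s < W) (y : Qb n → Bool) (ha : ∀ p, y (.a p) = false)
    (ht : ∀ b, y (.t b) = false) (hm : ∀ b, y (.m b) = false) (hc : ∀ b, y (.c b) = false)
    (htmp : y .tmp = false) (hok : y .ok = false) :
    ∃ T < 2 ^ (W + 1),
      (μ.mass N (fun v => y (.x v)) ≤ 2 ^ s → T = 2 ^ s - μ.mass N (fun v => y (.x v))) ∧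
      run G (setupC μ s (W + 1) N) (ket y) =
        ket (setupState μ T (decide (μ.mass N (fun v => y (.x v)) ≤ 2 ^ s)) y) := by
  set y1 : Qb n → Bool := fun q => match q with
    | .a p => μ.mem (fun v => y (.x v)) p
    | q => y q with hy1
  have hsW : 2 ^ s < 2 ^ W := Nat.pow_lt_pow_right (by norm_num) hs
  have hWW : 2 ^ (W + 1) = 2 * 2 ^ W := pow_succ' 2 W
  have h1 : run G ((pairs n).flatMap (memC μ) ++ notC (.t s)) (ket y) = ket (put .t (2 ^ s) y1) := by
    rw [run_append, run_flatMap_memC G μ _ nodup_pairs, run_notC]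
    refine ket_congr fun q => ?_
    cases q with
    | a p => simp [toggle_apply, hy1, mem_pairs, ha]
    | t b =>
      rw [put_self t_injective, toggle_apply, Nat.testBit_two_pow]
      simp [ht, eq_comm]
    | _ => simp [toggle_apply, hy1]
  have hmass : ((pairs n).map fun p => if y1 (.a p) then N p else 0).sum =
      μ.mass N (fun v => y (.x v)) := by
    rw [pairs, Finset.sum_map_toList, Mode.mass]
  obtain ⟨T, hT, h2, h3⟩ := run_totalC G (W := W + 1) (N := N) (fun p => by have := hN p; omega)
    (pairs n) y1 (by simp [hy1, hc]) (by simp [hy1, hm]) (by simp [hy1, htmp]) (2 ^ s) (by omega)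
  rw [hmass] at h3
  obtain ⟨S, hS⟩ : ∃ S, S = μ.mass N (fun v => y (.x v)) := ⟨_, rfl⟩
  rw [← hS] at h3 ⊢
  have hSle : S ≤ 2 ^ W := by
    refine le_trans ?_ hW
    rw [hS, Mode.mass]
    refine (Finset.sum_le_card_nsmul _ _ (2 ^ s) fun p _ => ?_).trans ?_
    · split_ifs
      · exact hN p
      · exact Nat.zero_le _
    · simp [pow_two]
  have hT1 : S ≤ 2 ^ s → T = 2 ^ s - S := by
    intro h
    have : T ≡ 2 ^ s - S [MOD 2 ^ (W + 1)] := by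
      refine Nat.ModEq.add_right_cancel' S ?_
      rwa [Nat.sub_add_cancel h]
    exact Nat.ModEq.eq_of_lt_of_lt this hT (by omega)
  have hT2 : ¬ S ≤ 2 ^ s → T = 2 ^ (W + 1) + 2 ^ s - S := by
    intro h
    have : T ≡ 2 ^ (W + 1) + 2 ^ s - S [MOD 2 ^ (W + 1)] := by
      refine Nat.ModEq.add_right_cancel' S ?_
      rw [Nat.sub_add_cancel (by rw [hWW]; linarith [Nat.two_pow_pos s, Nat.two_pow_pos W])]
      refine h3.trans ?_
      simp [Nat.ModEq]
    have h4 : 2 ^ (W + 1) + 2 ^ s - S < 2 ^ (W + 1) := by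
      have : 0 < 2 ^ (W + 1) := by positivity
      omega
    exact Nat.ModEq.eq_of_lt_of_lt this hT h4
  refine ⟨T, hT, hT1, ?_⟩
  rw [setupC, run_append, run_append, run_append, h1, h2, Nat.add_sub_cancel, run_cxC G (by simp),
    run_notC, put_self t_injective, testBit_top hT]
  have hdec : decide (2 ^ W ≤ T) = !decide (S ≤ 2 ^ s) := by
    by_cases h : S ≤ 2 ^ s
    · have h4 : ¬ 2 ^ W ≤ T := by
        rw [hT1 h]
        omega
      simp [h, h4]
    · have h4 : 2 ^ W ≤ T := by
        rw [hT2 h, hWW]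
        exact Nat.le_sub_of_add_le (by linarith [Nat.two_pow_pos s])
      simp [h, h4]
  rw [hdec, toggle_toggle]
  refine ket_congr fun q => ?_
  cases q with
  | t b => rw [toggle_ne (by simp), put_self t_injective]; rfl
  | ok => simp [toggle, hy1, hok, setupState]
  | _ => simp [toggle_apply, hy1, setupState]

theorem cost_memC (μ : Mode) (p : Fin n × Fin n) : QCircuit.cost (memC μ p) ≤ 5 := by
  have h1 := cost_litC (n := n) (Qb.x p.1) false (Qb.x p.2) true (Qb.a p)
  have h2 := cost_cxC (n := n) (Qb.x p.1) (Qb.a p)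
  unfold memC
  split_ifs
  · cases μ <;> simp only [cost_append, cost_notC] <;> omega
  · exact h1

theorem cost_setupC (μ : Mode) (s W : ℕ) (N : Fin n × Fin n → ℕ) :
    QCircuit.cost (setupC μ s W N) ≤ n ^ 2 * (26 * W + 7) + 3 := by
  have h1 := cost_flatMap_le (pairs n) (memC μ) 5 fun p _ => cost_memC μ p
  have h2 := cost_flatMap_le (pairs n) (fun p => cxC (Qb.a p) Qb.tmp ++ subConstC Qb.t W (N p) ++
    cxC (Qb.a p) Qb.tmp) (26 * W + 2) fun p _ => by
      have h1 := cost_cxC (n := n) (Qb.a p) Qb.tmp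
      have h2 := cost_subConstC (n := n) Qb.t W (N p)
      simp only [cost_append]
      omega
  have h3 := cost_cxC (n := n) (Qb.t (W - 1)) (Qb.ok (n := n))
  rw [length_pairs] at h1 h2
  simp only [setupC, totalC, cost_append, cost_notC]
  nlinarith

/-! ### Sampling a pair -/

/-- The superposition over `v < R` in the register `r` is split into the part `v < N p`, which is
marked by `e p`, and the rest, if `a p` and `f1` are set. -/
def splitC (W : ℕ) (N : Fin n × Fin n → ℕ) (p : Fin n × Fin n) : QCircuit n (Qb n) :=
  ccxC (.a p) .f1 .tmp ++ subConstC .r W (N p) ++ ccxC .tmp (.r (W - 1)) (.e p) ++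
    ccxC (.a p) .f1 .tmp ++
    fanC (.e p) (((List.range W).filter fun b => !(N p).testBit b).map Qb.r) ++ cxC (.e p) .f1

theorem run_splitC {W : ℕ} {N : Fin n × Fin n → ℕ} (p : Fin n × Fin n) (hN : N p ≤ 2 ^ W)
    (z : Qb n → Bool) (hc : ∀ i, z (.c i) = false) (hm : ∀ i, z (.m i) = false)
    (htmp : z .tmp = false) (he : z (.e p) = false) (v : ℕ) (hv : v < 2 ^ (W + 1)) :
    run G (splitC (W + 1) N p) (ket (put .r v z)) =
      if z (.a p) && z .f1 then
        (if ((v + 2 ^ (W + 1) - N p) % 2 ^ (W + 1)).testBit W then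
          ket (put .r (((v + 2 ^ (W + 1) - N p) % 2 ^ (W + 1)) ^^^ (2 ^ (W + 1) - 1 - N p))
            (Function.update (Function.update z (.e p) true) .f1 false))
        else ket (put .r ((v + 2 ^ (W + 1) - N p) % 2 ^ (W + 1)) z))
      else ket (put .r v z) := by
  have hWW : 2 ^ (W + 1) = 2 * 2 ^ W := pow_succ' 2 W
  have hNW : N p < 2 ^ (W + 1) := by have := Nat.two_pow_pos W; omega
  have hfan : ∀ u y, y (.e p) = true → run G (fanC (.e p)
      (((List.range (W + 1)).filter fun b => !(N p).testBit b).map Qb.r)) (ket (put .r u y)) =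
      ket (put .r (u ^^^ (2 ^ (W + 1) - 1 - N p)) y) := by
    intro u y hy
    rw [run_fanC G _ _ (by simp) (nodup_bits r_injective _ _)]
    refine ket_congr fun q => ?_
    rw [put_of_ne _ _ (q := Qb.e p) (by simp), hy, Bool.true_and]
    by_cases hq : ∃ b, Qb.r b = q
    · obtain ⟨b, rfl⟩ := hq
      rw [put_self r_injective, put_self r_injective, Nat.testBit_xor]
      congr 1
      rw [show 2 ^ (W + 1) - 1 - N p = 2 ^ (W + 1) - (N p + 1) by omega,
        Nat.testBit_two_pow_sub_succ hNW, Bool.eq_iff_iff, decide_eq_true_iff,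
        List.mem_map_of_injective r_injective, List.mem_filter, List.mem_range]
      simp
    · push Not at hq
      rw [put_of_ne _ _ hq, put_of_ne _ _ hq, decide_eq_false, Bool.xor_false]
      intro h
      obtain ⟨b, _, hb⟩ := List.mem_map.1 h
      exact hq b hb
  have hfan0 : ∀ u y, y (.e p) = false → run G (fanC (.e p)
      (((List.range (W + 1)).filter fun b => !(N p).testBit b).map Qb.r)) (ket (put .r u y)) =
      ket (put .r u y) := by
    intro u y hy
    rw [run_fanC G _ _ (by simp) (nodup_bits r_injective _ _), put_of_ne _ _ (q := Qb.e p) (by simp), hy]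
    simp
  obtain ⟨z1, hz1⟩ : ∃ z1, z1 = toggle z .tmp (z (.a p) && z .f1) := ⟨_, rfl⟩
  have htmp1 : z1 .tmp = (z (.a p) && z .f1) := by
    rw [hz1, toggle, Function.update_self, htmp, Bool.false_xor]
  have h3 := run_subConstC G (R := Qb.r) r_injective (by simp) (by simp) (by simp) hNW hv z1
      (fun i => by rw [hz1, toggle_ne (by simp), hc]) (fun i => by rw [hz1, toggle_ne (by simp), hm])
  obtain ⟨w, hw⟩ : ∃ w, w = (v + 2 ^ (W + 1) - N p) % 2 ^ (W + 1) := ⟨_, rfl⟩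
  rw [htmp1, ← hw] at h3
  have hlast : ∀ u (y : Qb n → Bool), run G (cxC (.e p) .f1) (ket (put .r u y)) =
      ket (put .r u (toggle y .f1 (y (.e p)))) := by
    intro u y
    rw [run_cxC G (by simp), put_of_ne _ _ (by simp), toggle_put (by simp)]
  rw [splitC, run_append, run_append, run_append, run_append, run_append,
    run_ccxC G (by simp) (by simp) (by simp), put_of_ne _ _ (by simp), put_of_ne _ _ (by simp),
    toggle_put (by simp), ← hz1, h3, ← hw, Nat.add_sub_cancel, run_ccxC G (by simp) (by simp) (by simp),
    put_of_ne _ _ (q := Qb.tmp) (by simp), htmp1, put_self r_injective, toggle_put (by simp),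
    run_ccxC G (by simp) (by simp) (by simp), put_of_ne _ _ (by simp), put_of_ne _ _ (by simp),
    toggle_ne (by simp), toggle_ne (by simp), toggle_put (by simp)]
  have ha1 : z1 (.a p) = z (.a p) := by rw [hz1, toggle_ne (by simp)]
  have hf1 : z1 .f1 = z .f1 := by rw [hz1, toggle_ne (by simp)]
  rw [ha1, hf1]
  have hback : ∀ b, toggle (toggle z1 (.e p) b) .tmp (z (.a p) && z .f1) =
      Function.update z (.e p) b := by
    intro b
    funext q
    simp only [toggle_apply, hz1, Function.update_apply]
    by_cases h1 : q = .tmp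
    · subst h1
      simp
    · by_cases h2 : q = .e p
      · subst h2
        simp [he]
      · simp [h1, h2]
  rw [hback]
  by_cases hA : (z (.a p) && z .f1) = true
  · rw [if_pos hA, if_pos hA, hA, Bool.true_and]
    rw [Bool.and_eq_true] at hA
    by_cases hb : w.testBit W = true
    · rw [hb, if_pos rfl, hfan _ _ (by simp), hlast]
      congr 2
      simp [toggle, hA.2]
    · rw [Bool.not_eq_true] at hb
      rw [hb, if_neg (by simp), ← he, Function.update_eq_self, hfan0 _ _ he, hlast, he, toggle_false]
  · rw [Bool.not_eq_true] at hA
    rw [if_neg (by simp [hA]), if_neg (by simp [hA]), hA, Bool.false_and, ← he,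
      Function.update_eq_self, hfan0 _ _ he, hlast, he, toggle_false]

/-- In the state `y`, the qubits used for sampling are `0`. -/
structure Idle (y : Qb n → Bool) : Prop where
  f1 : y .f1 = false
  e : ∀ p, y (.e p) = false
  r : ∀ b, y (.r b) = false
  m : ∀ b, y (.m b) = false
  c : ∀ b, y (.c b) = false
  o : ∀ b, y (.o b) = false
  anc : ∀ b, y (.anc b) = false
  tok : y .tok = false
  tmp : y .tmp = false
  y : ∀ v, y (.y v) = false

/-- The state in which no pair is chosen yet. -/
noncomputable def actState (y : Qb n → Bool) (v : ℕ) : Qb n → Bool := put .r v (Function.update y .f1 true)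

/-- The state in which the pair `p` is chosen. -/
noncomputable def hitState (y : Qb n → Bool) (p : Fin n × Fin n) (v : ℕ) : Qb n → Bool :=
  put .r v (Function.update y (.e p) true)

theorem run_splitC_idle {W : ℕ} {N : Fin n × Fin n → ℕ} {p : Fin n × Fin n} (hN : N p ≤ 2 ^ W)
    {y : Qb n → Bool} (hy : Idle y) : run G (splitC (W + 1) N p) (ket y) = ket y := by
  have := run_splitC G p hN y hy.c hy.m hy.tmp (hy.e p) 0 (by positivity)
  rw [hy.f1, put_zero r_injective hy.r] at this
  simpa using this

theorem run_splitC_hit {W : ℕ} {N : Fin n × Fin n → ℕ} {p p' : Fin n × Fin n} (hN : N p ≤ 2 ^ W)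
    {y : Qb n → Bool} (hy : Idle y) (hp : p ≠ p') (v : ℕ) (hv : v < 2 ^ (W + 1)) :
    run G (splitC (W + 1) N p) (ket (hitState y p' v)) = ket (hitState y p' v) := by
  have := run_splitC G p hN (Function.update y (.e p') true) (by simp [hy.c]) (by simp [hy.m])
    (by simp [hy.tmp]) (by simp [hy.e, hp]) v hv
  simpa [hy.f1, hitState] using this

/-- Values v ≥ N p are shifted down and fill an initial interval again, ready for the next pair. For
v < N p put v' = N p - 1 - v: modulo 2^(W+1) the difference v - N p is the bitwise complement of v',
so adding the complement of N p bitwise leaves v' ⊕ N p, which is the input that `run_hadC_xor`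
expects. -/
theorem run_splitC_sum {W : ℕ} {N : Fin n × Fin n → ℕ} {p : Fin n × Fin n} (hN : N p ≤ 2 ^ W)
    {y : Qb n → Bool} (hy : Idle y) (R : ℕ) (hR : R ≤ 2 ^ W) (hNR : y (.a p) = true → N p ≤ R) :
    run G (splitC (W + 1) N p) (∑ v ∈ Finset.range R, ket (actState y v)) =
      ∑ v ∈ Finset.range (R - if y (.a p) then N p else 0), ket (actState y v) +
        if y (.a p) then ∑ v ∈ Finset.range (N p), ket (hitState y p (v ^^^ N p)) else 0 := by
  have hWW : 2 ^ (W + 1) = 2 * 2 ^ W := pow_succ' 2 W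
  have key := fun v hv => run_splitC G p hN (Function.update y .f1 true) (by simp [hy.c])
    (by simp [hy.m]) (by simp [hy.tmp]) (by simp [hy.e]) v hv
  have hpos : 0 < 2 ^ W := by positivity
  simp only [actState, hitState]
  rcases ha : y (.a p) with _ | _
  · simp only [Bool.false_eq_true, if_false, Nat.sub_zero, add_zero]
    rw [map_sum]
    refine Finset.sum_congr rfl fun v hv => ?_
    have := key v (by have := Finset.mem_range.1 hv; omega)
    rw [Function.update_of_ne (by simp), ha, Bool.false_and, if_neg (by simp)] at this
    exact this
  · simp only [if_true]
    have hNR' := hNR ha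
    have hR' : R = N p + (R - N p) := by omega
    rw [map_sum]
    conv_lhs => rw [hR', Finset.sum_range_add]
    rw [add_comm]
    refine congrArg₂ (· + ·) ?_ ?_
    · refine Finset.sum_congr rfl fun v hv => ?_
      rw [Finset.mem_range] at hv
      have h1 := key (N p + v) (by omega)
      have h2 : (N p + v + 2 ^ (W + 1) - N p) % 2 ^ (W + 1) = v := by
        rw [show N p + v + 2 ^ (W + 1) - N p = v + 2 ^ (W + 1) by omega, Nat.add_mod_right,
          Nat.mod_eq_of_lt (by omega)]
      rw [h2, testBit_of_le (W := W) (by omega) le_rfl] at h1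
      rw [Function.update_of_ne (by simp), ha, Function.update_self, Bool.and_self, if_pos rfl,
        if_neg (by simp)] at h1
      exact h1
    · rw [← Finset.sum_range_reflect]
      refine Finset.sum_congr rfl fun v hv => ?_
      rw [Finset.mem_range] at hv
      have h1 := key (N p - 1 - v) (by omega)
      have h2 : (N p - 1 - v + 2 ^ (W + 1) - N p) % 2 ^ (W + 1) = 2 ^ (W + 1) - (v + 1) := by
        rw [Nat.mod_eq_of_lt (by omega)]
        omega
      have h3 : (2 ^ (W + 1) - (v + 1)).testBit W = true := by
        rw [testBit_top (by omega)]
        simp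
        omega
      have h4 : (2 ^ (W + 1) - (v + 1)) ^^^ (2 ^ (W + 1) - 1 - N p) = v ^^^ N p := by
        rw [show 2 ^ (W + 1) - 1 - N p = 2 ^ (W + 1) - (N p + 1) by omega]
        refine Nat.eq_of_testBit_eq fun j => ?_
        rw [Nat.testBit_xor, Nat.testBit_xor, Nat.testBit_two_pow_sub_succ (by omega),
          Nat.testBit_two_pow_sub_succ (by omega)]
        by_cases hj : j < W + 1
        · simp [hj]
        · rw [testBit_of_le (W := W + 1) (N := v) (by omega) (by omega),
            testBit_of_le (W := W + 1) (N := N p) (by omega) (by omega)]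
          simp [hj]
      rw [h2, h3, h4] at h1
      have h5 : Function.update (Function.update (Function.update y .f1 true) (.e p) true) .f1 false =
          Function.update y (.e p) true := by
        funext q
        by_cases hq : q = .f1
        · subst hq
          simp [hy.f1]
        · simp [Function.update_apply, hq]
      rw [h5, Function.update_of_ne (by simp), ha, Function.update_self, Bool.and_self, if_pos rfl,
        if_pos rfl] at h1
      exact h1

/-- Samples one of the pairs. -/
def scanC (W : ℕ) (N : Fin n × Fin n → ℕ) (l : List (Fin n × Fin n)) : QCircuit n (Qb n) :=
  l.flatMap (splitC W N)

theorem run_scanC_idle {W : ℕ} {N : Fin n × Fin n → ℕ} (hN : ∀ p, N p ≤ 2 ^ W)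
    {y : Qb n → Bool} (hy : Idle y) (l : List (Fin n × Fin n)) :
    run G (scanC (W + 1) N l) (ket y) = ket y := by
  induction l with
  | nil => rfl
  | cons p l ih => rw [scanC, List.flatMap_cons, run_append, run_splitC_idle G (hN p) hy]; exact ih

theorem run_scanC_hit {W : ℕ} {N : Fin n × Fin n → ℕ} (hN : ∀ p, N p ≤ 2 ^ W)
    {y : Qb n → Bool} (hy : Idle y) (l : List (Fin n × Fin n)) {p : Fin n × Fin n} (hp : p ∉ l)
    (v : ℕ) (hv : v < 2 ^ (W + 1)) :
    run G (scanC (W + 1) N l) (ket (hitState y p v)) = ket (hitState y p v) := by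
  induction l with
  | nil => rfl
  | cons p' l ih =>
    simp only [List.mem_cons, not_or] at hp
    rw [scanC, List.flatMap_cons, run_append, run_splitC_hit G (hN p') hy (Ne.symm hp.1) v hv]
    exact ih hp.2

/-- A branch in which a pair has been hit has `f1` cleared and is left alone by all later pairs; the
other branches keep a uniform superposition over a shorter interval. -/
theorem run_scanC {W : ℕ} {N : Fin n × Fin n → ℕ} (hN : ∀ p, N p ≤ 2 ^ W)
    {y : Qb n → Bool} (hy : Idle y) (l : List (Fin n × Fin n)) (hl : l.Nodup) (R : ℕ)
    (hR : R ≤ 2 ^ W) (hS : (l.map fun p => if y (.a p) then N p else 0).sum ≤ R) :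
    run G (scanC (W + 1) N l) (∑ v ∈ Finset.range R, ket (actState y v)) =
      ∑ v ∈ Finset.range (R - (l.map fun p => if y (.a p) then N p else 0).sum), ket (actState y v) +
        (l.map fun p => if y (.a p) then ∑ v ∈ Finset.range (N p), ket (hitState y p (v ^^^ N p))
          else 0).sum := by
  induction l generalizing R with
  | nil => simp [scanC]
  | cons p l ih =>
    rw [List.nodup_cons] at hl
    simp only [List.map_cons, List.sum_cons] at hS ⊢
    have hNp : y (.a p) = true → N p ≤ R := by
      intro h
      rw [h, if_pos rfl] at hS
      omega
    have hWW : 2 ^ (W + 1) = 2 * 2 ^ W := pow_succ' 2 W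
    have hpos : 0 < 2 ^ W := by positivity
    have hfix : run G (scanC (W + 1) N l)
        (if y (.a p) then ∑ v ∈ Finset.range (N p), ket (hitState y p (v ^^^ N p)) else 0) =
        if y (.a p) then ∑ v ∈ Finset.range (N p), ket (hitState y p (v ^^^ N p)) else 0 := by
      split_ifs
      · rw [map_sum]
        refine Finset.sum_congr rfl fun v hv => ?_
        rw [Finset.mem_range] at hv
        have := hN p
        exact run_scanC_hit G hN hy l hl.1 _ (Nat.xor_lt_two_pow (by omega) (by omega))
      · simp
    have := run_splitC_sum G (hN p) hy R hR hNp
    rw [scanC, List.flatMap_cons, run_append, this, map_add]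
    change run G (scanC (W + 1) N l) _ + run G (scanC (W + 1) N l) _ = _
    rw [ih hl.2 _ (by omega) (by omega), hfix, Nat.sub_sub]
    abel

theorem cost_scanC (W : ℕ) (N : Fin n × Fin n → ℕ) (l : List (Fin n × Fin n)) :
    QCircuit.cost (scanC W N l) ≤ l.length * (27 * W + 4) := by
  refine cost_flatMap_le l _ _ fun p _ => ?_
  have h1 := cost_ccxC (n := n) (Qb.a p) Qb.f1 Qb.tmp
  have h2 := cost_subConstC (n := n) Qb.r W (N p)
  have h3 := cost_ccxC (n := n) Qb.tmp (Qb.r (W - 1)) (Qb.e p)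
  have h4 := cost_fanC (n := n) (Qb.e p) (((List.range W).filter fun b => !(N p).testBit b).map Qb.r)
  have h5 := List.length_filter_le (fun b => !(N p).testBit b) (List.range W)
  have h6 := cost_cxC (n := n) (Qb.e p) Qb.f1
  rw [List.length_map] at h4
  rw [List.length_range] at h5
  simp only [splitC, cost_append]
  omega

end Pairs

/-! ### Encoding the chosen pair by a single qubit -/

section Encoding

variable {n : ℕ} (G : SimpleGraph (Fin n))

/-- Adds the register `t` to `r`, if `f1` is set. -/
def xorTC (W : ℕ) : QCircuit n (Qb n) := (List.range W).flatMap fun b => ccxC .f1 (.t b) (.r b)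

theorem run_xorTC_idle (W : ℕ) (y : Qb n → Bool) (hf : y .f1 = false) :
    run G (xorTC W) (ket y) = ket y := by
  unfold xorTC
  induction List.range W with
  | nil => rfl
  | cons b l ih =>
    rw [List.flatMap_cons, run_append, run_ccxC G (by simp) (by simp) (by simp), hf, Bool.false_and,
      toggle_false, ih]

theorem run_xorTC (W T v : ℕ) (hT : T < 2 ^ W) (y : Qb n → Bool) (hf : y .f1 = true)
    (ht : ∀ b, y (.t b) = T.testBit b) :
    run G (xorTC W) (ket (put .r v y)) = ket (put .r (v ^^^ T) y) := by
  have key : ∀ l : List ℕ, l.Nodup → ∀ z : Qb n → Bool, z .f1 = true → (∀ b, z (.t b) = T.testBit b) →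
      run G (l.flatMap fun b => ccxC .f1 (.t b) (.r b)) (ket z) = ket fun q => match q with
        | .r b => xor (z (.r b)) (decide (b ∈ l) && T.testBit b)
        | q => z q := by
    intro l hl
    induction l with
    | nil =>
      intro z _ _
      refine ket_congr fun q => ?_
      cases q <;> simp
    | cons b l ih =>
      intro z hf ht
      rw [List.nodup_cons] at hl
      rw [List.flatMap_cons, run_append, run_ccxC G (by simp) (by simp) (by simp), hf, ht,
        Bool.true_and, ih hl.2 _ (by rw [toggle_ne (by simp), hf])
          (fun b => by rw [toggle_ne (by simp), ht])]
      refine ket_congr fun q => ?_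
      cases q with
      | r b' =>
        simp only [toggle_apply, Qb.r.injEq, List.mem_cons]
        by_cases h : b' = b
        · subst h
          simp [hl.1]
        · simp [h]
      | _ => simp [toggle_apply]
  rw [xorTC, key _ List.nodup_range _ (by rw [put_of_ne _ _ (by simp), hf])
    (fun b => by rw [put_of_ne _ _ (by simp), ht])]
  refine ket_congr fun q => ?_
  by_cases hq : ∃ b, Qb.r b = q
  · obtain ⟨b, rfl⟩ := hq
    simp only [put_self r_injective, Nat.testBit_xor, List.mem_range]
    by_cases hb : b < W
    · simp [hb]
    · have := testBit_of_le hT (not_lt.1 hb)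
      simp [hb, this]
  · push Not at hq
    rw [put_of_ne _ _ hq]
    cases q with
    | r b => exact absurd rfl (hq b)
    | _ => simp

/-- The inverse of the preparation of `√2 ^ b`, where `b` runs over the bits of `N p`. -/
noncomputable def unprepC (W : ℕ) (N : Fin n × Fin n → ℕ) (p : Fin n × Fin n) : QCircuit n (Qb n) :=
  QCircuit.inv (cxC (.e p) .tok ++ chainC (.e p) .tok
    (((List.range W).filter fun b => (N p).testBit b).map
      fun b => (Qb.r b, Real.sqrt (2 ^ b / N p))) 1)

theorem run_unprepC_idle (W : ℕ) (N : Fin n × Fin n → ℕ) (p : Fin n × Fin n) (y : Qb n → Bool)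
    (he : y (.e p) = false) (ht : y .tok = false) : run G (unprepC W N p) (ket y) = ket y := by
  refine run_inv_of_eq G ?_
  rw [run_append, run_cxC G (by simp), he, toggle_false, run_chainC_idle G (by simp) _ _ _ _ ht (.inl he)]
  simp only [List.mem_map]
  rintro q ⟨b, _, rfl⟩
  simp

theorem sum_bits_nat (W N : ℕ) (hN : N < 2 ^ W) :
    (((List.range W).filter fun b => N.testBit b).map fun b => 2 ^ b).sum = N := by
  induction W generalizing N with
  | zero =>
    obtain rfl : N = 0 := by simpa using hN
    rfl
  | succ W ih =>
    rw [List.range_succ, List.filter_append, List.map_append, List.sum_append]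
    by_cases h : N < 2 ^ W
    · rw [ih N h]
      simp [testBit_of_le h le_rfl]
    · obtain ⟨N, rfl⟩ : ∃ N', N = 2 ^ W + N' := ⟨N - 2 ^ W, by omega⟩
      have hN' : N < 2 ^ W := by rw [pow_succ] at hN; omega
      have hb := fun j => Nat.testBit_two_pow_mul_add 1 hN' j
      simp only [mul_one] at hb
      have : ((List.range W).filter fun b => (2 ^ W + N).testBit b) =
          (List.range W).filter fun b => N.testBit b := by
        refine List.filter_congr fun b hb' => ?_
        rw [hb, if_pos (List.mem_range.1 hb')]
      have hW : (2 ^ W + N).testBit W = true := by simp [hb]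
      rw [this, ih N hN', List.filter_cons, if_pos hW]
      simp [add_comm]

theorem update_r (b : ℕ) (y : Qb n → Bool) (hy : ∀ b, y (.r b) = false) :
    Function.update y (.r b) true = put .r (2 ^ b) y := by
  funext q
  by_cases hq : ∃ i, Qb.r i = q
  · obtain ⟨i, rfl⟩ := hq
    rw [put_self r_injective, Nat.testBit_two_pow, Function.update_apply, hy]
    by_cases h : i = b
    · simp [h]
    · simp [h, Ne.symm h]
  · push Not at hq
    rw [put_of_ne _ _ hq, Function.update_of_ne (hq b).symm]

/-- Read backwards: a token of amplitude 1 is distributed to the bits b of `N p` with amplitudes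
√(2^b / N p). Their squares sum to 1 because the powers 2^b sum to `N p`, so no token is left over.
-/
theorem run_unprepC {W : ℕ} {N : Fin n × Fin n → ℕ} (p : Fin n × Fin n) (hN : N p < 2 ^ W)
    {y : Qb n → Bool} (hy : Idle y) :
    run G (unprepC W N p) (∑ b ∈ Finset.range W,
      if (N p).testBit b then ((Real.sqrt 2 : ℂ) ^ b) • ket (hitState y p (2 ^ b)) else 0) =
      (Real.sqrt (N p) : ℂ) • ket (hitState y p 0) := by
  rcases Nat.eq_zero_or_pos (N p) with h0 | h0
  · simp [h0]
  have hN0 : (0 : ℝ) < N p := by exact_mod_cast h0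
  have h00 : hitState y p 0 = Function.update y (.e p) true :=
    put_zero r_injective fun b => by rw [Function.update_of_ne (by simp), hy.r]
  refine run_inv_of_eq G ?_
  set l := ((List.range W).filter fun b => (N p).testBit b).map
      fun b => (Qb.r (n := n) b, Real.sqrt (2 ^ b / N p)) with hl
  have hsq : (l.map fun q => q.2 ^ 2).sum = 1 := by
    rw [hl, List.map_map]
    have : ((fun q : Qb n × ℝ => q.2 ^ 2) ∘ fun b => (Qb.r (n := n) b, Real.sqrt (2 ^ b / N p))) =
        fun b : ℕ => ((2 ^ b : ℕ) : ℝ) * (N p : ℝ)⁻¹ := by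
      funext b
      rw [Function.comp, Real.sq_sqrt (by positivity)]
      push_cast
      rfl
    rw [this, List.sum_map_mul_right]
    have h1 := congrArg (Nat.cast (R := ℝ)) (sum_bits_nat W (N p) hN)
    rw [Nat.cast_list_sum, List.map_map] at h1
    rw [show (fun b : ℕ => ((2 ^ b : ℕ) : ℝ)) = Nat.cast ∘ fun b => 2 ^ b from rfl, h1,
      mul_inv_cancel₀ hN0.ne']
  set z := Function.update (hitState y p 0) .tok true with hz
  have h1 : run G (cxC (.e p) .tok) (ket (hitState y p 0)) = ket z := by
    rw [run_cxC G (by simp), h00, hz, h00]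
    simp [toggle, hy.tok]
  have h2 := run_chainC G (g := Qb.e p) (tok := Qb.tok) (by simp) l 1 zero_le_one
    (by
      simp only [hl, List.mem_map]
      rintro q ⟨b, _, rfl⟩
      exact ⟨Real.sqrt_nonneg _, by simp, by simp⟩)
    (by rw [hsq]; norm_num)
    (by
      rw [hl, List.map_map]
      exact nodup_bits r_injective W _)
    z
    (by
      simp only [hl, List.mem_map]
      rintro q ⟨b, _, rfl⟩
      simp [hz, h00, hy.r])
    (by simp [hz, h00]) (by simp [hz])
  rw [hsq] at h2
  simp only [Complex.ofReal_one, one_smul, one_pow, sub_self, Real.sqrt_zero, Complex.ofReal_zero,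
    zero_smul, add_zero] at h2
  rw [map_smul, run_append, h1, h2, hl, List.map_map]
  have h3 : (((List.range W).filter fun b => (N p).testBit b).map
      ((fun q : Qb n × ℝ => (q.2 : ℂ) • ket (Function.update (Function.update z Qb.tok false) q.1 true)) ∘
        fun b => (Qb.r (n := n) b, Real.sqrt (2 ^ b / N p)))).sum =
      ∑ b ∈ Finset.range W, if (N p).testBit b then
        (Real.sqrt (2 ^ b / N p) : ℂ) • ket (hitState y p (2 ^ b)) else 0 := by
    rw [← Finset.sum_filter, ← List.sum_toFinset _ (List.nodup_range.filter _)]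
    refine Finset.sum_congr ?_ fun b _ => ?_
    · ext b
      simp
    · have h4 : Function.update z Qb.tok false = Function.update y (.e p) true := by
        rw [hz, h00, Function.update_idem]
        conv_rhs => rw [← Function.update_eq_self Qb.tok (Function.update y (.e p) true)]
        rw [Function.update_of_ne (a := Qb.tok) (by simp), hy.tok]
      simp only [Function.comp, h4]
      rw [update_r _ _ fun b => by rw [Function.update_of_ne (by simp), hy.r]]
      rfl
  rw [h3, Finset.smul_sum]
  refine Finset.sum_congr rfl fun b _ => ?_
  split_ifs
  · rw [smul_smul, ← Complex.ofReal_mul, ← Complex.ofReal_pow]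
    congr 2
    rw [← Real.sqrt_mul hN0.le, mul_div_cancel₀ _ hN0.ne', Real.sqrt_eq_rpow, Real.sqrt_eq_rpow,
      ← Real.rpow_natCast, ← Real.rpow_natCast, ← Real.rpow_mul (by norm_num),
      ← Real.rpow_mul (by norm_num), mul_comm]
  · simp

/-- Replaces the one-hot encoding of `b` in `r` by its binary encoding in the register `y`, if `f1` is
set. -/
def compressC (W : ℕ) : QCircuit n (Qb n) :=
  ((List.range W).flatMap fun b => fanC (.r b) (((List.finRange n).filter
    fun v => b.testBit v.val).map Qb.y)) ++
  (List.range W).flatMap fun b => andC .anc ((List.finRange n).map fun v => (Qb.y v, b.testBit v.val)) 0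
    .f1 (.r b)

/-- The state in which no pair is chosen, with the label `u`. -/
def restState (y : Qb n → Bool) (u : Fin n → Bool) : Qb n → Bool
  | .f1 => true
  | .y v => u v
  | q => y q

theorem anc_injective : Function.Injective (Qb.anc (n := n)) := fun i j h => by simpa using h

theorem run_andC_y (l : List (Qb n × Bool)) (hl : ∀ p ∈ l, ∃ v, p.1 = .y v) (b : ℕ) (y : Qb n → Bool)
    (hy : ∀ j, y (.anc j) = false) :
    run G (andC .anc l 0 .f1 (.r b)) (ket y) =
      ket (toggle y (.r b) (y .f1 && l.all fun p => y p.1 == p.2)) := by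
  refine run_andC G anc_injective l 0 .f1 (.r b) (by simp) (by simp) (by simp) (fun p hp => ?_) y
    fun j _ => hy j
  obtain ⟨v, hv⟩ := hl p hp
  simp [hv]

theorem run_fan_idle (W : ℕ) (y : Qb n → Bool) (hr : ∀ b, y (.r b) = false) :
    run G ((List.range W).flatMap fun b => fanC (.r b) (((List.finRange n).filter
      fun v => b.testBit v.val).map Qb.y)) (ket y) = ket y := by
  induction List.range W with
  | nil => rfl
  | cons b l ih =>
    rw [List.flatMap_cons, run_append, run_fanC G _ _ (by simp)
      (((List.nodup_finRange n).filter _).map fun i j h => by simpa using h), hr]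
    simpa using ih

theorem run_compressC_idle (W : ℕ) (y : Qb n → Bool) (hr : ∀ b, y (.r b) = false)
    (hf : y .f1 = false) (ha : ∀ j, y (.anc j) = false) :
    run G (compressC W) (ket y) = ket y := by
  rw [compressC, run_append, run_fan_idle G W y hr]
  induction List.range W with
  | nil => rfl
  | cons b l ih =>
    rw [List.flatMap_cons, run_append, run_andC_y G _ (by simp) _ _ ha, hf, Bool.false_and, toggle_false,
      ih]

/-- Because of W ≤ 2^n, the `n` qubits of the register `y` distinguish all b < W; so the binary
label determines which qubit of `r` is set, and this qubit can be cleared by a test of the label. -/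
theorem run_compressC {W b : ℕ} (hW : W ≤ 2 ^ n) (hb : b < W) {y : Qb n → Bool} (hy : Idle y) :
    run G (compressC W) (ket (actState y (2 ^ b))) =
      ket (restState y fun v => b.testBit v.val) := by
  have hr : ∀ i, actState y (2 ^ b) (.r i) = decide (b = i) := fun i => by
    rw [actState, put_self r_injective, Nat.testBit_two_pow]
  obtain ⟨z, hz⟩ : ∃ z : Qb n → Bool, z = fun q => match q with
    | .y v => b.testBit v.val
    | q => actState y (2 ^ b) q := ⟨_, rfl⟩
  have h1 : run G ((List.range W).flatMap fun b => fanC (.r b) (((List.finRange n).filter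
      fun v => b.testBit v.val).map Qb.y)) (ket (actState y (2 ^ b))) = ket z := by
    have key : ∀ l : List ℕ, l.Nodup → ∀ z : Qb n → Bool, (∀ i, z (.r i) = decide (b = i)) →
        run G (l.flatMap fun b => fanC (.r b) (((List.finRange n).filter
          fun v => b.testBit v.val).map Qb.y)) (ket z) = ket fun q => match q with
            | .y v => xor (z (.y v)) (decide (b ∈ l) && b.testBit v.val)
            | q => z q := by
      intro l hl
      induction l with
      | nil =>
        intro z _
        refine ket_congr fun q => ?_
        cases q <;> simp
      | cons i l ih =>
        intro z hz
        rw [List.nodup_cons] at hl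
        rw [List.flatMap_cons, run_append, run_fanC G _ _ (by simp)
          (((List.nodup_finRange n).filter _).map fun i j h => by simpa using h), ih hl.2 _ (by simp [hz])]
        refine ket_congr fun q => ?_
        cases q with
        | y v =>
          simp only [hz, List.mem_map, List.mem_filter, List.mem_finRange, true_and, Qb.y.injEq,
            exists_eq_right, List.mem_cons, Bool.decide_eq_true]
          by_cases h : b = i
          · subst h
            simp [hl.1]
          · simp [h]
        | _ => simp
    rw [key _ List.nodup_range _ hr, hz]
    refine ket_congr fun q => ?_
    cases q with
    | y v => simp [hb, actState, hy.y]
    | _ => rfl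
  have h2 : ∀ l : List ℕ, l.Nodup → (∀ i ∈ l, i < W) → ∀ z : Qb n → Bool, z .f1 = true →
      (∀ v, z (.y v) = b.testBit v.val) → (∀ i, z (.anc i) = false) →
      run G (l.flatMap fun b => andC .anc ((List.finRange n).map fun v => (Qb.y v, b.testBit v.val)) 0
        .f1 (.r b)) (ket z) = ket (toggle z (.r b) (decide (b ∈ l))) := by
    intro l hl hlW
    induction l with
    | nil =>
      intro z _ _ _
      simp
    | cons i l ih =>
      intro z hf hzy hza
      rw [List.nodup_cons] at hl
      have hi := hlW i (by simp)
      have hall : (((List.finRange n).map fun v => (Qb.y v, i.testBit v.val)).all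
          fun p => z p.1 == p.2) = decide (b = i) := by
        rw [Bool.eq_iff_iff, List.all_eq_true, decide_eq_true_iff]
        constructor
        · intro h
          refine Nat.eq_of_testBit_eq fun j => ?_
          by_cases hj : j < n
          · have := h (Qb.y ⟨j, hj⟩, i.testBit j) (List.mem_map.2 ⟨⟨j, hj⟩, List.mem_finRange _, rfl⟩)
            simpa [hzy] using this
          · rw [testBit_of_le (W := n) (by omega) (by omega),
              testBit_of_le (W := n) (by omega) (by omega)]
        · rintro rfl p hp
          obtain ⟨v, _, rfl⟩ := List.mem_map.1 hp
          simp [hzy]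
      rw [List.flatMap_cons, run_append, run_andC_y G _ (by simp) _ _ hza, hf, hall, Bool.true_and,
        ih hl.2 (fun i hi => hlW i (by simp [hi])) _ (by rw [toggle_ne (by simp), hf])
          (fun v => by rw [toggle_ne (by simp), hzy]) (fun v => by rw [toggle_ne (by simp), hza])]
      by_cases h : b = i
      · subst h
        rw [toggle_toggle]
        simp [hl.1]
      · simp [h]
  rw [compressC, run_append, h1, h2 _ List.nodup_range (by simp) _ (by simp [hz, actState]) (by simp [hz])
    (by simp [hz, actState, hy.anc])]
  refine ket_congr fun q => ?_
  rw [toggle_apply]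
  cases q with
  | r i =>
    by_cases h : i = b
    · subst h
      simp [hz, hr, hb, restState, hy.r]
    · simp [hz, hr, h, Ne.symm h, restState, hy.r]
  | _ => simp [hz, actState, restState]

theorem cost_unprepC (W : ℕ) (N : Fin n × Fin n → ℕ) (p : Fin n × Fin n) :
    QCircuit.cost (unprepC W N p) ≤ 4 * W + 1 := by
  have h1 := cost_cxC (n := n) (Qb.e p) Qb.tok
  have h2 := cost_chainC (n := n) (Qb.e p) Qb.tok (((List.range W).filter fun b => (N p).testBit b).map
      fun b => (Qb.r b, Real.sqrt (2 ^ b / N p))) 1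
  have h5 := List.length_filter_le (fun b => (N p).testBit b) (List.range W)
  rw [List.length_map] at h2
  rw [List.length_range] at h5
  rw [unprepC, cost_inv, cost_append]
  omega

theorem cost_xorTC (W : ℕ) : QCircuit.cost (xorTC (n := n) W) ≤ W := by
  simpa [xorTC] using cost_flatMap_le (n := n) (List.range W) (fun b => ccxC (Qb.f1 (n := n)) (.t b) (.r b)) 1
    fun b _ => cost_ccxC _ _ _

theorem cost_compressC (W : ℕ) : QCircuit.cost (compressC (n := n) W) ≤ W * (11 * n + 1) := by
  have h1 := cost_flatMap_le (n := n) (List.range W) (fun b => fanC (Qb.r (n := n) b) (((List.finRange n).filter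
    fun v => b.testBit v.val).map Qb.y)) n fun b _ => by
      refine (cost_fanC _ _).trans ?_
      rw [List.length_map]
      exact (List.length_filter_le _ _).trans (by simp)
  have h2 := cost_flatMap_le (n := n) (List.range W) (fun b => andC Qb.anc ((List.finRange n).map
    fun v => (Qb.y v, b.testBit v.val)) 0 Qb.f1 (.r b)) (10 * n + 1) fun b _ => by
      refine (cost_andC _ _ _ _ _).trans ?_
      simp
  rw [List.length_range] at h1 h2
  rw [compressC, cost_append]
  linarith

end Encoding

/-! ### Preparing the superposition of the pairs -/

section Prepare

variable {n : ℕ} (G : SimpleGraph (Fin n))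

/-- All the qubits used to prepare the superposition of the pairs are `0`. -/
structure Clean (z : Qb n → Bool) : Prop extends Idle z where
  a : ∀ p, z (.a p) = false
  t : ∀ b, z (.t b) = false
  ok : z .ok = false

/-- The circuit maps a state with the simplex `x` to a superposition of itself, of the pairs, and of
rest states; if `x` is good, then the admissible pairs have the amplitudes `α p / √2`. -/
def Prepares (μ : Mode) (α : Fin n × Fin n → ℝ) (good : (Fin n → Bool) → Prop)
    (c : QCircuit n (Qb n)) : Prop :=
  ∀ (G : SimpleGraph (Fin n)) (y : Qb n → Bool), Clean y →
    ∃ (c₀ : ℂ) (β : Fin n × Fin n → ℂ) (γ : (Fin n → Bool) → ℂ),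
      run G c (ket y) = c₀ • ket y + ∑ p, β p • ket (Function.update y (.e p) true) +
        ∑ u, γ u • ket (restState y u) ∧
      (good (fun v => y (.x v)) → (Real.sqrt 2 : ℂ) * c₀ = 1 ∧
        ∀ p, (Real.sqrt 2 : ℂ) * β p = if μ.mem (fun v => y (.x v)) p then (α p : ℂ) else 0)

/-- The part of the preparation that acts on the qubit `f1` and the register `r`. -/
noncomputable def sampleC (s W : ℕ) (N : Fin n × Fin n → ℕ) : QCircuit n (Qb n) :=
  uniformC s ++ scanC W N (pairs n) ++ xorTC W ++ hadC W ++ (pairs n).flatMap (unprepC W N) ++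
    compressC W

/-- The superposition with the amplitudes `√2 ^ b` of the bits `b` of `N p` in the register `r`. -/
noncomputable def bitsVec (W : ℕ) (N : Fin n × Fin n → ℕ) (y : Qb n → Bool) (p : Fin n × Fin n) :
    Vec (Qb n) :=
  ∑ b ∈ Finset.range W, if (N p).testBit b then ((Real.sqrt 2 : ℂ) ^ b) • ket (hitState y p (2 ^ b))
    else 0

theorem hitState_zero {y : Qb n → Bool} (hy : Idle y) (p : Fin n × Fin n) :
    hitState y p 0 = Function.update y (.e p) true :=
  put_zero r_injective fun b => by rw [Function.update_of_ne (by simp), hy.r]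

theorem run_flatMap_unprepC_idle (W : ℕ) (N : Fin n × Fin n → ℕ) (l : List (Fin n × Fin n))
    (y : Qb n → Bool) (he : ∀ p ∈ l, y (.e p) = false) (ht : y .tok = false) :
    run G (l.flatMap (unprepC W N)) (ket y) = ket y := by
  induction l with
  | nil => rfl
  | cons p l ih =>
    rw [List.flatMap_cons, run_append, run_unprepC_idle G W N p y (he p (by simp)) ht,
      ih fun p hp => he p (by simp [hp])]

theorem run_flatMap_unprepC {W : ℕ} {N : Fin n × Fin n → ℕ} (hN : ∀ p, N p < 2 ^ W)
    (l : List (Fin n × Fin n)) (hl : l.Nodup) {y : Qb n → Bool} (hy : Idle y) {p : Fin n × Fin n}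
    (hp : p ∈ l) :
    run G (l.flatMap (unprepC W N)) (bitsVec W N y p) =
      (Real.sqrt (N p) : ℂ) • ket (Function.update y (.e p) true) := by
  induction l with
  | nil => simp at hp
  | cons p' l ih =>
    rw [List.nodup_cons] at hl
    rw [List.flatMap_cons, run_append]
    rcases List.mem_cons.1 hp with rfl | hp
    · rw [bitsVec, run_unprepC G p (hN p) hy, map_smul, hitState_zero hy,
        run_flatMap_unprepC_idle G W N l _ (fun p' hp' => ?_) (by simp [hy.tok])]
      have : p' ≠ p := fun h => hl.1 (h ▸ hp')
      simp [hy.e, this]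
    · have hne : p' ≠ p := fun h => hl.1 (h ▸ hp)
      have : run G (unprepC W N p') (bitsVec W N y p) = bitsVec W N y p := by
        rw [bitsVec, map_sum]
        refine Finset.sum_congr rfl fun b _ => ?_
        split_ifs
        · rw [map_smul, run_unprepC_idle G W N p' _ (by simp [hitState, hne, hy.e])
            (by simp [hitState, hy.tok])]
        · simp
      rw [this, ih hl.2 hp]

theorem run_sampleC_idle {s W : ℕ} {N : Fin n × Fin n → ℕ} (hN : ∀ p, N p ≤ 2 ^ W)
    {y : Qb n → Bool} (hy : Idle y) : run G (sampleC s (W + 1) N) (ket y) = ket y := by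
  rw [sampleC, run_append, run_append, run_append, run_append, run_append, run_uniformC_idle G _ _ hy.f1,
    run_scanC_idle G hN hy, run_xorTC_idle G _ _ hy.f1, run_hadC_idle G _ _ hy.o fun i _ => hy.r i,
    run_flatMap_unprepC_idle G _ _ _ _ (fun p _ => hy.e p) hy.tok,
    run_compressC_idle G _ _ hy.r hy.f1 hy.anc]

/-- The register `r` is erased in two ways. For a hit pair, `e p` selects the constant `N p`, whose
bits are known to the circuit. In the rest branch the length T depends on the simplex, so no fixed
rotation erases it; instead the position of the bit is kept as a label in `y`, which is harmless
since rest states do not contribute to the overlaps. -/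
theorem run_sampleC {s W : ℕ} {N : Fin n × Fin n → ℕ} (hN : ∀ p, N p ≤ 2 ^ W)
    (hs : s < W) (hWn : W + 1 ≤ 2 ^ n) {y : Qb n → Bool} (hy : Idle y)
    (hS : (∑ p, if y (.a p) then N p else 0) ≤ 2 ^ s)
    (hT : ∀ b, y (.t b) = (2 ^ s - ∑ p, if y (.a p) then N p else 0).testBit b) :
    ((Real.sqrt 2 : ℂ) ^ s) • run G (sampleC s (W + 1) N) (ket (Function.update y .f1 true)) =
      ∑ p, (if y (.a p) then (Real.sqrt (N p) : ℂ) else 0) • ket (Function.update y (.e p) true) +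
      ∑ b ∈ Finset.range (W + 1),
        (if (2 ^ s - ∑ p, if y (.a p) then N p else 0).testBit b then (Real.sqrt 2 : ℂ) ^ b else 0) •
          ket (restState y fun v => b.testBit v.val) := by
  set z := Function.update y .f1 true with hz
  have hWs : 2 ^ s ≤ 2 ^ W := Nat.pow_le_pow_right (by norm_num) hs.le
  have hpos := Nat.two_pow_pos W
  have hWW : 2 ^ (W + 1) = 2 * 2 ^ W := pow_succ' 2 W
  obtain ⟨T, hTdef⟩ : ∃ T, T = 2 ^ s - ∑ p, if y (.a p) then N p else 0 := ⟨_, rfl⟩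
  rw [← hTdef] at hT ⊢
  have hTlt : T < 2 ^ (W + 1) := by omega
  have hzr : ∀ b, z (.r b) = false := fun b => by rw [hz, Function.update_of_ne (by simp), hy.r]
  have hzo : ∀ b, z (.o b) = false := fun b => by rw [hz, Function.update_of_ne (by simp), hy.o]
  have hNlt : ∀ p, N p < 2 ^ (W + 1) := fun p => by have := hN p; omega
  have hlist : ((pairs n).map fun p => if y (.a p) then N p else 0).sum =
      ∑ p, if y (.a p) then N p else 0 := by rw [pairs, Finset.sum_map_toList]
  have h1 := run_uniformC G s z (by simp [hz]) hzr
  have h2 := run_scanC G hN hy (pairs n) nodup_pairs (2 ^ s) hWs (by rw [hlist]; exact hS)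
  rw [hlist, ← hTdef, pairs, Finset.sum_map_toList] at h2
  have h3 : run G (xorTC (W + 1)) (∑ v ∈ Finset.range T, ket (actState y v)) =
      ∑ v ∈ Finset.range T, ket (put .r (v ^^^ T) z) := by
    rw [map_sum]
    exact Finset.sum_congr rfl fun v _ => run_xorTC G (W + 1) T v hTlt z (by simp [hz])
      fun b => by rw [hz, Function.update_of_ne (by simp), hT]
  have h3' : ∀ p v, run G (xorTC (W + 1)) (ket (hitState y p v)) = ket (hitState y p v) := fun p v =>
    run_xorTC_idle G _ _ (by simp [hitState, hy.f1])
  have h4 := run_hadC_xor G (W + 1) T hTlt z hzo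
  have h4' : ∀ p, run G (hadC (W + 1)) (∑ v ∈ Finset.range (N p), ket (hitState y p (v ^^^ N p))) =
      bitsVec (W + 1) N y p := fun p =>
    run_hadC_xor G (W + 1) (N p) (hNlt p) (Function.update y (.e p) true) (by simp [hy.o])
  have h5 : ∀ b, run G ((pairs n).flatMap (unprepC (W + 1) N)) (ket (put .r (2 ^ b) z)) =
      ket (put .r (2 ^ b) z) := fun b =>
    run_flatMap_unprepC_idle G _ _ _ _ (by simp [hz, hy.e]) (by simp [hz, hy.tok])
  have h5' := fun p => run_flatMap_unprepC G hNlt (pairs n) nodup_pairs hy (mem_pairs p)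
  have h6 : ∀ b < W + 1, run G (compressC (W + 1)) (ket (put .r (2 ^ b) z)) =
      ket (restState y fun v => b.testBit v.val) := fun b hb => run_compressC G hWn hb hy
  have h6' : ∀ p, run G (compressC (W + 1)) (ket (Function.update y (.e p) true)) =
      ket (Function.update y (.e p) true) := fun p =>
    run_compressC_idle G _ _ (by simp [hy.r]) (by simp [hy.f1]) (by simp [hy.anc])
  have e1 : run G (uniformC s ++ scanC (W + 1) N (pairs n) ++ xorTC (W + 1))
      (((Real.sqrt 2 : ℂ) ^ s) • ket z) = ∑ v ∈ Finset.range T, ket (put .r (v ^^^ T) z) +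
      ∑ p, if y (.a p) then ∑ v ∈ Finset.range (N p), ket (hitState y p (v ^^^ N p)) else 0 := by
    rw [run_append, run_append, map_smul, h1]
    refine (congrArg _ h2).trans ?_
    rw [map_add, h3, map_sum]
    refine congrArg₂ (· + ·) rfl (Finset.sum_congr rfl fun p _ => ?_)
    split_ifs
    · rw [map_sum]
      exact Finset.sum_congr rfl fun v _ => h3' p _
    · simp
  rw [← map_smul, sampleC, run_append, run_append, run_append, e1, map_add, h4, map_add, map_add, add_comm]
  refine congrArg₂ (· + ·) ?_ ?_
  · rw [map_sum, map_sum, map_sum]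
    refine Finset.sum_congr rfl fun p _ => ?_
    split_ifs
    · rw [h4', h5', map_smul, h6']
    · simp
  · rw [map_sum, map_sum]
    refine Finset.sum_congr rfl fun b hb => ?_
    split_ifs
    · rw [map_smul, map_smul, h5, h6 b (Finset.mem_range.1 hb)]
    · simp

/-- The preparation for integral masses `N p`, in units of `2 ^ (-s)`. -/
noncomputable def prepC (μ : Mode) (s W : ℕ) (N : Fin n × Fin n → ℕ) : QCircuit n (Qb n) :=
  setupC μ s W N ++ reflC .ok .f1 (Real.pi / 4) ++ sampleC s W N ++ (setupC μ s W N).inv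

theorem Idle.setupState (μ : Mode) (T : ℕ) (b : Bool) {y : Qb n → Bool} (hy : Idle y) :
    Idle (setupState μ T b y) where
  f1 := hy.f1
  e := hy.e
  r := hy.r
  m := hy.m
  c := hy.c
  o := hy.o
  anc := hy.anc
  tok := hy.tok
  tmp := hy.tmp
  y := hy.y

theorem setupState_update_e (μ : Mode) (T : ℕ) (b : Bool) (y : Qb n → Bool) (p : Fin n × Fin n) :
    Function.update (setupState μ T b y) (.e p) true =
      setupState μ T b (Function.update y (.e p) true) := by
  funext q
  cases q <;> simp [setupState, Function.update_apply]

theorem setupState_restState (μ : Mode) (T : ℕ) (b : Bool) (y : Qb n → Bool) (u : Fin n → Bool) :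
    restState (setupState μ T b y) u = setupState μ T b (restState y u) := by
  funext q
  cases q <;> rfl

theorem sqrt_two_mul_cos : (Real.sqrt 2 : ℂ) * Real.cos (Real.pi / 4) = 1 := by
  rw [Real.cos_pi_div_four]
  norm_cast
  rw [← mul_div_assoc, Real.mul_self_sqrt (by norm_num)]; norm_num

theorem sqrt_two_mul_sin : (Real.sqrt 2 : ℂ) * Real.sin (Real.pi / 4) = 1 := by
  rw [Real.sin_pi_div_four, ← Real.cos_pi_div_four, sqrt_two_mul_cos]

theorem sqrt_two_ne_zero : (Real.sqrt 2 : ℂ) ≠ 0 := by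
  norm_cast
  positivity

/-- The Hadamard gate on `f1`, controlled by `ok`, keeps the amplitude 1/√2 on the initial state and
sends 1/√2 to the sampling. If the mass is too large, `ok` is off, the middle part is idle, and the
whole circuit acts as the identity. -/
theorem prepares_prepC (μ : Mode) {s W : ℕ} {N : Fin n × Fin n → ℕ} (hN : ∀ p, N p ≤ 2 ^ s)
    (hW : n ^ 2 * 2 ^ s ≤ 2 ^ W) (hs : s < W) (hWn : W + 1 ≤ 2 ^ n) :
    Prepares μ (fun p => Real.sqrt (N p / 2 ^ s)) (fun x => μ.mass N x ≤ 2 ^ s)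
      (prepC μ s (W + 1) N) := by
  intro G y hy
  obtain ⟨T, hT, hT1, h1⟩ := run_setupC G μ hN hW hs y hy.a hy.t hy.m hy.c hy.tmp hy.ok
  by_cases hS : μ.mass N (fun v => y (.x v)) ≤ 2 ^ s
  · obtain ⟨S, hSdef⟩ : ∃ S, S = μ.mass N (fun v => y (.x v)) := ⟨_, rfl⟩
    have hT2 := hT1 hS
    rw [decide_eq_true hS] at h1
    set z := setupState μ T true y with hz
    have hzI : Idle z := hy.toIdle.setupState μ T true
    have hza : (∑ p, if z (.a p) then N p else 0) = μ.mass N (fun v => y (.x v)) := rfl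
    have h2 := run_sampleC G (fun p => (hN p).trans (Nat.pow_le_pow_right (by norm_num) hs.le)) hs hWn
      hzI (by rw [hza]; exact hS) (fun b => by rw [hza, ← hT2]; rfl)
    rw [hza, ← hT2] at h2
    -- All branches have the same `x` and agree on the qubits used by `setupC`; as the mass is at
    -- most 2^s, it determines `T`, so one inverse circuit cleans every branch.
    have hinv : ∀ w : Qb n → Bool, (∀ v, w (.x v) = y (.x v)) → (∀ p, w (.a p) = false) →
        (∀ b, w (.t b) = false) → (∀ b, w (.m b) = false) → (∀ b, w (.c b) = false) →
        w .tmp = false → w .ok = false →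
        run G (setupC μ s (W + 1) N).inv (ket (setupState μ T true w)) = ket w := by
      intro w hx ha ht hm hc htmp hok
      obtain ⟨T', _, hT1', h1'⟩ := run_setupC G μ hN hW hs w ha ht hm hc htmp hok
      simp only [hx] at hT1' h1'
      rw [hT1' hS, ← hT2, decide_eq_true hS] at h1'
      exact run_inv_of_eq G h1'
    have hi1 := hinv y (fun _ => rfl) hy.a hy.t hy.m hy.c hy.tmp hy.ok
    rw [← hz] at hi1
    have hi2 : ∀ p, run G (setupC μ s (W + 1) N).inv (ket (Function.update z (.e p) true)) =
        ket (Function.update y (.e p) true) := fun p => by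
      rw [hz, setupState_update_e]
      exact hinv _ (by simp) (by simp [hy.a]) (by simp [hy.t]) (by simp [hy.m]) (by simp [hy.c])
        (by simp [hy.tmp]) (by simp [hy.ok])
    have hi3 : ∀ u, run G (setupC μ s (W + 1) N).inv (ket (restState z u)) = ket (restState y u) := by
      intro u
      rw [hz, setupState_restState]
      exact hinv _ (fun _ => rfl) hy.a hy.t hy.m hy.c hy.tmp hy.ok
    obtain ⟨D, hD⟩ : ∃ D : ℂ, D = ((Real.sqrt 2 : ℂ) ^ s)⁻¹ := ⟨_, rfl⟩
    have hDs : ((Real.sqrt 2 : ℂ) ^ s) * D = 1 := by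
      rw [hD]; exact mul_inv_cancel₀ (pow_ne_zero _ sqrt_two_ne_zero)
    have h3 := congrArg (D • ·) h2
    simp only [smul_smul, mul_comm D, hDs, one_smul] at h3
    refine ⟨Real.cos (Real.pi / 4), fun p => Real.sin (Real.pi / 4) * (D *
      if z (.a p) then (Real.sqrt (N p) : ℂ) else 0),
      -- The amplitudes of the rest states, grouped by label; this form needs no injectivity of the
      -- labels.
      fun u => ∑ b ∈ (Finset.range (W + 1)).filter (fun b => (fun v : Fin n => b.testBit v.val) = u),
        Real.sin (Real.pi / 4) * (D * if T.testBit b then (Real.sqrt 2 : ℂ) ^ b else 0), ?_, ?_⟩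
    · rw [prepC, run_append, run_append, run_append, h1, run_reflC G (by simp), show z .ok = true from rfl, if_pos rfl, hzI.f1,
        if_neg (by simp), map_add, map_add, map_smul, map_smul, map_smul, map_smul,
        run_sampleC_idle G (fun p => (hN p).trans (Nat.pow_le_pow_right (by norm_num) hs.le)) hzI, h3,
        hi1, add_assoc]
      congr 1
      rw [map_smul, map_add, map_sum, map_sum, smul_add, smul_add]
      refine congrArg₂ (· + ·) ?_ ?_
      · simp only [Finset.smul_sum, map_smul, smul_smul, hi2]
      · simp only [Finset.smul_sum, map_smul, smul_smul, hi3, Finset.sum_smul]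
        rw [← Finset.sum_fiberwise (Finset.range (W + 1)) (fun b (v : Fin n) => b.testBit v.val)]
        refine Finset.sum_congr rfl fun u _ => Finset.sum_congr rfl fun b hb => ?_
        rw [(Finset.mem_filter.1 hb).2]
    · intro _
      refine ⟨sqrt_two_mul_cos, fun p => ?_⟩
      rw [← mul_assoc, sqrt_two_mul_sin, one_mul]
      change D * (if μ.mem (fun v => y (.x v)) p = true then _ else _) = _
      split_ifs
      · rw [hD, ← Complex.ofReal_pow, ← Complex.ofReal_inv, ← Complex.ofReal_mul]
        congr 1
        beta_reduce
        rw [Real.sqrt_div (by positivity), div_eq_inv_mul]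
        congr 2
        rw [Real.sqrt_eq_rpow, Real.sqrt_eq_rpow, ← Real.rpow_natCast, ← Real.rpow_natCast,
          ← Real.rpow_mul (by norm_num), ← Real.rpow_mul (by norm_num), mul_comm]
      · simp
  · rw [decide_eq_false hS] at h1
    refine ⟨1, 0, 0, ?_, fun h => absurd h hS⟩
    have hzI : Idle (setupState μ T false y) := hy.toIdle.setupState μ T false
    rw [prepC, run_append, run_append, run_append, h1, run_reflC G (by simp), if_neg (by simp [setupState]),
        run_sampleC_idle G (fun p => (hN p).trans (Nat.pow_le_pow_right (by norm_num) hs.le)) hzI,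
        run_inv_of_eq G h1]
    simp

theorem cost_prepC (μ : Mode) (s W : ℕ) (N : Fin n × Fin n → ℕ) (hn : 1 ≤ n) (hs : s ≤ W) :
    QCircuit.cost (prepC μ s W N) ≤ n ^ 2 * (200 * W + 40) := by
  have h1 := cost_setupC μ s W N
  have h2 := cost_reflC (n := n) (Qb.ok (n := n)) .f1 (Real.pi / 4)
  have h3 := cost_uniformC (n := n) s
  have h4 := cost_scanC W N (pairs n)
  have h5 := cost_xorTC (n := n) W
  have h6 := cost_hadC (n := n) W
  have h7 := cost_flatMap_le (pairs n) (unprepC W N) _ fun p _ => cost_unprepC W N p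
  have h8 := cost_compressC (n := n) W
  rw [length_pairs] at h4 h7
  simp only [prepC, sampleC, cost_append, cost_inv]
  have hnn : n ≤ n ^ 2 := Nat.le_self_pow (by norm_num) n
  have hn1 : 1 ≤ n ^ 2 := hn.trans hnn
  have e1 : W * n ≤ W * n ^ 2 := Nat.mul_le_mul_left _ hnn
  have e2 : W * 1 ≤ W * n ^ 2 := Nat.mul_le_mul_left _ hn1
  nlinarith

end Prepare

/-! ### Preparation by a table of all simplices, for high precision and few vertices -/

section Table

variable {n : ℕ} (G : SimpleGraph (Fin n))

/-- Flips `ok` if the register `x` holds `S`. -/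
def flagC (S : Fin n → Bool) : QCircuit n (Qb n) :=
  notC .tmp ++ andC .anc ((List.finRange n).map fun v => (Qb.x v, S v)) 0 .tmp .ok ++ notC .tmp

theorem run_flagC (S : Fin n → Bool) (y : Qb n → Bool) (htmp : y .tmp = false)
    (ha : ∀ j, y (.anc j) = false) :
    run G (flagC S) (ket y) = ket (toggle y .ok (decide ((fun v => y (.x v)) = S))) := by
  have hall : (((List.finRange n).map fun v => (Qb.x v, S v)).all
      fun p => toggle y .tmp true p.1 == p.2) = decide ((fun v => y (.x v)) = S) := by
    rw [Bool.eq_iff_iff, List.all_eq_true, decide_eq_true_iff]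
    constructor
    · intro h
      funext v
      simpa [toggle_apply] using h (Qb.x v, S v) (List.mem_map.2 ⟨v, List.mem_finRange _, rfl⟩)
    · rintro rfl p hp
      obtain ⟨v, _, rfl⟩ := List.mem_map.1 hp
      simp [toggle_apply]
  rw [flagC, run_append, run_append, run_notC, run_andC G anc_injective _ 0 .tmp .ok (by simp) (by simp)
    (by simp) (by simp) _ (fun j _ => by rw [toggle_ne (by simp), ha]), hall, run_notC]
  refine ket_congr fun q => ?_
  simp only [toggle_apply]
  by_cases h1 : q = .tmp
  · subst h1
    simp
  · by_cases h2 : q = .ok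
    · subst h2
      simp [htmp]
    · simp [h1, h2]

/-- The preparation for the simplex `S`, if `ok` is set. -/
noncomputable def loadC (μ : Mode) (α : Fin n × Fin n → ℝ) (S : Fin n → Bool) : QCircuit n (Qb n) :=
  if (∑ p, if μ.mem S p then α p ^ 2 else 0) ≤ 1 then
    reflC .ok .f1 (Real.pi / 4) ++ ccxC .ok .f1 .tok ++ cxC .tok .f1 ++
      chainC .ok .tok (((pairs n).filter fun p => μ.mem S p).map fun p => (Qb.e p, α p)) 1 ++
      cxC .tok .f1 ++ ccxC .ok .f1 .tok
  else []

theorem forall_entries {μ : Mode} {α : Fin n × Fin n → ℝ} {S : Fin n → Bool} {P : Qb n × ℝ → Prop}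
    (h : ∀ p, P (Qb.e p, α p)) :
    ∀ r ∈ ((pairs n).filter fun p => μ.mem S p).map fun p => (Qb.e p, α p), P r := by
  intro r hr
  obtain ⟨p, _, rfl⟩ := List.mem_map.1 hr
  exact h p

theorem run_loadC_idle (μ : Mode) (α : Fin n × Fin n → ℝ) (S : Fin n → Bool) (y : Qb n → Bool)
    (hok : y .ok = false) (ht : y .tok = false) : run G (loadC μ α S) (ket y) = ket y := by
  unfold loadC
  split_ifs
  · have h1 : run G (ccxC .ok .f1 .tok) (ket y) = ket y := by
      rw [run_ccxC G (by simp) (by simp) (by simp), hok, Bool.false_and, toggle_false]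
    have h2 : run G (cxC .tok .f1) (ket y) = ket y := by
      rw [run_cxC G (by simp), ht, toggle_false]
    rw [run_append, run_append, run_append, run_append, run_append, run_reflC G (by simp), hok,
      if_neg (by simp), h1, h2, run_chainC_idle G (by simp) _ _ (forall_entries (by simp)) _ ht (.inl hok), h2, h1]
  · rfl

/-- After the Hadamard gate, `f1` is traded for the token, which `chainC` distributes to the
admissible pairs of the fixed set `S`. The trade is then reversed: the unspent token becomes `f1`
again, which is a rest state with label 0. -/
theorem run_loadC (μ : Mode) {α : Fin n × Fin n → ℝ} (hα : ∀ p, 0 ≤ α p) {S : Fin n → Bool}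
    (hS : (∑ p, if μ.mem S p then α p ^ 2 else 0) ≤ 1) {y : Qb n → Bool} (hy : Idle y)
    (hok : y .ok = true) : (Real.sqrt 2 : ℂ) • run G (loadC μ α S) (ket y) =
      ket y + ∑ p, (if μ.mem S p then (α p : ℂ) else 0) • ket (Function.update y (.e p) true) +
        (Real.sqrt (1 - ∑ p, if μ.mem S p then α p ^ 2 else 0) : ℂ) •
          ket (restState y fun _ => false) := by
  have hrest : restState y (fun _ => false) = Function.update y .f1 true := by
    funext q
    cases q <;> simp [restState, hy.y]
  set l := ((pairs n).filter fun p => μ.mem S p).map fun p => (Qb.e p, α p) with hl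
  have hmap : ∀ {M : Type} [AddCommMonoid M] (f : Qb n × ℝ → M), (l.map f).sum =
      ∑ p, if μ.mem S p then f (Qb.e p, α p) else 0 := by
    intro M _ f
    rw [hl, List.map_map, ← List.sum_toFinset _ (nodup_pairs.filter _), ← Finset.sum_filter]
    refine Finset.sum_congr ?_ fun _ _ => rfl
    ext p
    simp [mem_pairs]
  have h1 : ∀ z : Qb n → Bool, (z .f1 = false → run G (ccxC .ok .f1 .tok) (ket z) = ket z) := by
    intro z hz
    rw [run_ccxC G (by simp) (by simp) (by simp), hz, Bool.and_false, toggle_false]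
  have h2 : ∀ z : Qb n → Bool, z .tok = false → run G (cxC .tok .f1) (ket z) = ket z := by
    intro z hz
    rw [run_cxC G (by simp), hz, toggle_false]
  set y1 := Function.update y .f1 true with hy1
  set y2 := Function.update y1 .tok true with hy2
  set y3 := Function.update y .tok true with hy3
  have h3 : run G (ccxC .ok .f1 .tok) (ket y1) = ket y2 := by
    rw [run_ccxC G (by simp) (by simp) (by simp)]
    simp [hy1, hy2, hok, toggle, hy.tok]
  have h4 : run G (cxC .tok .f1) (ket y2) = ket y3 := by
    rw [run_cxC G (by simp)]
    refine ket_congr fun q => ?_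
    simp only [hy3, hy2, hy1, toggle_apply, Function.update_apply]
    by_cases h : q = .f1
    · subst h
      simp [hy.f1]
    · simp [h]
  have h4' : run G (cxC .tok .f1) (ket y3) = ket y2 := by
    rw [run_cxC G (by simp)]
    refine ket_congr fun q => ?_
    simp only [hy3, hy2, hy1, toggle_apply, Function.update_apply]
    by_cases h : q = .f1
    · subst h
      simp [hy.f1]
    · simp [h]
  have h3' : run G (ccxC .ok .f1 .tok) (ket y2) = ket y1 := by
    rw [run_ccxC G (by simp) (by simp) (by simp)]
    simp [hy1, hy2, hok, toggle]
    rw [← hy.tok]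
    conv_rhs => rw [← Function.update_eq_self (Qb.tok) (Function.update y .f1 true)]
    simp
  have h5 := run_chainC G (g := Qb.ok (n := n)) (tok := Qb.tok) (by simp) l 1 zero_le_one
    (forall_entries (by simp [hα])) (by rw [hmap]; simpa using hS)
    (by
      rw [hl, List.map_map]
      exact (nodup_pairs.filter _).map fun i j h => by simpa using h)
    y3 (forall_entries (by simp [hy3, hy.e])) (by simp [hy3, hok]) (by simp [hy3])
  have h6 : Function.update y3 .tok false = y := by
    rw [hy3, Function.update_idem, ← hy.tok, Function.update_eq_self]
  rw [hmap, hmap, h6, Complex.ofReal_one, one_smul, one_pow] at h5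
  have h7 : ∀ p, run G (cxC .tok .f1) (ket (Function.update y (Qb.e p) true)) =
    ket (Function.update y (Qb.e p) true) := fun p => h2 _ (by simp [hy.tok])
  have h8 : ∀ p, run G (ccxC .ok .f1 .tok) (ket (Function.update y (Qb.e p) true)) =
    ket (Function.update y (Qb.e p) true) := fun p => h1 _ (by simp [hy.f1])
  have h9 : run G (chainC .ok .tok l 1) (ket y) = ket y :=
    run_chainC_idle G (by simp) _ _ (forall_entries (by simp)) _ hy.tok
      (.inr (forall_entries (by simp [hy.e])))
  rw [loadC, if_pos hS, run_append, run_append, run_append, run_append, run_append,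
    run_reflC G (by simp), hok, if_pos rfl, hy.f1, if_neg (by simp), ← hl]
  simp only [map_add, map_smul]
  rw [h1 y hy.f1, h2 y hy.tok, h9, h2 y hy.tok, h1 y hy.f1, h3, h4, h5, map_add, map_add, map_smul,
    map_smul, h4', h3', smul_add, smul_smul, smul_smul, sqrt_two_mul_cos, sqrt_two_mul_sin, one_smul,
    one_smul, hrest, add_assoc]
  congr 2
  rw [map_sum, map_sum]
  refine Finset.sum_congr rfl fun p _ => ?_
  split_ifs
  · rw [map_smul, map_smul, h7, h8]
  · simp

/-- The preparation by a table of all the simplices. -/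
noncomputable def tableC (μ : Mode) (α : Fin n × Fin n → ℝ) (l : List (Fin n → Bool)) :
    QCircuit n (Qb n) := l.flatMap fun S => flagC S ++ loadC μ α S ++ flagC S

theorem run_tableC_idle (μ : Mode) (α : Fin n × Fin n → ℝ) (l : List (Fin n → Bool)) (y : Qb n → Bool)
    (hx : (fun v => y (.x v)) ∉ l) (hok : y .ok = false) (ht : y .tok = false) (htmp : y .tmp = false)
    (ha : ∀ j, y (.anc j) = false) : run G (tableC μ α l) (ket y) = ket y := by
  induction l with
  | nil => rfl
  | cons S l ih =>
    simp only [List.mem_cons, not_or] at hx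
    rw [tableC, List.flatMap_cons, run_append, run_append, run_append, run_flagC G S y htmp ha,
      decide_eq_false hx.1, toggle_false, run_loadC_idle G μ α S y hok ht, run_flagC G S y htmp ha,
      decide_eq_false hx.1, toggle_false]
    exact ih hx.2

/-- Exactly one entry of the table matches `x`. The entries before it are idle on the initial state,
and those after it are idle on every branch, since no branch changes `x`. -/
theorem prepares_tableC (μ : Mode) {α : Fin n × Fin n → ℝ} (hα : ∀ p, 0 ≤ α p) :
    Prepares μ α (fun x => (∑ p, if μ.mem x p then α p ^ 2 else 0) ≤ 1)
      (tableC μ α (Finset.univ : Finset (Fin n → Bool)).toList) := by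
  intro G y hy
  obtain ⟨x, hx⟩ : ∃ x, x = fun v => y (.x v) := ⟨_, rfl⟩
  obtain ⟨l₁, l₂, hl⟩ := List.append_of_mem (Finset.mem_toList.2 (Finset.mem_univ x))
  have hn := Finset.nodup_toList (Finset.univ : Finset (Fin n → Bool))
  rw [hl, List.nodup_middle, List.nodup_cons, List.mem_append, not_or] at hn
  have h1 := run_tableC_idle G μ α l₁ y (by rw [← hx]; exact hn.1.1) hy.ok hy.tok hy.tmp hy.anc
  have h2 : ∀ z : Qb n → Bool, (∀ v, z (.x v) = y (.x v)) → z .ok = false → z .tok = false →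
      z .tmp = false → (∀ j, z (.anc j) = false) → run G (tableC μ α l₂) (ket z) = ket z := by
    intro z hzx
    exact run_tableC_idle G μ α l₂ z (by simp only [hzx, ← hx]; exact hn.1.2)
  have h3 : ∀ z : Qb n → Bool, (∀ v, z (.x v) = y (.x v)) → z .ok = false →
      z .tmp = false → (∀ j, z (.anc j) = false) →
      run G (flagC x) (ket z) = ket (Function.update z .ok true) ∧
      run G (flagC x) (ket (Function.update z .ok true)) = ket z := by
    intro z hzx hok htmp ha
    rw [run_flagC G x z htmp ha, run_flagC G x _ (by simp [htmp]) (by simp [ha])]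
    simp only [hzx, ← hx, Function.update_of_ne (a := Qb.x _) (a' := Qb.ok) (by simp : Qb.x _ ≠ Qb.ok)]
    simp only [toggle, hok, decide_true, Function.update_self, Function.update_idem, Bool.xor_self,
      Bool.false_xor, true_and]
    rw [← hok, Function.update_eq_self]
  have hsplit : tableC μ α (Finset.univ : Finset (Fin n → Bool)).toList =
      tableC μ α l₁ ++ (flagC x ++ loadC μ α x ++ flagC x ++ tableC μ α l₂) := by
    rw [hl, tableC, List.flatMap_append, List.flatMap_cons]
    rfl
  rw [hsplit]
  set y' := Function.update y .ok true with hy'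
  have hyI : Idle y' := by
    constructor <;> simp [hy', hy.f1, hy.e, hy.r, hy.m, hy.c, hy.o, hy.anc, hy.tok, hy.tmp, hy.y]
  have f1 := h3 y (fun _ => rfl) hy.ok hy.tmp hy.anc
  by_cases hS : (∑ p, if μ.mem x p then α p ^ 2 else 0) ≤ 1
  · have h4 := run_loadC G μ hα hS hyI (by simp [hy'])
    have e1 : ∀ p, Function.update y' (.e p) true =
        Function.update (Function.update y (.e p) true) .ok true := fun p => by
      rw [hy', Function.update_comm (by simp)]
    have e2 : restState y' (fun _ => false) =
        Function.update (restState y fun _ => false) .ok true := by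
      funext q
      cases q <;> simp [restState, hy']
    obtain ⟨E, hE⟩ : ∃ E : ℂ, E = (Real.sqrt 2 : ℂ)⁻¹ := ⟨_, rfl⟩
    have hE1 : (Real.sqrt 2 : ℂ) * E = 1 := by rw [hE]; exact mul_inv_cancel₀ sqrt_two_ne_zero
    have h5 := congrArg (E • ·) h4
    simp only [smul_smul, mul_comm E, hE1, one_smul] at h5
    refine ⟨E, fun p => E * if μ.mem x p then (α p : ℂ) else 0, fun u => if u = fun _ => false then
      E * (Real.sqrt (1 - ∑ p, if μ.mem x p then α p ^ 2 else 0) : ℂ) else 0, ?_, ?_⟩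
    · rw [run_append, run_append, run_append, run_append, h1, f1.1, h5, map_smul, map_smul, map_add,
        map_add, map_add, map_add, map_smul, map_smul, f1.2, h2 y (fun _ => rfl) hy.ok hy.tok hy.tmp hy.anc,
        e2, (h3 (restState y fun _ => false) (fun _ => rfl) hy.ok hy.tmp hy.anc).2,
        h2 (restState y fun _ => false) (fun _ => rfl) hy.ok hy.tok hy.tmp hy.anc, smul_add, smul_add,
        smul_smul, map_sum, map_sum, Finset.smul_sum]
      refine congrArg₂ (· + ·) (congrArg₂ (· + ·) rfl (Finset.sum_congr rfl fun p _ => ?_)) ?_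
      · rw [map_smul, map_smul, e1, (h3 _ (by simp) (by simp [hy.ok]) (by simp [hy.tmp])
          (by simp [hy.anc])).2, h2 _ (by simp) (by simp [hy.ok]) (by simp [hy.tok]) (by simp [hy.tmp])
          (by simp [hy.anc]), smul_smul]
      · simp
    · intro _
      refine ⟨hE1, fun p => ?_⟩
      rw [← hx, ← mul_assoc, hE1, one_mul]
  · refine ⟨1, 0, 0, ?_, fun h => absurd (hx ▸ h) hS⟩
    have : loadC μ α x = [] := by rw [loadC, if_neg hS]
    rw [this, run_append, run_append, run_append, run_append, h1, f1.1, run_nil, f1.2,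
      h2 y (fun _ => rfl) hy.ok hy.tok hy.tmp hy.anc]
    simp

theorem cost_tableC (μ : Mode) (α : Fin n × Fin n → ℝ) (hn : 1 ≤ n) :
    QCircuit.cost (tableC μ α (Finset.univ : Finset (Fin n → Bool)).toList) ≤ n ^ 2 * (2 ^ n * 37) := by
  have hnn : n ≤ n ^ 2 := Nat.le_self_pow (by norm_num) n
  have h1 : ∀ S, QCircuit.cost (flagC (n := n) S) ≤ 10 * n + 3 := by
    intro S
    have := cost_andC (n := n) Qb.anc ((List.finRange n).map fun v => (Qb.x v, S v)) 0 Qb.tmp Qb.ok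
    rw [List.length_map, List.length_finRange] at this
    simp only [flagC, cost_append, cost_notC]
    omega
  have h2 : ∀ S, QCircuit.cost (loadC μ α S) ≤ 4 * n ^ 2 + 7 := by
    intro S
    unfold loadC
    split_ifs
    · have h1 := cost_reflC (n := n) (Qb.ok (n := n)) .f1 (Real.pi / 4)
      have h2 := cost_ccxC (n := n) (Qb.ok (n := n)) .f1 .tok
      have h3 := cost_cxC (n := n) (Qb.tok (n := n)) .f1
      have h4 := cost_chainC (n := n) (Qb.ok (n := n)) .tok
        (((pairs n).filter fun p => μ.mem S p).map fun p => (Qb.e p, α p)) 1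
      have h5 := List.length_filter_le (fun p => μ.mem S p) (pairs n)
      rw [List.length_map] at h4
      rw [length_pairs] at h5
      simp only [cost_append]
      omega
    · simp
  have h3 := cost_flatMap_le (Finset.univ : Finset (Fin n → Bool)).toList
    (fun S => flagC S ++ loadC μ α S ++ flagC S) (37 * n ^ 2) fun S _ => by
      have := h1 S
      have := h2 S
      simp only [cost_append]
      omega
  rw [Finset.length_toList] at h3
  refine h3.trans (le_of_eq ?_)
  simp only [Finset.card_univ, Fintype.card_fun, Fintype.card_bool, Fintype.card_fin]
  ring

theorem Prepares.mono {μ : Mode} {α : Fin n × Fin n → ℝ} {good good' : (Fin n → Bool) → Prop}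
    {c : QCircuit n (Qb n)} (h : Prepares μ α good c) (hg : ∀ x, good' x → good x) :
    Prepares μ α good' c := by
  intro G y hy
  obtain ⟨c₀, β, γ, h1, h2⟩ := h G y hy
  exact ⟨c₀, β, γ, h1, fun hx => h2 (hg _ hx)⟩

/-- For symmetric probabilities `q` there is a circuit that prepares the pairs with the probabilities
`q`, up to `2 ^ (-s)`. -/
theorem exists_prepares (μ : Mode) (hn : 1 ≤ n) (s : ℕ) {q : Fin n × Fin n → ℝ} (hq : ∀ p, 0 ≤ q p)
    (hqs : ∀ p, q p.swap = q p) :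
    ∃ (c : QCircuit n (Qb n)) (α : Fin n × Fin n → ℝ),
      QCircuit.cost c ≤ n ^ 2 * (200 * (s + 2 * vertexBits n + 2) + 40) ∧
      Prepares μ α (fun x => (∑ p, if μ.mem x p then q p else 0) ≤ 1) c ∧
      ∀ p, q p ≤ 1 → |q p - α p * α p.swap| ≤ (1 / 2) ^ s := by
  obtain ⟨W, hWdef⟩ : ∃ W, W = s + 2 * vertexBits n + 1 := ⟨_, rfl⟩
  have hW1 : s + 2 * vertexBits n + 2 = W + 1 := by omega
  rw [hW1]
  have hnL : n ≤ 2 ^ vertexBits n := Nat.le_pow_clog (by norm_num) n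
  have hW : n ^ 2 * 2 ^ s ≤ 2 ^ W := by
    calc n ^ 2 * 2 ^ s ≤ (2 ^ vertexBits n) ^ 2 * 2 ^ s :=
          Nat.mul_le_mul_right _ (Nat.pow_le_pow_left hnL 2)
      _ = 2 ^ (s + 2 * vertexBits n) := by rw [← pow_mul, ← pow_add]; ring_nf
      _ ≤ 2 ^ W := Nat.pow_le_pow_right (by norm_num) (by omega)
  -- The sampling circuit stores the numbers below `W + 1` in `n` qubits. If they do not fit, there
  -- are fewer than `W + 1` vertex sets, and the table obeys the same cost bound.
  by_cases hWn : W + 1 ≤ 2 ^ n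
  -- Rounding down keeps the total mass at most 2^s wherever the probabilities sum to at most 1. The
  -- minimum matters only for `q p > 1`, about which the conclusion says nothing.
  · set N : Fin n × Fin n → ℕ := fun p => min ⌊2 ^ s * q p⌋₊ (2 ^ s) with hN
    refine ⟨prepC μ s (W + 1) N, fun p => Real.sqrt (N p / 2 ^ s), cost_prepC μ s (W + 1) N hn (by omega),
      (prepares_prepC μ (fun p => min_le_right _ _) hW (by omega) hWn).mono fun x hx => ?_, fun p hp => ?_⟩
    · have h1 : ((μ.mass N x : ℕ) : ℝ) ≤ 2 ^ s := by
        rw [Mode.mass, Nat.cast_sum]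
        calc _ ≤ ∑ p, 2 ^ s * (if μ.mem x p then q p else 0) := Finset.sum_le_sum fun p _ => by
              split_ifs
              · refine (Nat.cast_le.2 (min_le_left _ _)).trans (Nat.floor_le ?_)
                exact mul_nonneg (by positivity) (hq p)
              · simp
          _ ≤ 2 ^ s := by
              rw [← Finset.mul_sum]
              exact mul_le_of_le_one_right (by positivity) hx
      rw [← Nat.cast_ofNat, ← Nat.cast_pow] at h1
      exact Nat.cast_le.1 h1
    -- Symmetry makes the product of the two square roots equal to `N p / 2 ^ s`.
    · have hsw : N p.swap = N p := by simp only [hN, hqs]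
      beta_reduce
      have h2 : (0 : ℝ) < 2 ^ s := by positivity
      rw [hsw, Real.mul_self_sqrt (by positivity)]
      have h3 : N p = ⌊2 ^ s * q p⌋₊ := by
        refine min_eq_left (Nat.floor_le_of_le ?_)
        push_cast
        exact mul_le_of_le_one_right h2.le hp
      have h4 := Nat.floor_le (mul_nonneg h2.le (hq p))
      have h5 := Nat.lt_floor_add_one (2 ^ s * q p)
      rw [← h3] at h4 h5
      have h6 : (N p : ℝ) / 2 ^ s ≤ q p := by rw [div_le_iff₀ h2]; linarith
      rw [abs_of_nonneg (by linarith), one_div, inv_pow, ← one_div, sub_le_iff_le_add, ← add_div,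
        le_div_iff₀ h2]
      linarith
  · refine ⟨tableC μ (fun p => Real.sqrt (q p)) _, fun p => Real.sqrt (q p),
      (cost_tableC μ _ hn).trans (Nat.mul_le_mul_left _ (by omega)),
      (prepares_tableC μ fun p => Real.sqrt_nonneg _).mono fun x hx => ?_, fun p _ => ?_⟩
    · simpa only [Real.sq_sqrt (hq _)] using hx
    · beta_reduce
      rw [hqs, Real.mul_self_sqrt (hq p)]
      simp

end Table

/-! ### Writing the target simplex and the index registers -/

section Write

variable {n : ℕ} (G : SimpleGraph (Fin n))

/-! ### Lists of gates with independent targets -/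

section Generic

variable {ι : Type} [DecidableEq ι]

/-- No gate reads a target of the family, so the flips commute and all their conditions may be
evaluated in the initial state. -/
theorem run_flatMap_toggle {β : Type} (l : List β) (hl : l.Nodup) {f : β → QCircuit n ι}
    {t : β → ι} (ht : Function.Injective t) {φ : β → (ι → Bool) → Bool} {P : (ι → Bool) → Prop}
    (hf : ∀ b, ∀ y, P y → run G (f b) (ket y) = ket (toggle y (t b) (φ b y)))
    (hφ : ∀ b b' y c, φ b (toggle y (t b') c) = φ b y) (hP : ∀ b y c, P y → P (toggle y (t b) c))
    (y : ι → Bool) (hy : P y) :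
    ∃ z : ι → Bool, run G (l.flatMap f) (ket y) = ket z ∧
      (∀ b ∈ l, z (t b) = xor (y (t b)) (φ b y)) ∧ ∀ q, (∀ b ∈ l, t b ≠ q) → z q = y q := by
  induction l generalizing y with
  | nil => exact ⟨y, rfl, by simp, by simp⟩
  | cons b l ih =>
    rw [List.nodup_cons] at hl
    obtain ⟨z, h1, h2, h3⟩ := ih hl.2 _ (hP b y (φ b y) hy)
    refine ⟨z, by rw [List.flatMap_cons, run_append, hf b y hy, h1], fun b' hb' => ?_, fun q hq => ?_⟩
    · by_cases hb : b' ∈ l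
      · rw [h2 b' hb, hφ, toggle_ne]
        intro h
        exact hl.1 (by rwa [← ht h])
      · obtain rfl : b' = b := by simpa [hb] using hb'
        rw [h3 _ fun b hb h => hl.1 (by rw [← ht h]; exact hb), toggle, Function.update_self]
    · rw [h3 q fun b' hb' => hq b' (by simp [hb']), toggle_ne (hq b (by simp)).symm]

theorem run_flatMap_single {β : Type} {l : List β} (hl : l.Nodup) {f : β → QCircuit n ι}
    {y z : ι → Bool} {b : β} (hb : b ∈ l) (h1 : ∀ b', b' ≠ b → run G (f b') (ket y) = ket y)
    (h2 : ∀ b', b' ≠ b → run G (f b') (ket z) = ket z) (h3 : run G (f b) (ket y) = ket z) :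
    run G (l.flatMap f) (ket y) = ket z := by
  have idle : ∀ (l : List β) (w : ι → Bool), (∀ b' ∈ l, run G (f b') (ket w) = ket w) →
      run G (l.flatMap f) (ket w) = ket w := by
    intro l w hw
    induction l with
    | nil => rfl
    | cons b l ih =>
      rw [List.flatMap_cons, run_append, hw b (by simp), ih fun b' hb' => hw b' (by simp [hb'])]
  obtain ⟨l₁, l₂, rfl⟩ := List.append_of_mem hb
  rw [List.nodup_middle, List.nodup_cons, List.mem_append, not_or] at hl
  rw [List.flatMap_append, List.flatMap_cons, run_append, run_append,
    idle l₁ y fun b' hb' => h1 b' fun h => hl.1.1 (h ▸ hb'), h3,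
    idle l₂ z fun b' hb' => h2 b' fun h => hl.1.2 (h ▸ hb')]

theorem run_flatMap_idle {β : Type} (l : List β) {f : β → QCircuit n ι} {y : ι → Bool}
    (h : ∀ b ∈ l, run G (f b) (ket y) = ket y) : run G (l.flatMap f) (ket y) = ket y := by
  induction l with
  | nil => rfl
  | cons b l ih =>
    rw [List.flatMap_cons, run_append, h b (by simp), ih fun b' hb' => h b' (by simp [hb'])]

end Generic

/-- The parity of the number of vertices below `b` in `x`. -/
def prefixParity (x : Fin n → Bool) : ℕ → Bool
  | 0 => false
  | b + 1 => xor (prefixParity x b) (if h : b < n then x ⟨b, h⟩ else false)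

/-- Computes the parities of the prefixes of `x`. -/
def parityC : ℕ → QCircuit n (Qb n)
  | 0 => []
  | b + 1 => parityC b ++ cxC (.par b) (.par (b + 1)) ++
      if h : b < n then cxC (.x ⟨b, h⟩) (.par (b + 1)) else []

/-- The state after `parityC k`. -/
def parityState (k : ℕ) (y : Qb n → Bool) : Qb n → Bool
  | .par b => if b ≤ k then prefixParity (fun v => y (.x v)) b else false
  | q => y q

theorem run_parityC (k : ℕ) (y : Qb n → Bool) (hy : ∀ b, y (.par b) = false) :
    run G (parityC k) (ket y) = ket (parityState k y) := by
  induction k with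
  | zero =>
    refine ket_congr fun q => ?_
    cases q with
    | par b =>
      rw [hy, parityState]
      split_ifs with h
      · obtain rfl : b = 0 := by omega
        rfl
      · rfl
    | _ => rfl
  | succ k ih =>
    have h1 : run G (if h : k < n then cxC (.x ⟨k, h⟩) (.par (k + 1)) else [])
        (ket (toggle (parityState k y) (.par (k + 1)) (parityState k y (.par k)))) =
        ket (toggle (parityState k y) (.par (k + 1)) (prefixParity (fun v => y (.x v)) (k + 1))) := by
      rw [prefixParity]
      split_ifs with h
      · rw [run_cxC G (by simp), toggle_toggle]
        simp [parityState, toggle_apply]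
      · simp [parityState]
    rw [parityC, run_append, run_append, ih, run_cxC G (by simp), h1]
    refine ket_congr fun q => ?_
    rw [toggle_apply]
    cases q with
    | par b =>
      by_cases h : b = k + 1
      · subst h
        simp [parityState]
      · have : b ≤ k ↔ b ≤ k + 1 := by omega
        simp [parityState, h, this]
    | _ => simp [parityState]

/-- The correction to the sign for the order of the two exchanged vertices. -/
def Mode.before (μ : Mode) (p : Fin n × Fin n) : Bool :=
  match μ with
  | .up => decide (p.1 < p.2)
  | _ => decide (p.2 < p.1)

/-- The qubits that are flipped if the pair `p` is chosen. -/
def targets (μ : Mode) (p : Fin n × Fin n) : List (Qb n) :=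
  [.h1, .h2] ++ (if p.1 = p.2 then [.d1, .d2] else [.y p.1, .y p.2]) ++
    ((List.range (vertexBits n)).filter fun b => p.1.val.testBit b).map .i1 ++
    ((List.range (vertexBits n)).filter fun b => p.2.val.testBit b).map .i2 ++
    (if μ.before p then [.ys 0] else [])

/-- Writes the data of the pair `p`, if `e p` is set. -/
def writeC (μ : Mode) (p : Fin n × Fin n) : QCircuit n (Qb n) :=
  fanC (.e p) (targets μ p) ++ ccxC (.e p) (.par p.1) (.ys 0) ++ ccxC (.e p) (.par p.2) (.ys 0)

/-- The change of the sign in the exchange of `p.2` by `p.1`. -/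
def Mode.sgn (μ : Mode) (x : Fin n → Bool) (p : Fin n × Fin n) : Bool :=
  xor (xor (μ.before p) (prefixParity x p.1))
    (prefixParity x p.2)

theorem i1_injective : Function.Injective (Qb.i1 (n := n)) := fun i j h => by simpa using h

theorem i2_injective : Function.Injective (Qb.i2 (n := n)) := fun i j h => by simpa using h

theorem val_lt_two_pow (v : Fin n) : v.val < 2 ^ vertexBits n :=
  v.isLt.trans_le (Nat.le_pow_clog (by norm_num) n)

theorem nodup_targets (μ : Mode) (p : Fin n × Fin n) : (targets μ p).Nodup := by
  have h1 := nodup_bits (i1_injective (n := n)) (vertexBits n) fun b => p.1.val.testBit b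
  have h2 := nodup_bits (i2_injective (n := n)) (vertexBits n) fun b => p.2.val.testBit b
  unfold targets
  refine List.Nodup.append (List.Nodup.append (List.Nodup.append (List.Nodup.append ?_ ?_ ?_) h1 ?_) h2 ?_)
    ?_ ?_
  · simp
  · split_ifs with h <;> simp [h]
  · intro q hq
    split_ifs with h <;> simp at hq <;> rcases hq with rfl | rfl <;> simp
  · intro q hq
    split_ifs at hq with h <;> simp at hq <;> rcases hq with rfl | rfl | rfl | rfl <;> simp
  · intro q hq
    split_ifs at hq with h <;> simp at hq <;>
      rcases hq with rfl | rfl | rfl | rfl | ⟨b, _, rfl⟩ <;> simp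
  · split_ifs <;> simp
  · intro q hq
    split_ifs at hq ⊢ with h <;> simp at hq <;>
      rcases hq with rfl | rfl | rfl | rfl | ⟨b, _, rfl⟩ | ⟨b, _, rfl⟩ <;> simp

theorem mem_targets_i1 (μ : Mode) (p : Fin n × Fin n) (b : ℕ) :
    Qb.i1 b ∈ targets μ p ↔ p.1.val.testBit b = true := by
  have h1 := mem_bits (i1_injective (n := n)) (val_lt_two_pow p.1) b
  unfold targets
  rw [List.mem_append, List.mem_append, List.mem_append, h1]
  split_ifs <;> simp

theorem mem_targets_i2 (μ : Mode) (p : Fin n × Fin n) (b : ℕ) :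
    Qb.i2 b ∈ targets μ p ↔ p.2.val.testBit b = true := by
  have h1 := mem_bits (i2_injective (n := n)) (val_lt_two_pow p.2) b
  unfold targets
  rw [List.mem_append, List.mem_append, h1]
  split_ifs <;> simp

/-- The state with the simplex `x` with the sign `s`, and `0` on all the other qubits. -/
def startState (x : Fin n → Bool) (s : Fin 2 → Bool) : Qb n → Bool
  | .x v => x v
  | .xs k => s k
  | _ => false

/-- The qubits that are written for the pair `p`, where the simplex is added to the register `y` if
`c` holds, and the other qubits of `y`. -/
def pairState (μ : Mode) (x : Fin n → Bool) (s : Fin 2 → Bool) (p : Fin n × Fin n) (c g : Bool)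
    (y : Qb n → Bool) : Qb n → Bool
  | .y v => xor (c && x v) (decide (p.1 ≠ p.2) && (decide (v = p.1) || decide (v = p.2)))
  | .ys k => decide (k = 0) && xor (c && s 0) (μ.sgn x p)
  | .i1 b => p.1.val.testBit b
  | .i2 b => p.2.val.testBit b
  | .h1 => true
  | .h2 => true
  | .d1 => decide (p.1 = p.2)
  | .d2 => decide (p.1 = p.2)
  | .g1 => g
  | q => y q

theorem run_writeC_idle (μ : Mode) (p : Fin n × Fin n) (y : Qb n → Bool) (hy : y (.e p) = false) :
    run G (writeC μ p) (ket y) = ket y := by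
  have hmem : Qb.e p ∉ targets μ p := by
    unfold targets
    split_ifs <;> simp
  rw [writeC, run_append, run_append, run_fanC G _ _ hmem (nodup_targets μ p), hy]
  simp only [Bool.false_and, Bool.xor_false]
  rw [run_ccxC G (by simp) (by simp) (by simp), hy, Bool.false_and, toggle_false,
    run_ccxC G (by simp) (by simp) (by simp), hy, Bool.false_and, toggle_false]

/-- With all prefix parities at hand, the sign of an exchange costs two Toffoli gates and at most
one constant flip per pair; recomputing them for each of the n² pairs would exceed the budget. -/
theorem run_writeC (μ : Mode) (x : Fin n → Bool) (s : Fin 2 → Bool) (p : Fin n × Fin n) :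
    run G (writeC μ p) (ket (parityState n (Function.update (startState x s) (.e p) true))) =
      ket (pairState μ x s p false false
        (parityState n (Function.update (startState x s) (.e p) true))) := by
  obtain ⟨y, hy⟩ : ∃ y, y = parityState n (Function.update (startState x s) (.e p) true) := ⟨_, rfl⟩
  have hmem : Qb.e p ∉ targets μ p := by
    unfold targets
    split_ifs <;> simp
  have he : y (.e p) = true := by simp [hy, parityState]
  have hpar : ∀ v : Fin n, y (.par v) = prefixParity x v := fun v => by
    simp [hy, parityState, startState, v.isLt.le]
  have hnp : ∀ b, Qb.par b ∉ targets μ p := by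
    intro b
    unfold targets
    split_ifs <;> simp
  rw [← hy, writeC, run_append, run_append, run_fanC G _ _ hmem (nodup_targets μ p),
    run_ccxC G (by simp) (by simp) (by simp), run_ccxC G (by simp) (by simp) (by simp)]
  refine ket_congr fun q => ?_
  simp only [toggle_apply, he, hpar, hmem, hnp, Bool.true_and, decide_false, Bool.xor_false,
    reduceCtorEq, if_false, if_true]
  cases q with
  | i1 b =>
    simp only [reduceCtorEq, if_false, mem_targets_i1, pairState, Bool.decide_eq_true]
    simp [hy, parityState, startState]
  | i2 b =>
    simp only [reduceCtorEq, if_false, mem_targets_i2, pairState, Bool.decide_eq_true]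
    simp [hy, parityState, startState]
  | y v =>
    have : y (.y v) = false := by simp [hy, parityState, startState]
    simp only [reduceCtorEq, if_false, pairState, this]
    unfold targets
    by_cases h : p.1 = p.2 <;> rcases hb : μ.before p with _ | _ <;> simp [h]
  | ys k =>
    have : ∀ k, y (.ys k) = false := fun k => by simp [hy, parityState, startState]
    simp only [pairState, this, Qb.ys.injEq]
    unfold targets
    by_cases hk : k = 0
    · subst hk
      by_cases h : p.1 = p.2 <;> rcases hb : μ.before p with _ | _ <;> simp [h, Mode.sgn, hb]
    · by_cases h : p.1 = p.2 <;> rcases hb : μ.before p with _ | _ <;> simp [h, hk]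
  | h1 => simp [targets, pairState, hy, parityState, startState]
  | h2 => simp [targets, pairState, hy, parityState, startState]
  | d1 =>
    have : y .d1 = false := by simp [hy, parityState, startState]
    simp only [reduceCtorEq, if_false, pairState, this]
    unfold targets
    by_cases h : p.1 = p.2 <;> rcases hb : μ.before p with _ | _ <;> simp [h]
  | d2 =>
    have : y .d2 = false := by simp [hy, parityState, startState]
    simp only [reduceCtorEq, if_false, pairState, this]
    unfold targets
    by_cases h : p.1 = p.2 <;> rcases hb : μ.before p with _ | _ <;> simp [h]
  | g1 =>
    have : y .g1 = false := by simp [hy, parityState, startState]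
    simp only [reduceCtorEq, if_false, pairState, this]
    unfold targets
    by_cases h : p.1 = p.2 <;> rcases hb : μ.before p with _ | _ <;> simp [h]
  | _ =>
    simp only [reduceCtorEq, if_false, pairState]
    unfold targets
    by_cases h : p.1 = p.2 <;> rcases hb : μ.before p with _ | _ <;> simp [h]

/-- Adds the simplex to the register `y`, if `h1` is set. -/
def copyC : QCircuit n (Qb n) :=
  ((List.finRange n).flatMap fun v => ccxC .h1 (.x v) (.y v)) ++ ccxC .h1 (.xs 0) (.ys 0)

theorem run_copyC_idle (y : Qb n → Bool) (hy : y .h1 = false) :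
    run G copyC (ket y) = ket y := by
  rw [copyC, run_append, run_flatMap_idle, run_ccxC G (by simp) (by simp) (by simp), hy, Bool.false_and,
    toggle_false]
  intro v _
  rw [run_ccxC G (by simp) (by simp) (by simp), hy, Bool.false_and, toggle_false]

theorem run_copyC (y : Qb n → Bool) (hy : y .h1 = true) :
    run G copyC (ket y) = ket fun q => match q with
      | .y v => xor (y (.y v)) (y (.x v))
      | .ys k => xor (y (.ys k)) (decide (k = 0) && y (.xs 0))
      | q => y q := by
  obtain ⟨z, h1, h2, h3⟩ := run_flatMap_toggle G (List.finRange n) (List.nodup_finRange n)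
    (f := fun v => ccxC .h1 (.x v) (.y v)) (t := Qb.y) (fun i j h => by simpa using h)
    (φ := fun v y => y .h1 && y (.x v)) (P := fun _ => True)
    (fun v y _ => run_ccxC G (by simp) (by simp) (by simp) y) (fun v v' y c => by simp [toggle_apply])
    (fun _ _ _ h => h) y trivial
  rw [copyC, run_append, h1, run_ccxC G (by simp) (by simp) (by simp)]
  refine ket_congr fun q => ?_
  rw [toggle_apply, h3 .h1 (by simp), h3 (.xs 0) (by simp), h3 (.ys 0) (by simp), hy]
  cases q with
  | y v => simp [h2 v (List.mem_finRange v), hy]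
  | ys k =>
    by_cases h : k = 0
    · subst h
      simp
    · simp [h, h3]
  | _ => simp [h3]

/-- Erases `e`, using the index registers. -/
noncomputable def clearC : QCircuit n (Qb n) :=
  (pairs n).flatMap fun p => andC .anc (((List.range (vertexBits n)).map fun b =>
    (Qb.i1 b, p.1.val.testBit b)) ++ (List.range (vertexBits n)).map fun b =>
    (Qb.i2 b, p.2.val.testBit b)) 0 .h1 (.e p)

theorem run_clearC_gate (p : Fin n × Fin n) (y : Qb n → Bool) (ha : ∀ j, y (.anc j) = false) :
    run G (andC .anc (((List.range (vertexBits n)).map fun b =>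
      (Qb.i1 b, p.1.val.testBit b)) ++ (List.range (vertexBits n)).map fun b =>
      (Qb.i2 b, p.2.val.testBit b)) 0 .h1 (.e p)) (ket y) = ket (toggle y (.e p) (y .h1 &&
        (((List.range (vertexBits n)).map fun b =>
      (Qb.i1 b, p.1.val.testBit b)) ++ (List.range (vertexBits n)).map fun b =>
      (Qb.i2 (n := n) b, p.2.val.testBit b)).all fun r => y r.1 == r.2)) := by
  refine run_andC G anc_injective _ 0 .h1 (.e p) (by simp) (by simp) (by simp) (fun r hr => ?_) y
    fun j _ => ha j
  rw [List.mem_append, List.mem_map, List.mem_map] at hr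
  rcases hr with ⟨b, _, rfl⟩ | ⟨b, _, rfl⟩ <;> simp

theorem run_clearC_idle (y : Qb n → Bool) (hy : y .h1 = false) (ha : ∀ j, y (.anc j) = false) :
    run G clearC (ket y) = ket y := by
  refine run_flatMap_idle G _ fun p _ => ?_
  rw [run_clearC_gate G p y ha, hy, Bool.false_and, toggle_false]

theorem eq_of_bits {u v : Fin n} (h : ∀ b < vertexBits n, u.val.testBit b = v.val.testBit b) : u = v := by
  refine Fin.ext (Nat.eq_of_testBit_eq fun b => ?_)
  by_cases hb : b < vertexBits n
  · exact h b hb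
  · rw [testBit_of_le (val_lt_two_pow u) (by omega), testBit_of_le (val_lt_two_pow v) (by omega)]

/-- The index registers now determine the pair, so the one-hot marker is redundant and can be
erased. The guard `h1` separates the pair (0, 0) from states in which nothing has been written. -/
theorem run_clearC (p : Fin n × Fin n) (y : Qb n → Bool) (hh : y .h1 = true)
    (hi : ∀ b, y (.i1 b) = p.1.val.testBit b) (hj : ∀ b, y (.i2 b) = p.2.val.testBit b)
    (he : ∀ p', y (.e p') = decide (p' = p)) (ha : ∀ j, y (.anc j) = false) :
    run G clearC (ket y) = ket (Function.update y (.e p) false) := by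
  obtain ⟨z, h1, h2, h3⟩ := run_flatMap_toggle G (pairs n) nodup_pairs (t := Qb.e)
    (fun i j h => by simpa using h) (P := fun y => ∀ j, y (.anc j) = false)
    (fun p y hy => run_clearC_gate G p y hy) (fun p p' y c => by
      congr 1
      rw [Bool.eq_iff_iff, List.all_eq_true, List.all_eq_true]
      refine forall₂_congr fun r hr => ?_
      rw [List.mem_append, List.mem_map, List.mem_map] at hr
      rcases hr with ⟨b, _, rfl⟩ | ⟨b, _, rfl⟩ <;> simp [toggle_apply])
    (fun p y c h j => by rw [toggle_ne (by simp), h]) y ha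
  rw [clearC, h1]
  refine ket_congr fun q => ?_
  rw [Function.update_apply]
  cases q with
  | e p' =>
    rw [h2 p' (mem_pairs p'), he, hh, Bool.true_and]
    have : ((((List.range (vertexBits n)).map fun b =>
      (Qb.i1 b, p'.1.val.testBit b)) ++ (List.range (vertexBits n)).map fun b =>
      (Qb.i2 (n := n) b, p'.2.val.testBit b)).all fun r => y r.1 == r.2) = decide (p' = p) := by
      rw [Bool.eq_iff_iff, List.all_eq_true, decide_eq_true_iff]
      constructor
      · intro h
        refine Prod.ext (eq_of_bits fun b hb => ?_) (eq_of_bits fun b hb => ?_)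
        · have := h (Qb.i1 b, p'.1.val.testBit b) (List.mem_append_left _
            (List.mem_map.2 ⟨b, List.mem_range.2 hb, rfl⟩))
          rw [hi] at this
          exact (beq_iff_eq.1 this).symm
        · have := h (Qb.i2 b, p'.2.val.testBit b) (List.mem_append_right _
            (List.mem_map.2 ⟨b, List.mem_range.2 hb, rfl⟩))
          rw [hj] at this
          exact (beq_iff_eq.1 this).symm
      · rintro rfl r hr
        rw [List.mem_append, List.mem_map, List.mem_map] at hr
        rcases hr with ⟨b, _, rfl⟩ | ⟨b, _, rfl⟩ <;> simp [hi, hj]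
    rw [this, Bool.xor_self]
    simp
  | _ => simp [h3]

end Write

/-! ### Testing adjacency -/

section Verify

variable {n : ℕ} (G : SimpleGraph (Fin n))

/-- Queries the adjacency of the vertices in the registers `vert` and `i1`. -/
def queryC : QCircuit n (Qb n) :=
  [.query (fun b => .vert b.val) (fun b => .i1 b.val) .qa
    (by rintro (a | a) (b | b) h <;> simp at h <;> simpa [Fin.ext_iff] using h) (by simp) (by simp)]

open scoped Classical in
/-- The answer to the query of the vertex `v` and the vertex in the register `i1`. -/
noncomputable def adjBit (v : Fin n) (y : Qb n → Bool) : Bool :=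
  decide (∃ u w, G.Adj u w ∧ (∀ b : Fin (vertexBits n), v.val.testBit b.val = u.val.testBit b.val) ∧
    HoldsVertex (fun b => Qb.i1 b.val) y w)

/-- Computes in `qa` whether `v` is adjacent or equal to the vertex in the register `i1`. -/
def testC (v : Fin n) : QCircuit n (Qb n) :=
  notsC (((List.range (vertexBits n)).filter fun b => v.val.testBit b).map .vert) ++ queryC ++
    andC .anc ((List.range (vertexBits n)).map fun b => (Qb.i1 b, v.val.testBit b)) 0 .h1 .qa

/-- The answer of `testC v`. -/
noncomputable def testBitC (v : Fin n) (y : Qb n → Bool) : Bool :=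
  xor (adjBit G v y) (y .h1 && ((List.range (vertexBits n)).map fun b =>
    (Qb.i1 (n := n) b, v.val.testBit b)).all fun r => y r.1 == r.2)

theorem vert_injective : Function.Injective (Qb.vert (n := n)) := fun i j h => by simpa using h

theorem run_testC (v : Fin n) (y : Qb n → Bool) (hv : ∀ b, y (.vert b) = false)
    (ha : ∀ b, y (.anc b) = false) :
    run G (testC v) (ket y) = ket (toggle (put .vert v.val y) .qa (testBitC G v y)) := by
  have h1 : run G (notsC (((List.range (vertexBits n)).filter fun b => v.val.testBit b).map .vert))
      (ket y) = ket (put .vert v.val y) := by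
    rw [run_notsC G _ (nodup_bits vert_injective _ _)]
    refine ket_congr fun q => ?_
    by_cases hq : ∃ b, Qb.vert b = q
    · obtain ⟨b, rfl⟩ := hq
      rw [put_self vert_injective, hv, Bool.false_xor, Bool.eq_iff_iff, decide_eq_true_iff,
        mem_bits vert_injective (val_lt_two_pow v)]
    · push Not at hq
      rw [put_of_ne _ _ hq, decide_eq_false, Bool.xor_false]
      intro h
      obtain ⟨b, _, hb⟩ := List.mem_map.1 h
      exact hq b hb
  have h2 : run G queryC (ket (put .vert v.val y)) =
      ket (toggle (put .vert v.val y) .qa (adjBit G v y)) := by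
    rw [queryC, run_singleton_ket]
    change ket (toggle _ _ (answer G _ _ _)) = _
    congr 2
    unfold answer adjBit
    rw [decide_eq_decide]
    simp only [HoldsVertex, put_self vert_injective]
    have : ∀ b, put Qb.vert v.val y (.i1 b) = y (.i1 b) := fun b => put_of_ne _ _ (by simp)
    simp only [this]
  rw [testC, run_append, run_append, h1, h2, run_andC G anc_injective _ 0 .h1 .qa (by simp) (by simp)
    (by simp) (fun r hr => ?_) _ (fun b _ => by rw [toggle_ne (by simp), put_of_ne _ _ (by simp), ha]),
    toggle_toggle, toggle_ne (by simp), put_of_ne _ _ (by simp)]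
  · congr 4
    rw [Bool.eq_iff_iff, List.all_eq_true, List.all_eq_true]
    refine forall₂_congr fun r hr => ?_
    obtain ⟨b, _, rfl⟩ := List.mem_map.1 hr
    rw [toggle_ne (by simp), put_of_ne _ _ (by simp)]
  · obtain ⟨b, _, rfl⟩ := List.mem_map.1 hr
    simp

theorem testBitC_toggle (v : Fin n) (y : Qb n → Bool) (t : Qb n) (c : Bool) (h1 : t ≠ .h1)
    (h2 : ∀ b, t ≠ .i1 b) : testBitC G v (toggle y t c) = testBitC G v y := by
  have : ∀ b, toggle y t c (.i1 b) = y (.i1 b) := fun b => toggle_ne (h2 b).symm _ _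
  unfold testBitC adjBit
  rw [toggle_ne h1.symm]
  congr 1
  · rw [decide_eq_decide]
    simp only [HoldsVertex, this]
  · congr 1
    rw [Bool.eq_iff_iff, List.all_eq_true, List.all_eq_true]
    refine forall₂_congr fun r hr => ?_
    obtain ⟨b, _, rfl⟩ := List.mem_map.1 hr
    rw [this]

/-- Flips `viol v` if `v` belongs to the simplex and is neither adjacent nor equal to the vertex in the
register `i1`. -/
def violC (v : Fin n) : QCircuit n (Qb n) :=
  testC v ++ litC (.x v) true .qa false (.viol v) ++ (testC v).inv

theorem run_violC (v : Fin n) (y : Qb n → Bool) (hv : ∀ b, y (.vert b) = false)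
    (ha : ∀ b, y (.anc b) = false) (hq : y .qa = false) :
    run G (violC v) (ket y) = ket (toggle y (.viol v) (y (.x v) && !testBitC G v y)) := by
  rw [violC, run_append, run_append, run_testC G v y hv ha, run_litC G (by simp) (by simp) (by simp)]
  have h1 : (toggle (put .vert v.val y) .qa (testBitC G v y) (.x v) == true &&
      toggle (put .vert v.val y) .qa (testBitC G v y) .qa == false) =
      (y (.x v) && !testBitC G v y) := by
    rw [toggle_ne (by simp), put_of_ne _ _ (by simp), toggle, Function.update_self,
      put_of_ne _ _ (by simp), hq]
    simp
  rw [h1]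
  refine run_inv_of_eq G ?_
  rw [run_testC G v _ (fun b => by rw [toggle_ne (by simp), hv]) (fun b => by rw [toggle_ne (by simp), ha]),
    testBitC_toggle G v _ _ _ (by simp) (by simp)]
  refine ket_congr fun q => ?_
  rw [← toggle_put (by simp)]
  simp only [toggle_apply]
  by_cases h1 : q = .qa
  · subst h1
    simp
  · by_cases h2 : q = .viol v
    · subst h2
      simp
    · simp [h1, h2]

/-- Computes in `viol` the vertices of the simplex that are neither adjacent nor equal to the vertex in
the register `i1`. -/
def checkC : QCircuit n (Qb n) := (List.finRange n).flatMap violC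

/-- The state after `checkC`. -/
noncomputable def checkState (y : Qb n → Bool) : Qb n → Bool
  | .viol v => xor (y (.viol v)) (y (.x v) && !testBitC G v y)
  | q => y q

theorem run_checkC (y : Qb n → Bool) (hv : ∀ b, y (.vert b) = false)
    (ha : ∀ b, y (.anc b) = false) (hq : y .qa = false) :
    run G checkC (ket y) = ket (checkState G y) := by
  obtain ⟨z, h1, h2, h3⟩ := run_flatMap_toggle G (List.finRange n) (List.nodup_finRange n)
    (t := Qb.viol) (fun i j h => by simpa using h)
    (P := fun y => (∀ b, y (.vert b) = false) ∧ (∀ b, y (.anc b) = false) ∧ y .qa = false)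
    (fun v y hy => run_violC G v y hy.1 hy.2.1 hy.2.2)
    (fun v v' y c => by rw [toggle_ne (by simp), testBitC_toggle G v _ _ _ (by simp) (by simp)])
    (fun v y c h => ⟨fun b => by rw [toggle_ne (by simp), h.1], fun b => by rw [toggle_ne (by simp), h.2.1],
      by rw [toggle_ne (by simp), h.2.2]⟩) y ⟨hv, ha, hq⟩
  rw [checkC, h1]
  refine ket_congr fun q => ?_
  cases q with
  | viol v => exact h2 v (List.mem_finRange v)
  | _ => exact h3 _ (by simp)

/-- Flips `g1` if the chosen pair does not contribute to the walk, if `h1` is set. -/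
def markC : Mode → QCircuit n (Qb n)
  | .up => cxC .h1 .g1 ++ andC .anc ((List.finRange n).map fun v => (.viol v, false)) 0 .h1 .g1
  | .down => []
  | .harm => cxC .h1 .g1 ++ andC .anc ((List.finRange n).map fun v => (.viol v, false)) 0 .h1 .g1 ++
      litC .h1 true .d1 false .g1

/-- The pair does not contribute to the walk, if the vertex `p.1` is adjacent to the other vertices
as `c` says. -/
def Mode.bad (μ : Mode) (c : Bool) (p : Fin n × Fin n) : Bool :=
  match μ with
  | .up => !c
  | .down => false
  | .harm => xor (!c) (decide (p.1 ≠ p.2))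

/-- Sets `g1` if the chosen pair does not contribute to the walk. -/
def verifyC (μ : Mode) : QCircuit n (Qb n) := checkC ++ markC μ ++ (checkC (n := n)).inv

theorem run_andC_viol (y : Qb n → Bool) (ha : ∀ b, y (.anc b) = false) :
    run G (andC .anc ((List.finRange n).map fun v => (.viol v, false)) 0 .h1 .g1) (ket y) =
      ket (toggle y .g1 (y .h1 && ((List.finRange n).map fun v => (Qb.viol v, false)).all
        fun r => y r.1 == r.2)) :=
  run_andC G anc_injective _ 0 .h1 .g1 (by simp) (by simp) (by simp) (by simp) y fun b _ => ha b

theorem run_markC_idle (μ : Mode) (y : Qb n → Bool) (ha : ∀ b, y (.anc b) = false)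
    (hh : y .h1 = false) : run G (markC μ) (ket y) = ket y := by
  have h1 : run G (cxC .h1 .g1) (ket y) = ket y := by rw [run_cxC G (by simp), hh, toggle_false]
  have h2 := run_andC_viol G y ha
  rw [hh, Bool.false_and, toggle_false] at h2
  cases μ with
  | up => rw [markC, run_append, h1, h2]
  | down => rfl
  | harm =>
    rw [markC, run_append, run_append, h1, h2, run_litC G (by simp) (by simp) (by simp), hh]
    simp

theorem run_markC (μ : Mode) (y : Qb n → Bool) (ha : ∀ b, y (.anc b) = false)
    (hh : y .h1 = true) (p : Fin n × Fin n) (hd : y .d1 = decide (p.1 = p.2)) :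
    run G (markC μ) (ket y) = ket (toggle y .g1 (μ.bad (decide (∀ v, y (.viol v) = false)) p)) := by
  have h2 := run_andC_viol G (toggle y .g1 true) (fun b => by rw [toggle_ne (by simp), ha])
  have h3 : (((List.finRange n).map fun v => (Qb.viol v, false)).all
        fun r => toggle y .g1 true r.1 == r.2) = decide (∀ v, y (.viol v) = false) := by
    rw [Bool.eq_iff_iff, List.all_eq_true, decide_eq_true_iff]
    constructor
    · intro h v
      have := h (Qb.viol v, false) (List.mem_map.2 ⟨v, List.mem_finRange v, rfl⟩)
      rw [toggle_ne (by simp)] at this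
      exact beq_iff_eq.1 this
    · intro h r hr
      obtain ⟨v, _, rfl⟩ := List.mem_map.1 hr
      rw [toggle_ne (by simp), h]
      rfl
  rw [h3, toggle_ne (by simp), hh, Bool.true_and, toggle_toggle, Bool.true_xor] at h2
  have h1 : run G (cxC .h1 .g1) (ket y) = ket (toggle y .g1 true) := by rw [run_cxC G (by simp), hh]
  cases μ with
  | up => rw [markC, run_append, h1, h2]; rfl
  | down => rw [markC, run_nil, Mode.bad, toggle_false]
  | harm =>
    rw [markC, run_append, run_append, h1, h2, run_litC G (by simp) (by simp) (by simp), toggle_toggle,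
      toggle_ne (by simp), toggle_ne (by simp), hh, hd]
    congr 2
    rw [Mode.bad]
    by_cases h : p.1 = p.2 <;> simp [h]

theorem run_verifyC_idle (μ : Mode) (y : Qb n → Bool) (hv : ∀ b, y (.vert b) = false)
    (ha : ∀ b, y (.anc b) = false) (hq : y .qa = false) (hh : y .h1 = false) :
    run G (verifyC μ) (ket y) = ket y := by
  have h1 := run_checkC G y hv ha hq
  rw [verifyC, run_append, run_append, h1, run_markC_idle G μ (checkState G y) ha hh, run_inv_of_eq G h1]

/-- The simplex is a clique already, so only the vertex `p.1` has to be tested against the others;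
this keeps the number of queries linear in `n`. -/
theorem run_verifyC (μ : Mode) (y : Qb n → Bool) (hv : ∀ b, y (.vert b) = false)
    (ha : ∀ b, y (.anc b) = false) (hq : y .qa = false) (hh : y .h1 = true)
    (hw : ∀ v, y (.viol v) = false) (p : Fin n × Fin n) (hd : y .d1 = decide (p.1 = p.2))
    (hi : ∀ b, y (.i1 b) = p.1.val.testBit b) (c : Bool)
    (hc : c = true ↔ ∀ v, y (.x v) = true → v ≠ p.1 → G.Adj v p.1) :
    run G (verifyC μ) (ket y) = ket (toggle y .g1 (μ.bad c p)) := by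
  have hall : ∀ v : Fin n, (((List.range (vertexBits n)).map fun b =>
      (Qb.i1 (n := n) b, v.val.testBit b)).all fun r => y r.1 == r.2) = decide (v = p.1) := by
    intro v
    rw [Bool.eq_iff_iff, List.all_eq_true, decide_eq_true_iff]
    constructor
    · intro h
      refine eq_of_bits fun b hb => ?_
      have := h (Qb.i1 b, v.val.testBit b) (List.mem_map.2 ⟨b, List.mem_range.2 hb, rfl⟩)
      rw [hi] at this
      exact (beq_iff_eq.1 this).symm
    · rintro rfl r hr
      obtain ⟨b, _, rfl⟩ := List.mem_map.1 hr
      simp [hi]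
  have hadj : ∀ v : Fin n, adjBit G v y = true ↔ G.Adj v p.1 := by
    classical
    intro v
    unfold adjBit
    rw [decide_eq_true_iff]
    simp only [HoldsVertex, hi]
    constructor
    · rintro ⟨u, w, h, h1, h2⟩
      obtain rfl : v = u := eq_of_bits fun b hb => h1 ⟨b, hb⟩
      obtain rfl : p.1 = w := eq_of_bits fun b hb => h2 ⟨b, hb⟩
      exact h
    · intro h
      exact ⟨v, p.1, h, fun _ => rfl, fun _ => rfl⟩
  -- The exclusive or acts as a disjunction, since a vertex is not adjacent to itself.
  have htest : ∀ v : Fin n, testBitC G v y = true ↔ v = p.1 ∨ G.Adj v p.1 := by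
    intro v
    unfold testBitC
    rw [hall, hh, Bool.true_and, ← hadj]
    by_cases h : v = p.1
    · have : adjBit G v y = false := by
        rw [← Bool.not_eq_true, hadj, h]
        exact G.loopless.irrefl p.1
      simp [h]
      rw [← h, this]
    · simp [h]
  have hc' : decide (∀ v, checkState G y (.viol v) = false) = c := by
    rw [Bool.eq_iff_iff, decide_eq_true_iff, hc]
    refine forall_congr' fun v => ?_
    rw [checkState, hw, Bool.false_xor]
    have := htest v
    by_cases hx : y (.x v) = true
    · rw [hx, Bool.true_and, Bool.not_eq_false', this]
      tauto
    · simp [hx]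
  have h1 := run_checkC G y hv ha hq
  have h2 := run_markC G μ (checkState G y) ha hh p hd
  rw [verifyC, run_append, run_append, h1, h2, hc']
  -- The test does not read `g1`, so it is undone also after `g1` has been flipped.
  refine run_inv_of_eq G ?_
  rw [run_checkC G _ (fun b => by rw [toggle_ne (by simp), hv]) (fun b => by rw [toggle_ne (by simp), ha])
    (by rw [toggle_ne (by simp), hq])]
  refine ket_congr fun q => ?_
  cases q with
  | viol v =>
    rw [checkState, testBitC_toggle G v _ _ _ (by simp) (by simp), toggle_ne (by simp),
      toggle_ne (by simp), toggle_ne (by simp)]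
    rfl
  | _ => rfl

/-- Writes the target simplex, its sign, and the index registers. -/
noncomputable def postC (μ : Mode) : QCircuit n (Qb n) :=
  parityC n ++ (pairs n).flatMap (writeC μ) ++ copyC ++ (parityC (n := n) n).inv ++ clearC ++ verifyC μ

theorem run_postC_idle (μ : Mode) (y : Qb n → Bool) (he : ∀ p, y (.e p) = false)
    (hh : y .h1 = false) (hp : ∀ b, y (.par b) = false) (ha : ∀ b, y (.anc b) = false)
    (hv : ∀ b, y (.vert b) = false) (hq : y .qa = false) :
    run G (postC μ) (ket y) = ket y := by
  have h1 := run_parityC G n y hp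
  rw [postC, run_append, run_append, run_append, run_append, run_append, h1,
    run_flatMap_idle G (f := writeC μ) (y := parityState n y) (pairs n)
      fun p _ => run_writeC_idle G μ p (parityState n y) (he p),
    run_copyC_idle G (parityState n y) hh, run_inv_of_eq G h1, run_clearC_idle G y hh ha,
    run_verifyC_idle G μ y hv ha hq hh]

theorem run_postC (μ : Mode) (x : Fin n → Bool) (s : Fin 2 → Bool) (p : Fin n × Fin n) (c : Bool)
    (hc : c = true ↔ ∀ v, x v = true → v ≠ p.1 → G.Adj v p.1) :
    run G (postC μ) (ket (Function.update (startState x s) (.e p) true)) =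
      ket (pairState μ x s p true (μ.bad c p) (startState x s)) := by
  set y := Function.update (startState x s) (.e p) true with hy
  have h1 := run_parityC G n y (by simp [hy, startState])
  have h2 : run G ((pairs n).flatMap (writeC μ)) (ket (parityState n y)) =
      ket (pairState μ x s p false false (parityState n y)) := by
    refine run_flatMap_single G nodup_pairs (mem_pairs p) (fun p' hp' => ?_) (fun p' hp' => ?_)
      (run_writeC G μ x s p)
    · exact run_writeC_idle G μ p' _ (by simp [hy, parityState, startState, hp'])
    · exact run_writeC_idle G μ p' _ (by simp [hy, pairState, parityState, startState, hp'])
  have h3 : run G copyC (ket (pairState μ x s p false false (parityState n y))) =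
      ket (parityState n (pairState μ x s p true false y)) := by
    rw [run_copyC G _ rfl]
    refine ket_congr fun q => ?_
    cases q with
    | y v => simp [pairState, parityState, hy, startState, Bool.xor_comm]
    | ys k =>
      by_cases hk : k = 0 <;> simp [pairState, parityState, hy, startState, hk, Bool.xor_comm]
    | _ => rfl
  have h4 : run G (parityC n).inv (ket (parityState n (pairState μ x s p true false y))) =
      ket (pairState μ x s p true false y) :=
    run_inv_of_eq G (run_parityC G n _ (by simp [pairState, hy, startState]))
  have h5 := run_clearC G p (pairState μ x s p true false y) rfl (fun b => rfl) (fun b => rfl)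
    (fun p' => by simp [pairState, hy, startState, Function.update_apply])
    (by simp [pairState, hy, startState])
  have h6 : Function.update (pairState μ x s p true false y) (.e p) false =
      pairState μ x s p true false (startState x s) := by
    funext q
    rw [Function.update_apply]
    cases q with
    | e p' =>
      by_cases h : p' = p
      · subst h
        simp [pairState, startState]
      · simp [pairState, h, hy]
    | _ => simp [pairState, hy]
  rw [postC, run_append, run_append, run_append, run_append, run_append, h1, h2, h3, h4, h5, h6,
    run_verifyC G μ _ (fun b => rfl) (fun b => rfl) rfl rfl (fun v => rfl) p rfl (fun b => rfl) c hc]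
  refine ket_congr fun q => ?_
  rw [toggle_apply]
  cases q <;> simp [pairState]

end Verify

/-! ### The walk unitaries -/

section Unitary

variable {n : ℕ}

theorem cost_parityC (k : ℕ) : QCircuit.cost (parityC (n := n) k) ≤ 2 * k := by
  induction k with
  | zero => simp [parityC]
  | succ k ih =>
    have h1 := cost_cxC (n := n) (Qb.par (n := n) k) (.par (k + 1))
    have h2 : QCircuit.cost (if h : k < n then cxC (n := n) (Qb.x ⟨k, h⟩) (.par (k + 1)) else []) ≤ 1 := by
      split_ifs
      · exact cost_cxC _ _
      · simp
    simp only [parityC, cost_append]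
    omega

theorem cost_writeC (μ : Mode) (p : Fin n × Fin n) :
    QCircuit.cost (writeC μ p) ≤ 2 * vertexBits n + 7 := by
  have h1 := cost_fanC (n := n) (Qb.e p) (targets μ p)
  have h2 := cost_ccxC (n := n) (Qb.e p) (.par p.1) (.ys 0)
  have h3 := cost_ccxC (n := n) (Qb.e p) (.par p.2) (.ys 0)
  have h4 : (targets μ p).length ≤ 2 * vertexBits n + 5 := by
    have h5 := List.length_filter_le (fun b => p.1.val.testBit b) (List.range (vertexBits n))
    have h6 := List.length_filter_le (fun b => p.2.val.testBit b) (List.range (vertexBits n))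
    rw [List.length_range] at h5 h6
    unfold targets
    split_ifs <;> simp only [List.length_append, List.length_map, List.length_cons, List.length_nil] <;>
      omega
  simp only [writeC, cost_append]
  omega

theorem cost_copyC : QCircuit.cost (copyC (n := n)) ≤ n + 1 := by
  have h1 := cost_flatMap_le (n := n) (List.finRange n) (fun v => ccxC (Qb.h1 (n := n)) (.x v) (.y v)) 1
    fun v _ => cost_ccxC _ _ _
  have h2 := cost_ccxC (n := n) (Qb.h1 (n := n)) (.xs 0) (.ys 0)
  rw [List.length_finRange] at h1
  simp only [copyC, cost_append]
  omega

theorem cost_clearC : QCircuit.cost (clearC (n := n)) ≤ n ^ 2 * (20 * vertexBits n + 1) := by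
  have h1 := cost_flatMap_le (n := n) (pairs n) (fun p => andC Qb.anc (((List.range (vertexBits n)).map fun b =>
    (Qb.i1 b, p.1.val.testBit b)) ++ (List.range (vertexBits n)).map fun b =>
    (Qb.i2 b, p.2.val.testBit b)) 0 Qb.h1 (.e p)) (20 * vertexBits n + 1) fun p _ => by
      refine (cost_andC _ _ _ _ _).trans ?_
      simp only [List.length_append, List.length_map, List.length_range]
      omega
  rwa [length_pairs] at h1

theorem cost_checkC : QCircuit.cost (checkC (n := n)) ≤ n * (2 * n + 22 * vertexBits n + 7) := by
  have h1 := cost_flatMap_le (n := n) (List.finRange n) violC (2 * n + 22 * vertexBits n + 7) fun v _ => by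
    have h2 : QCircuit.cost (testC v) ≤ n + 11 * vertexBits n + 1 := by
      have h3 := cost_notsC (n := n)
        (((List.range (vertexBits n)).filter fun b => v.val.testBit b).map (Qb.vert (n := n)))
      have h4 : QCircuit.cost (queryC (n := n)) = n := by simp [queryC, QCircuit.cost, Gate.cost]
      have h5 := cost_andC (n := n) Qb.anc ((List.range (vertexBits n)).map fun b =>
        (Qb.i1 (n := n) b, v.val.testBit b)) 0 Qb.h1 .qa
      have h6 := List.length_filter_le (fun b => v.val.testBit b) (List.range (vertexBits n))
      rw [List.length_map] at h3 h5
      rw [List.length_range] at h5 h6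
      simp only [testC, cost_append]
      omega
    have h3 := cost_litC (n := n) (Qb.x v) true .qa false (.viol v)
    simp only [violC, cost_append, cost_inv]
    omega
  rwa [List.length_finRange] at h1

theorem cost_verifyC (μ : Mode) :
    QCircuit.cost (verifyC (n := n) μ) ≤ n * (4 * n + 44 * vertexBits n + 24) + 7 := by
  have h1 := cost_checkC (n := n)
  have h2 := cost_andC (n := n) Qb.anc ((List.finRange n).map fun v => (Qb.viol v, false)) 0 .h1 .g1
  have h3 := cost_cxC (n := n) (Qb.h1 (n := n)) .g1
  have h4 := cost_litC (n := n) (Qb.h1 (n := n)) true .d1 false .g1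
  rw [List.length_map, List.length_finRange] at h2
  have h5 : QCircuit.cost (markC (n := n) μ) ≤ 10 * n + 7 := by
    cases μ <;> simp only [markC, cost_append, cost_nil] <;> omega
  simp only [verifyC, cost_append, cost_inv]
  nlinarith

theorem cost_postC (μ : Mode) (hn : 1 ≤ n) :
    QCircuit.cost (postC (n := n) μ) ≤ n ^ 2 * (66 * vertexBits n + 49) := by
  have h1 := cost_parityC (n := n) n
  have h2 := cost_flatMap_le (pairs n) (writeC μ) _ fun p _ => cost_writeC μ p
  have h3 := cost_copyC (n := n)
  have h4 := cost_clearC (n := n)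
  have h5 := cost_verifyC (n := n) μ
  rw [length_pairs] at h2
  have hnn : n ≤ n ^ 2 := Nat.le_self_pow (by norm_num) n
  have e1 : n * vertexBits n ≤ n ^ 2 * vertexBits n := Nat.mul_le_mul_right _ hnn
  simp only [postC, cost_append, cost_inv]
  nlinarith

/-- The qubits of the first index register. -/
def firstIndex (i : Fin (vertexBits n + 4)) : Qb n :=
  if i.val < vertexBits n then .i1 i.val
  else if i.val = vertexBits n then .f1
  else if i.val = vertexBits n + 1 then .g1
  else if i.val = vertexBits n + 2 then .h1
  else .d1

/-- The qubits of the second index register. -/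
def secondIndex (i : Fin (vertexBits n + 4)) : Qb n :=
  if i.val < vertexBits n then .i2 i.val
  else if i.val = vertexBits n then .f2
  else if i.val = vertexBits n + 1 then .g2
  else if i.val = vertexBits n + 2 then .h2
  else .d2

/-- The qubits of the walk unitaries. -/
def walkQb : WalkQubit n (vertexBits n + 4) → Qb n
  | .inl (.inl (.inl v)) => .x v
  | .inl (.inl (.inr k)) => .xs k
  | .inl (.inr (.inl v)) => .y v
  | .inl (.inr (.inr k)) => .ys k
  | .inr (.inl i) => firstIndex i
  | .inr (.inr i) => secondIndex i

theorem firstIndex_injective : Function.Injective (firstIndex (n := n)) := by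
  intro i j h
  unfold firstIndex at h
  apply Fin.ext
  split_ifs at h <;> first | omega | (simp at h; done) | (simp at h; omega)

theorem secondIndex_injective : Function.Injective (secondIndex (n := n)) := by
  intro i j h
  unfold secondIndex at h
  apply Fin.ext
  split_ifs at h <;> first | omega | (simp at h; done) | (simp at h; omega)

theorem firstIndex_cases (i : Fin (vertexBits n + 4)) :
    (∃ b, firstIndex i = .i1 b) ∨ firstIndex i = .f1 ∨ firstIndex i = .g1 ∨ firstIndex i = .h1 ∨
      firstIndex i = .d1 := by
  unfold firstIndex
  split_ifs <;> simp

theorem secondIndex_cases (i : Fin (vertexBits n + 4)) :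
    (∃ b, secondIndex i = .i2 b) ∨ secondIndex i = .f2 ∨ secondIndex i = .g2 ∨ secondIndex i = .h2 ∨
      secondIndex i = .d2 := by
  unfold secondIndex
  split_ifs <;> simp

theorem walkQb_injective : Function.Injective (walkQb (n := n)) := by
  have h1 := firstIndex_cases (n := n)
  have h2 := secondIndex_cases (n := n)
  rintro (((a | a) | (a | a)) | (a | a)) (((b | b) | (b | b)) | (b | b)) h <;>
    simp only [walkQb, Qb.x.injEq, Qb.xs.injEq, Qb.y.injEq, Qb.ys.injEq, reduceCtorEq] at h
  case inr.inl.inr.inl => rw [firstIndex_injective h]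
  case inr.inr.inr.inr => rw [secondIndex_injective h]
  all_goals first
    | rw [h]
    | (rcases h1 a with ⟨c, h3⟩ | h3 | h3 | h3 | h3 <;> rw [h3] at h <;>
        first
        | simp at h
        | (rcases h2 b with ⟨c, h4⟩ | h4 | h4 | h4 | h4 <;> rw [h4] at h <;> simp at h))
    | (rcases h1 b with ⟨c, h3⟩ | h3 | h3 | h3 | h3 <;> rw [h3] at h <;>
        first
        | simp at h
        | (rcases h2 a with ⟨c, h4⟩ | h4 | h4 | h4 | h4 <;> rw [h4] at h <;> simp at h))
    | (rcases h2 a with ⟨c, h3⟩ | h3 | h3 | h3 | h3 <;> rw [h3] at h <;> simp at h)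
    | (rcases h2 b with ⟨c, h3⟩ | h3 | h3 | h3 | h3 <;> rw [h3] at h <;> simp at h)

/-- All the work qubits are `0`. -/
def WorkZero (z : Qb n → Bool) : Prop := ∀ q, (∀ i, walkQb i ≠ q) → z q = false

theorem extend_walkQb {z : Qb n → Bool} (hz : WorkZero z) :
    Function.extend walkQb (z ∘ walkQb) (fun _ => false) = z := by
  funext q
  by_cases hq : ∃ i, walkQb i = q
  · obtain ⟨i, rfl⟩ := hq
    rw [walkQb_injective.extend_apply]
    rfl
  · push Not at hq
    rw [Function.extend_apply' _ _ _ fun ⟨i, hi⟩ => hq i hi, hz q hq]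

theorem workZero_startState (x : Fin n → Bool) (s : Fin 2 → Bool) : WorkZero (startState x s) := by
  intro q hq
  cases q with
  | x v => exact absurd rfl (hq (.inl (.inl (.inl v))))
  | xs k => exact absurd rfl (hq (.inl (.inl (.inr k))))
  | _ => rfl

theorem workZero_restState (x : Fin n → Bool) (s : Fin 2 → Bool) (u : Fin n → Bool) :
    WorkZero (restState (startState x s) u) := by
  intro q hq
  cases q with
  | x v => exact absurd rfl (hq (.inl (.inl (.inl v))))
  | xs k => exact absurd rfl (hq (.inl (.inl (.inr k))))
  | y v => exact absurd rfl (hq (.inl (.inr (.inl v))))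
  | f1 => exact absurd (by simp [walkQb, firstIndex]) (hq (.inr (.inl ⟨vertexBits n, by omega⟩)))
  | _ => rfl

theorem workZero_pairState (μ : Mode) (x : Fin n → Bool) (s : Fin 2 → Bool) (p : Fin n × Fin n) (g : Bool) :
    WorkZero (pairState μ x s p true g (startState x s)) := by
  intro q hq
  cases q with
  | x v => exact absurd rfl (hq (.inl (.inl (.inl v))))
  | xs k => exact absurd rfl (hq (.inl (.inl (.inr k))))
  | y v => exact absurd rfl (hq (.inl (.inr (.inl v))))
  | ys v => exact absurd rfl (hq (.inl (.inr (.inr v))))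
  | i1 b =>
    by_cases hb : b < vertexBits n
    · exact absurd (by simp [walkQb, firstIndex, hb]) (hq (.inr (.inl ⟨b, by omega⟩)))
    · exact testBit_of_le (val_lt_two_pow p.1) (by omega)
  | i2 b =>
    by_cases hb : b < vertexBits n
    · exact absurd (by simp [walkQb, secondIndex, hb]) (hq (.inr (.inr ⟨b, by omega⟩)))
    · exact testBit_of_le (val_lt_two_pow p.2) (by omega)
  | g1 => exact absurd (by simp [walkQb, firstIndex]) (hq (.inr (.inl ⟨vertexBits n + 1, by omega⟩)))
  | h1 => exact absurd (by simp [walkQb, firstIndex]) (hq (.inr (.inl ⟨vertexBits n + 2, by omega⟩)))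
  | d1 => exact absurd (by simp [walkQb, firstIndex]) (hq (.inr (.inl ⟨vertexBits n + 3, by omega⟩)))
  | h2 => exact absurd (by simp [walkQb, secondIndex]) (hq (.inr (.inr ⟨vertexBits n + 2, by omega⟩)))
  | d2 => exact absurd (by simp [walkQb, secondIndex]) (hq (.inr (.inr ⟨vertexBits n + 3, by omega⟩)))
  | _ => rfl

theorem clean_startState (x : Fin n → Bool) (s : Fin 2 → Bool) : Clean (startState x s) := by
  constructor
  · constructor <;> first | exact rfl | exact fun _ => rfl
  all_goals first | exact rfl | exact fun _ => rfl

/-- The first simplex register. -/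
def firstRegister {m : ℕ} : WalkQubit n m → Bool
  | .inl (.inl _) => true
  | _ => false

open scoped Classical in
/-- The answer to the question whether `i` is adjacent to all the other vertices of `x`. -/
noncomputable def adjAll (G : SimpleGraph (Fin n)) (x : Fin n → Bool) (i : Fin n) : Bool :=
  decide (∀ v, x v = true → v ≠ i → G.Adj v i)

/-- The basis state of the walk registers for the pair `p`. -/
noncomputable def pairKet (μ : Mode) (G : SimpleGraph (Fin n)) (x : Fin n → Bool) (s : Fin 2 → Bool)
    (p : Fin n × Fin n) : WalkQubit n (vertexBits n + 4) → Bool :=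
  pairState μ x s p true (μ.bad (adjAll G x p.1) p) (startState x s) ∘ walkQb

/-- A basis state of the walk registers in which no pair is chosen. -/
def restKet (x : Fin n → Bool) (s : Fin 2 → Bool) (u : Fin n → Bool) :
    WalkQubit n (vertexBits n + 4) → Bool := restState (startState x s) u ∘ walkQb

/-- The initial state of the walk registers. -/
def startKet (x : Fin n → Bool) (s : Fin 2 → Bool) :
    WalkQubit n (vertexBits n + 4) → Bool := startState x s ∘ walkQb

theorem startKet_of_keepOnly {σ : WalkQubit n (vertexBits n + 4) → Bool}
    (hσ : keepOnly firstRegister σ = σ) :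
    startKet (fun v => σ (.inl (.inl (.inl v)))) (fun k => σ (.inl (.inl (.inr k)))) = σ := by
  funext q
  have h := congrFun hσ q
  have h1 := firstIndex_cases (n := n)
  have h2 := secondIndex_cases (n := n)
  rcases q with ((q | q) | (q | q)) | (q | q)
  · rfl
  · rfl
  · exact h
  · exact h
  · refine Eq.trans ?_ h
    rcases h1 q with ⟨c, h3⟩ | h3 | h3 | h3 | h3 <;> simp [startKet, walkQb, h3] <;> rfl
  · refine Eq.trans ?_ h
    rcases h2 q with ⟨c, h3⟩ | h3 | h3 | h3 | h3 <;> simp [startKet, walkQb, h3] <;> rfl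

theorem keepOnly_comp_walkQb (x : Fin n → Bool) (s : Fin 2 → Bool) {z : Qb n → Bool}
    (hx : ∀ v, z (.x v) = x v) (hs : ∀ k, z (.xs k) = s k) :
    keepOnly firstRegister (z ∘ walkQb) = startKet x s := by
  have h1 := firstIndex_cases (n := n)
  have h2 := secondIndex_cases (n := n)
  funext q
  rcases q with ((q | q) | (q | q)) | (q | q)
  · exact (Bool.true_and _).trans (hx q)
  · exact (Bool.true_and _).trans (hs q)
  · rfl
  · rfl
  · rcases h1 q with ⟨c, h3⟩ | h3 | h3 | h3 | h3 <;>
      simp [keepOnly, firstRegister, startKet, walkQb, h3, startState]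
  · rcases h2 q with ⟨c, h3⟩ | h3 | h3 | h3 | h3 <;>
      simp [keepOnly, firstRegister, startKet, walkQb, h3, startState]

/-- A circuit that prepares the pairs yields a circuit for the reflection about the states in which
the pairs are written out. -/
theorem exists_reflection (μ : Mode) (hn : 1 ≤ n) {α : Fin n × Fin n → ℝ} {good : (Fin n → Bool) → Prop}
    {c : QCircuit n (Qb n)} (hc : Prepares μ α good c) :
    ∃ (a : ℕ) (circ : QCircuit n (WalkQubit n (vertexBits n + 4) ⊕ Fin a)),
      QCircuit.cost circ ≤ 32 * (QCircuit.cost c + n ^ 2 * (66 * vertexBits n + 49)) +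
        10 * (2 * (n + 2) + 2 * (vertexBits n + 4)) + 11 ∧
      ∀ G : SimpleGraph (Fin n), ∃ V : (WalkQubit n (vertexBits n + 4) → Bool) →
        Vec (WalkQubit n (vertexBits n + 4)),
        householder firstRegister V ∈ Matrix.unitaryGroup (WalkQubit n (vertexBits n + 4) → Bool) ℂ ∧
        circ.Implements G (householder firstRegister V) ∧
        ∀ (x : Fin n → Bool) (s : Fin 2 → Bool), ∃ (c₀ : ℂ) (β : Fin n × Fin n → ℂ) (γ : (Fin n → Bool) → ℂ),
          V (startKet x s) = c₀ • ket (startKet x s) + ∑ p, β p • ket (pairKet μ G x s p) +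
            ∑ u, γ u • ket (restKet x s u) ∧
          (good x → (Real.sqrt 2 : ℂ) * c₀ = 1 ∧
            ∀ p, (Real.sqrt 2 : ℂ) * β p = if μ.mem x p then (α p : ℂ) else 0) := by
  obtain ⟨a, circ, hcost, hcirc⟩ := exists_householder hn (walkQb_injective (n := n)) (c ++ postC μ)
    firstRegister
  refine ⟨a, circ, ?_, fun G => ?_⟩
  · have h1 := cost_postC (n := n) μ hn
    have h2 : Fintype.card (WalkQubit n (vertexBits n + 4)) = 2 * (n + 2) + 2 * (vertexBits n + 4) := by
      simp [Fintype.card_sum]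
      omega
    rw [cost_append, h2] at hcost
    omega
  · choose c₀ β γ h1 h2 using fun (x : Fin n → Bool) (s : Fin 2 → Bool) =>
      hc G (startState x s) (clean_startState x s)
    -- V reads `x` and `s` off the first simplex register of its argument, so that the formula holds
    -- definitionally at every `startKet`.
    obtain ⟨V, hV⟩ : ∃ V : (WalkQubit n (vertexBits n + 4) → Bool) →
        Vec (WalkQubit n (vertexBits n + 4)), ∀ x s, V (startKet x s) =
          c₀ x s • ket (startKet x s) + ∑ p, β x s p • ket (pairKet μ G x s p) +
            ∑ u, γ x s u • ket (restKet x s u) := by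
      refine ⟨fun σ => c₀ (fun v => σ (.inl (.inl (.inl v)))) (fun k => σ (.inl (.inl (.inr k)))) •
        ket (startKet (fun v => σ (.inl (.inl (.inl v)))) (fun k => σ (.inl (.inl (.inr k))))) +
        ∑ p, β (fun v => σ (.inl (.inl (.inl v)))) (fun k => σ (.inl (.inl (.inr k)))) p •
        ket (pairKet μ G (fun v => σ (.inl (.inl (.inl v)))) (fun k => σ (.inl (.inl (.inr k)))) p) +
        ∑ u, γ (fun v => σ (.inl (.inl (.inl v)))) (fun k => σ (.inl (.inl (.inr k)))) u •
        ket (restKet (fun v => σ (.inl (.inl (.inl v)))) (fun k => σ (.inl (.inl (.inr k)))) u), ?_⟩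
      intro x s
      rfl
    have hlift : ∀ z : Qb n → Bool, WorkZero z → lift walkQb (fun _ => false) (ket (z ∘ walkQb)) = ket z :=
      fun z hz => by rw [lift_ket, extend_walkQb hz]
    have hA : ∀ σ, keepOnly firstRegister σ = σ →
        run G (c ++ postC μ) (ket (Function.extend walkQb σ fun _ => false)) =
          lift walkQb (fun _ => false) (V σ) := by
      intro σ hσ
      obtain ⟨x, s, rfl⟩ : ∃ x s, σ = startKet x s := ⟨_, _, (startKet_of_keepOnly hσ).symm⟩
      have i1 : ∀ y : Qb n → Bool, (∀ p, y (.e p) = false) → y .h1 = false →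
          (∀ b, y (.par b) = false) → (∀ b, y (.anc b) = false) → (∀ b, y (.vert b) = false) →
          y .qa = false → run G (postC μ) (ket y) = ket y := run_postC_idle G μ
      rw [startKet, extend_walkQb (workZero_startState x s), run_append, h1, ← startKet, hV, map_add, map_add,
        map_sum, map_sum, map_smul, i1 _ (fun _ => rfl) rfl (fun _ => rfl) (fun _ => rfl) (fun _ => rfl) rfl,
        map_add, map_add, map_sum, map_sum, map_smul]
      refine congrArg₂ (· + ·) (congrArg₂ (· + ·) ?_ (Finset.sum_congr rfl fun p _ => ?_))
        (Finset.sum_congr rfl fun u _ => ?_)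
      · rw [startKet, hlift _ (workZero_startState x s)]
      · rw [map_smul, map_smul, pairKet, hlift _ (workZero_pairState μ x s p _),
          run_postC G μ x s p (adjAll G x p.1)]
        classical
        unfold adjAll
        rw [decide_eq_true_iff]
      · rw [map_smul, map_smul, restKet, hlift _ (workZero_restState x s u),
          i1 _ (fun _ => rfl) rfl (fun _ => rfl) (fun _ => rfl) (fun _ => rfl) rfl]
    -- The first simplex register is never written to, so every term of V σ still carries σ there.
    have hB : ∀ σ x, keepOnly firstRegister σ = σ → V σ x ≠ 0 → keepOnly firstRegister x = σ := by
      intro σ x hσ hx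
      obtain ⟨x', s, rfl⟩ : ∃ x s, σ = startKet x s := ⟨_, _, (startKet_of_keepOnly hσ).symm⟩
      by_contra hne
      refine hx ?_
      classical
      have k1 : x ≠ startKet x' s := fun h => hne (h ▸ hσ)
      have k2 : ∀ p, x ≠ pairKet μ G x' s p := by
        rintro p rfl
        exact hne (keepOnly_comp_walkQb x' s (fun v => rfl) fun k => rfl)
      have k3 : ∀ u, x ≠ restKet x' s u := by
        rintro u rfl
        exact hne (keepOnly_comp_walkQb x' s (fun v => rfl) fun k => rfl)
      rw [hV]
      simp [ket_apply, k1, k2, k3]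
    obtain ⟨hU, hI⟩ := hcirc G V hA hB
    exact ⟨V, hU, hI, fun x s => ⟨c₀ x s, β x s, γ x s, hV x s, h2 x s⟩⟩

end Unitary

/-! ### The amplitudes of the walk unitaries -/

section Overlap

variable {n : ℕ}

/-- Exchanges the two simplex registers and the two index registers. -/
def flipRegisters {m : ℕ} (y : WalkQubit n m → Bool) : WalkQubit n m → Bool :=
  y ∘ Sum.map Sum.swap Sum.swap

theorem conjTranspose_mul_swapMatrix_mul {m : ℕ}
    (U : Matrix (WalkQubit n m → Bool) (WalkQubit n m → Bool) ℂ) (a b : WalkQubit n m → Bool) :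
    (U.conjTranspose * swapMatrix n m * U) a b = ∑ y, star (U (flipRegisters y) a) * U y b := by
  rw [Matrix.mul_apply]
  refine Finset.sum_congr rfl fun y _ => ?_
  rw [Matrix.mul_apply, Finset.sum_eq_single (flipRegisters y)]
  · simp [swapMatrix, flipRegisters]
  · intro z _ hz
    have : swapMatrix n m z y = 0 := if_neg hz
    rw [this, mul_zero]
  · simp

/-- The qubit of the first index register that marks the states in which no pair is chosen. -/
def restFlag (n : ℕ) : Fin (vertexBits n + 4) := ⟨vertexBits n, by omega⟩

/-- The qubit of an index register that marks the states in which the pair does not contribute. -/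
def badFlag (n : ℕ) : Fin (vertexBits n + 4) := ⟨vertexBits n + 1, by omega⟩

/-- The qubit of an index register that marks the states in which a pair is chosen. -/
def pairFlag (n : ℕ) : Fin (vertexBits n + 4) := ⟨vertexBits n + 2, by omega⟩

theorem firstIndex_restFlag : firstIndex (restFlag n) = .f1 := by simp [firstIndex, restFlag]

theorem secondIndex_restFlag : secondIndex (restFlag n) = .f2 := by simp [secondIndex, restFlag]

theorem firstIndex_badFlag : firstIndex (badFlag n) = .g1 := by simp [firstIndex, badFlag]

theorem secondIndex_badFlag : secondIndex (badFlag n) = .g2 := by simp [secondIndex, badFlag]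

theorem firstIndex_pairFlag : firstIndex (pairFlag n) = .h1 := by simp [firstIndex, pairFlag]

theorem restKet_restFlag (x : Fin n → Bool) (s : Fin 2 → Bool) (u : Fin n → Bool) :
    restKet x s u (.inr (.inl (restFlag n))) = true ∧
      restKet x s u (.inr (.inr (restFlag n))) = false := by
  constructor
  · simp only [restKet, Function.comp, walkQb, firstIndex_restFlag]
    rfl
  · simp only [restKet, Function.comp, walkQb, secondIndex_restFlag]
    rfl

theorem startKet_restFlag (x : Fin n → Bool) (s : Fin 2 → Bool) :
    startKet x s (.inr (.inl (restFlag n))) = false := by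
  simp only [startKet, Function.comp, walkQb, firstIndex_restFlag]
  rfl

theorem startKet_pairFlag (x : Fin n → Bool) (s : Fin 2 → Bool) :
    startKet x s (.inr (.inl (pairFlag n))) = false := by
  simp only [startKet, Function.comp, walkQb, firstIndex_pairFlag]
  rfl

variable (μ : Mode) (G : SimpleGraph (Fin n))

theorem pairKet_restFlag (x : Fin n → Bool) (s : Fin 2 → Bool) (p : Fin n × Fin n) :
    pairKet μ G x s p (.inr (.inl (restFlag n))) = false ∧
      pairKet μ G x s p (.inr (.inr (restFlag n))) = false := by
  constructor
  · simp only [pairKet, Function.comp, walkQb, firstIndex_restFlag]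
    rfl
  · simp only [pairKet, Function.comp, walkQb, secondIndex_restFlag]
    rfl

theorem pairKet_pairFlag (x : Fin n → Bool) (s : Fin 2 → Bool) (p : Fin n × Fin n) :
    pairKet μ G x s p (.inr (.inl (pairFlag n))) = true := by
  simp only [pairKet, Function.comp, walkQb, firstIndex_pairFlag]
  rfl

theorem pairKet_index (x : Fin n → Bool) (s : Fin 2 → Bool) (p : Fin n × Fin n) {b : ℕ}
    (hb : b < vertexBits n) :
    pairKet μ G x s p (.inr (.inl ⟨b, by omega⟩)) = p.1.val.testBit b ∧
      pairKet μ G x s p (.inr (.inr ⟨b, by omega⟩)) = p.2.val.testBit b := by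
  constructor
  · have : firstIndex (n := n) ⟨b, by omega⟩ = .i1 b := if_pos hb
    simp only [pairKet, Function.comp, walkQb, this]
    rfl
  · have : secondIndex (n := n) ⟨b, by omega⟩ = .i2 b := if_pos hb
    simp only [pairKet, Function.comp, walkQb, this]
    rfl

theorem eq_of_testBit {u v : Fin n} (h : ∀ b < vertexBits n, u.val.testBit b = v.val.testBit b) : u = v := by
  refine Fin.ext (Nat.eq_of_testBit_eq fun b => ?_)
  rcases lt_or_ge b (vertexBits n) with hb | hb
  · exact h b hb
  · rw [testBit_of_le (val_lt_two_pow u) hb, testBit_of_le (val_lt_two_pow v) hb]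

theorem eq_swap_of_flip_pairKet {x x' : Fin n → Bool} {s s' : Fin 2 → Bool} {p p' : Fin n × Fin n}
    (h : flipRegisters (pairKet μ G x s p) = pairKet μ G x' s' p') : p' = p.swap := by
  refine Prod.ext (eq_of_testBit fun b hb => ?_) (eq_of_testBit fun b hb => ?_)
  · rw [← (pairKet_index μ G x' s' p' hb).1, ← h]
    exact (pairKet_index μ G x s p hb).2
  · rw [← (pairKet_index μ G x' s' p' hb).2, ← h]
    exact (pairKet_index μ G x s p hb).1

/-- The exchange of the pair `p` turns the simplex `x` with the sign `s` into `x'` with the sign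
`s'`. -/
def Mode.Exchanges (x : Fin n → Bool) (s : Bool) (p : Fin n × Fin n) (x' : Fin n → Bool) (s' : Bool) :
    Prop :=
  (∀ v, x' v = xor (x v) (decide (p.1 ≠ p.2) && (decide (v = p.1) || decide (v = p.2)))) ∧
    s' = xor s (μ.sgn x p)

/-- Compared register by register: the simplex registers give the two exchange conditions. The flag
`g1` is matched with `g2`, which is never set, so it has to vanish on both sides. The flags `h` and
`d` are written to both index registers and agree automatically. -/
theorem flip_pairKet_iff (x x' : Fin n → Bool) (s s' : Bool) (p : Fin n × Fin n) :
    flipRegisters (pairKet μ G x ![s, false] p) = pairKet μ G x' ![s', false] p.swap ↔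
      μ.bad (adjAll G x p.1) p = false ∧ μ.bad (adjAll G x' p.2) p.swap = false ∧
        μ.Exchanges x s p x' s' ∧ μ.Exchanges x' s' p.swap x s := by
  constructor
  · intro h
    refine ⟨?_, ?_, ⟨fun v => ?_, ?_⟩, fun v => ?_, ?_⟩
    · have h1 := congrFun h (.inr (.inr (badFlag n)))
      simp only [flipRegisters, pairKet, Function.comp, Sum.map_inr, Sum.swap_inr, walkQb, firstIndex_badFlag,
        secondIndex_badFlag] at h1
      exact h1
    · have h1 := congrFun h (.inr (.inl (badFlag n)))
      simp only [flipRegisters, pairKet, Function.comp, Sum.map_inr, Sum.swap_inl, walkQb, firstIndex_badFlag,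
        secondIndex_badFlag] at h1
      exact h1.symm
    · exact (congrFun h (.inl (.inl (.inl v)))).symm
    · exact (congrFun h (.inl (.inl (.inr 0)))).symm
    · exact (congrFun h (.inl (.inr (.inl v))))
    · exact (congrFun h (.inl (.inr (.inr 0))))
  · rintro ⟨h1, h2, ⟨h3, h4⟩, h5, h6⟩
    funext q
    rcases q with ((v | k) | (v | k)) | (i | i)
    · exact (h3 v).symm
    · fin_cases k
      · exact h4.symm
      · rfl
    · exact h5 v
    · fin_cases k
      · exact h6
      · rfl
    · simp only [flipRegisters, pairKet, Function.comp, Sum.map_inr, Sum.swap_inl, walkQb, firstIndex, secondIndex,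
        Prod.fst_swap]
      rw [h2]
      split_ifs
      · rfl
      · rfl
      · rfl
      · rfl
      · exact Bool.decide_congr eq_comm
    · simp only [flipRegisters, pairKet, Function.comp, Sum.map_inr, Sum.swap_inr, walkQb, firstIndex, secondIndex,
        Prod.fst_swap]
      rw [h1]
      split_ifs
      · rfl
      · rfl
      · rfl
      · rfl
      · exact Bool.decide_congr eq_comm

/-- The column of the reflection is |σ⟩ - 2 c̄₀ V σ. With √2 c₀ = 1 the factor 2 c̄₀ is √2, and the
component along |σ⟩ cancels. -/
theorem householder_startKet {V : (WalkQubit n (vertexBits n + 4) → Bool) →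
      Vec (WalkQubit n (vertexBits n + 4))} {x : Fin n → Bool} {s : Fin 2 → Bool} {c₀ : ℂ}
    {β : Fin n × Fin n → ℂ} {γ : (Fin n → Bool) → ℂ}
    (hV : V (startKet x s) = c₀ • ket (startKet x s) + ∑ p, β p • ket (pairKet μ G x s p) +
      ∑ u, γ u • ket (restKet x s u)) (hc : (Real.sqrt 2 : ℂ) * c₀ = 1)
    (y : WalkQubit n (vertexBits n + 4) → Bool) :
    householder firstRegister V y (startKet x s) =
      -((∑ p, ((Real.sqrt 2 : ℂ) * β p) • ket (pairKet μ G x s p) +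
        ∑ u, ((Real.sqrt 2 : ℂ) * γ u) • ket (restKet x s u)) y) := by
  classical
  have h1 : keepOnly firstRegister (startKet x s) = startKet x s :=
    keepOnly_comp_walkQb x s (fun _ => rfl) fun _ => rfl
  have h2 : ∀ p, startKet x s ≠ pairKet μ G x s p := fun p h => by
    simpa [startKet_pairFlag, pairKet_pairFlag] using congrFun h (.inr (.inl (pairFlag n)))
  have h3 : ∀ u, startKet x s ≠ restKet x s u := fun u h => by
    simpa [startKet_restFlag, restKet_restFlag] using congrFun h (.inr (.inl (restFlag n)))
  have hs2 : (Real.sqrt 2 : ℂ) * Real.sqrt 2 = 2 := by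
    rw [← Complex.ofReal_mul, Real.mul_self_sqrt (by norm_num)]
    norm_num
  have h4 : V (startKet x s) (startKet x s) = c₀ := by
    rw [hV]
    simp [ket_apply, h2, h3]
  have h5 : 2 * star c₀ = (Real.sqrt 2 : ℂ) := by
    have h6 : (Real.sqrt 2 : ℂ) * star c₀ = 1 := by
      have := congrArg star hc
      simpa [mul_comm] using this
    rw [← hs2, mul_assoc, h6, mul_one]
  have h6 : householder firstRegister V y (startKet x s) =
      (if y = startKet x s then 1 else 0) - (Real.sqrt 2 : ℂ) * V (startKet x s) y := by
    simp only [householder, Matrix.of_apply]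
    rw [h1, h4, ← h5]
    refine congrArg₂ (· - ·) (by congr) (by ring)
  rw [h6, hV]
  simp only [Finsupp.add_apply, Finsupp.smul_apply, smul_eq_mul, mul_add, Finsupp.finsetSum_apply,
    Finset.mul_sum, ket_apply, ← mul_assoc, hc]
  ring

/-- Rest states have `f1` set, while no state here has `f2` set, so SWAP separates them from
everything. The index registers leave `p.swap` as the only possible partner of `p`. -/
theorem sum_star_flip_mul {x x' : Fin n → Bool} {s s' : Fin 2 → Bool} (b b' : Fin n × Fin n → ℝ)
    (γ γ' : (Fin n → Bool) → ℂ)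
    [DecidablePred fun p => flipRegisters (pairKet μ G x s p) = pairKet μ G x' s' p.swap] :
    ∑ y, star ((∑ p, (b' p : ℂ) • ket (pairKet μ G x' s' p) + ∑ u, γ' u • ket (restKet x' s' u))
        (flipRegisters y)) *
      (∑ p, (b p : ℂ) • ket (pairKet μ G x s p) + ∑ u, γ u • ket (restKet x s u)) y =
      ((∑ p, if flipRegisters (pairKet μ G x s p) = pairKet μ G x' s' p.swap then b p * b' p.swap else 0 : ℝ) :
        ℂ) := by
  classical
  obtain ⟨Ψ, hΨ⟩ : ∃ Ψ, Ψ = ∑ p, (b' p : ℂ) • ket (pairKet μ G x' s' p) + ∑ u, γ' u • ket (restKet x' s' u) :=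
    ⟨_, rfl⟩
  have h1 : ∀ u, Ψ (flipRegisters (restKet x s u)) = 0 := by
    intro u
    have k1 : ∀ p, flipRegisters (restKet x s u) ≠ pairKet μ G x' s' p := fun p h => by
      have h1 := congrFun h (.inr (.inr (restFlag n)))
      rw [(pairKet_restFlag μ G x' s' p).2] at h1
      exact Bool.noConfusion ((restKet_restFlag x s u).1.symm.trans h1)
    have k2 : ∀ u', flipRegisters (restKet x s u) ≠ restKet x' s' u' := fun u' h => by
      have h1 := congrFun h (.inr (.inr (restFlag n)))
      rw [(restKet_restFlag x' s' u').2] at h1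
      exact Bool.noConfusion ((restKet_restFlag x s u).1.symm.trans h1)
    rw [hΨ]
    simp [ket_apply, k1, k2]
  have h2 : ∀ p, Ψ (flipRegisters (pairKet μ G x s p)) =
      if flipRegisters (pairKet μ G x s p) = pairKet μ G x' s' p.swap then (b' p.swap : ℂ) else 0 := by
    intro p
    have k1 : ∀ u', flipRegisters (pairKet μ G x s p) ≠ restKet x' s' u' := fun u' h => by
      have h1 := congrFun h (.inr (.inl (restFlag n)))
      rw [(restKet_restFlag x' s' u').1] at h1
      exact Bool.noConfusion ((pairKet_restFlag μ G x s p).2.symm.trans h1)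
    rw [hΨ]
    simp only [Finsupp.add_apply, Finsupp.smul_apply, smul_eq_mul, Finsupp.finsetSum_apply, ket_apply, k1,
      if_false, mul_zero, Finset.sum_const_zero, add_zero]
    rw [Finset.sum_eq_single p.swap]
    · simp
    · intro p' _ hp'
      rw [if_neg fun h => hp' (eq_swap_of_flip_pairKet μ G h), mul_zero]
    · simp
  rw [← hΨ]
  simp only [Finsupp.add_apply, Finsupp.smul_apply, smul_eq_mul, Finsupp.finsetSum_apply, ket_apply, mul_add,
    Finset.mul_sum, Finset.sum_add_distrib]
  rw [Finset.sum_comm]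
  conv_lhs => enter [2]; rw [Finset.sum_comm]
  simp only [mul_ite, mul_one, mul_zero, Finset.sum_ite_eq', Finset.mem_univ, if_true, h1, h2, star_zero, zero_mul,
    Finset.sum_const_zero, add_zero, Complex.ofReal_sum]
  refine Finset.sum_congr rfl fun p _ => ?_
  split_ifs
  · simp [mul_comm]
  · simp

end Overlap

/-! ### The exchanges of vertices and the adjacency of oriented simplices -/

section Exchange

variable {n : ℕ}

/-- The indicator of a set of vertices. -/
def indicatorBits (S : Finset (Fin n)) : Fin n → Bool := fun v => decide (v ∈ S)

/-- The parity of the number of vertices of `S` below `v`. -/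
def lowerParity (S : Finset (Fin n)) (v : Fin n) : Bool := decide (Odd (S.filter fun u => u < v).card)

theorem lowerParity_insert {S : Finset (Fin n)} {i : Fin n} (hi : i ∉ S) (v : Fin n) :
    lowerParity (insert i S) v = xor (lowerParity S v) (decide (i < v)) := by
  unfold lowerParity
  rw [Finset.filter_insert]
  split_ifs with h
  · rw [Finset.card_insert_of_notMem (by simp [hi])]
    simp [Nat.odd_add_one, h, -Nat.not_odd_iff_even]
  · simp [h]

theorem lowerParity_erase {S : Finset (Fin n)} {j : Fin n} (hj : j ∈ S) (v : Fin n) :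
    lowerParity (S.erase j) v = xor (lowerParity S v) (decide (j < v)) := by
  have h := lowerParity_insert (Finset.notMem_erase j S) v
  rw [Finset.insert_erase hj] at h
  rw [h, Bool.xor_assoc, Bool.xor_self, Bool.xor_false]

theorem prefixParity_eq (x : Fin n → Bool) (b : ℕ) :
    prefixParity x b = decide (Odd (Finset.univ.filter fun u : Fin n => x u = true ∧ u.val < b).card) := by
  induction b with
  | zero => simp [prefixParity]
  | succ b ih =>
    have hsub : (Finset.univ.filter fun u : Fin n => x u = true ∧ u.val < b + 1) =
        (Finset.univ.filter fun u : Fin n => x u = true ∧ u.val < b) ∪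
          Finset.univ.filter fun u : Fin n => x u = true ∧ u.val = b := by
      ext u
      simp only [Finset.mem_filter, Finset.mem_univ, true_and, Finset.mem_union]
      rw [← and_or_left, Nat.lt_succ_iff_lt_or_eq]
    have hdis : Disjoint (Finset.univ.filter fun u : Fin n => x u = true ∧ u.val < b)
        (Finset.univ.filter fun u : Fin n => x u = true ∧ u.val = b) := by
      rw [Finset.disjoint_left]
      intro u hu hu'
      simp only [Finset.mem_filter, Finset.mem_univ, true_and] at hu hu'
      omega
    rw [prefixParity, ih, hsub, Finset.card_union_of_disjoint hdis]
    by_cases h : b < n ∧ ∃ h : b < n, x ⟨b, h⟩ = true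
    · obtain ⟨-, hb, hx⟩ := h
      have : (Finset.univ.filter fun u : Fin n => x u = true ∧ u.val = b) = {⟨b, hb⟩} := by
        ext u
        simp only [Finset.mem_filter, Finset.mem_univ, true_and, Finset.mem_singleton]
        constructor
        · rintro ⟨-, h⟩
          exact Fin.ext h
        · rintro rfl
          exact ⟨hx, rfl⟩
      rw [this, dif_pos hb, hx]
      simp [Nat.odd_add_one, -Nat.not_odd_iff_even]
    · have : (Finset.univ.filter fun u : Fin n => x u = true ∧ u.val = b) = ∅ := by
        refine Finset.filter_eq_empty_iff.2 fun u _ hu => h ⟨hu.2 ▸ u.isLt, hu.2 ▸ u.isLt, ?_⟩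
        obtain ⟨hx, rfl⟩ := hu
        exact hx
      have h2 : (if h : b < n then x ⟨b, h⟩ else false) = false := by
        by_contra hc
        split_ifs at hc with hb
        · exact h ⟨hb, hb, by simpa using hc⟩
        · exact hc rfl
      rw [this, h2]
      simp

theorem prefixParity_indicatorBits (S : Finset (Fin n)) (v : Fin n) :
    prefixParity (indicatorBits S) v = lowerParity S v := by
  rw [prefixParity_eq, lowerParity]
  congr 3
  ext u
  simp [indicatorBits]

/-- `S'` arises from `S` by the exchange of the vertex `p.2` by `p.1`. -/
def IsExchange (S : Finset (Fin n)) (p : Fin n × Fin n) (S' : Finset (Fin n)) : Prop :=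
  S' \ S = {p.1} ∧ S \ S' = {p.2}

variable {S S' : Finset (Fin n)} {p : Fin n × Fin n}

theorem isExchange_iff :
    IsExchange S p S' ↔ p.1 ∉ S ∧ p.2 ∈ S ∧ S' = (insert p.1 S).erase p.2 := by
  unfold IsExchange
  simp only [Finset.ext_iff, Finset.mem_sdiff, Finset.mem_singleton, Finset.mem_erase, Finset.mem_insert]
  constructor
  · rintro ⟨h1, h2⟩
    have h3 := (h1 p.1).2 rfl
    have h4 := (h2 p.2).2 rfl
    refine ⟨h3.2, h4.1, fun v => ?_⟩
    have h5 := h1 v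
    have h6 := h2 v
    have h7 : p.1 ≠ p.2 := fun h => h3.2 (h ▸ h4.1)
    by_cases e1 : v = p.1
    · subst e1
      tauto
    · tauto
  · rintro ⟨h1, h2, h3⟩
    have h7 : p.1 ≠ p.2 := fun h => h1 (h ▸ h2)
    refine ⟨fun v => ?_, fun v => ?_⟩
    · rw [h3]
      constructor
      · tauto
      · rintro rfl
        tauto
    · rw [h3]
      constructor
      · tauto
      · rintro rfl
        tauto

theorem IsExchange.swap (h : IsExchange S p S') : IsExchange S' p.swap S := ⟨h.2, h.1⟩

theorem IsExchange.ne (h : IsExchange S p S') : p.1 ≠ p.2 := by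
  rw [isExchange_iff] at h
  exact fun e => h.1 (e ▸ h.2.1)

theorem IsExchange.eq {p' : Fin n × Fin n} (h : IsExchange S p S') (h' : IsExchange S p' S') : p = p' :=
  Prod.ext (Finset.singleton_injective (h.1.symm.trans h'.1)) (Finset.singleton_injective (h.2.symm.trans h'.2))

theorem IsExchange.insert_eq (h : IsExchange S p S') : insert p.1 S = insert p.2 S' := by
  rw [isExchange_iff] at h
  rw [h.2.2, Finset.insert_erase (Finset.mem_insert_of_mem h.2.1)]

theorem IsExchange.erase_eq (h : IsExchange S p S') : S.erase p.2 = S'.erase p.1 := by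
  have h1 := h.ne
  rw [isExchange_iff] at h
  rw [h.2.2, Finset.erase_right_comm, Finset.erase_insert h.1]

theorem IsExchange.lowerParity_eq (h : IsExchange S p S') (v : Fin n) :
    lowerParity S' v = xor (xor (lowerParity S v) (decide (p.1 < v))) (decide (p.2 < v)) := by
  rw [isExchange_iff] at h
  rw [h.2.2, lowerParity_erase (Finset.mem_insert_of_mem h.2.1), lowerParity_insert h.1]

/-- Passing from `S` to `S'` adds the terms [p.1 < p.2] and [p.2 < p.1] to the two parities, and
these turn `before p.swap` into `before p`. Hence reversing an exchange restores the sign. -/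
theorem Mode.sgn_swap (μ : Mode) (h : IsExchange S p S') :
    μ.sgn (indicatorBits S') p.swap = μ.sgn (indicatorBits S) p := by
  simp only [Mode.sgn, Prod.fst_swap, Prod.snd_swap, prefixParity_indicatorBits, h.lowerParity_eq, lt_irrefl,
    decide_false, Bool.xor_false]
  cases μ <;> simp only [Mode.before, Prod.fst_swap, Prod.snd_swap] <;>
    cases lowerParity S p.1 <;> cases lowerParity S p.2 <;> cases decide (p.1 < p.2) <;>
    cases decide (p.2 < p.1) <;> rfl

/-- Exactly one of p.1 < p.2 and p.2 < p.1 holds. This is the cancellation behind ∂∂ = 0: simplices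
that agree on a common face disagree on a common coface. -/
theorem Mode.sgn_up (x : Fin n → Bool) (hp : p.1 ≠ p.2) : Mode.up.sgn x p = !Mode.down.sgn x p := by
  simp only [Mode.sgn, Mode.before]
  rcases lt_or_gt_of_ne hp with h | h <;> simp [h, not_lt_of_gt h]

theorem Mode.sgn_diagonal (μ : Mode) (x : Fin n → Bool) (hp : p.1 = p.2) : μ.sgn x p = false := by
  cases μ <;> simp [Mode.sgn, Mode.before, hp]

theorem Mode.exchanges_iff_of_diagonal (μ : Mode) (σ σ' : OrientedSimplex n) (hp : p.1 = p.2) :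
    μ.Exchanges (indicatorBits σ.1) σ.2 p (indicatorBits σ'.1) σ'.2 ↔ σ' = σ := by
  unfold Mode.Exchanges
  rw [μ.sgn_diagonal _ hp, Prod.ext_iff, Finset.ext_iff]
  simp [hp, indicatorBits]

theorem Mode.exchanges_iff_of_ne (μ : Mode) (σ σ' : OrientedSimplex n) (h1 : p.1 ∉ σ.1) (h2 : p.2 ∈ σ.1) :
    μ.Exchanges (indicatorBits σ.1) σ.2 p (indicatorBits σ'.1) σ'.2 ↔
      IsExchange σ.1 p σ'.1 ∧ σ'.2 = xor σ.2 (μ.sgn (indicatorBits σ.1) p) := by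
  have h7 : p.1 ≠ p.2 := fun h => h1 (h ▸ h2)
  unfold Mode.Exchanges
  refine and_congr_left fun _ => ?_
  rw [isExchange_iff, Finset.ext_iff, and_iff_right h1, and_iff_right h2]
  refine forall_congr' fun v => ?_
  simp only [indicatorBits, Finset.mem_erase, Finset.mem_insert, ne_eq, h7, not_false_iff, decide_true,
    Bool.true_and]
  by_cases e1 : v = p.1
  · subst e1
    simp [h1, h7]
  · by_cases e2 : v = p.2
    · subst e2
      simp [h2, e1]
    · simp [e1, e2]

variable {G : SimpleGraph (Fin n)} {k : ℕ}

/-- The common face is σ without `p.2` and also σ' without `p.1`. Equating the two induced signs and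
rewriting the parity in σ' at `p.1` as the parity in σ plus [p.2 < p.1] gives the sign rule. -/
theorem downAdj_iff {σ σ' : OrientedSimplex n} (hne : σ ≠ σ') :
    σ.DownAdj σ' ↔ ∃ p, IsExchange σ.1 p σ'.1 ∧ σ'.2 = xor σ.2 (Mode.down.sgn (indicatorBits σ.1) p) := by
  have key : ∀ p, IsExchange σ.1 p σ'.1 → (σ.face p.2 = σ'.face p.1 ↔
      σ'.2 = xor σ.2 (Mode.down.sgn (indicatorBits σ.1) p)) := by
    intro p hp
    have h1 : σ.face p.2 = σ'.face p.1 ↔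
        xor σ.2 (lowerParity σ.1 p.2) = xor σ'.2 (lowerParity σ'.1 p.1) := by
      rw [Prod.ext_iff]
      exact and_iff_right hp.erase_eq
    rw [h1, hp.lowerParity_eq, Mode.sgn, prefixParity_indicatorBits, prefixParity_indicatorBits]
    simp only [lt_irrefl, decide_false, Bool.xor_false, Mode.before]
    cases σ.2 <;> cases σ'.2 <;> cases lowerParity σ.1 p.1 <;> cases lowerParity σ.1 p.2 <;>
      cases decide (p.2 < p.1) <;> decide
  constructor
  · rintro ⟨ρ, ⟨j, hj, hρ⟩, i, hi, hρ'⟩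
    have h1 : σ.face j = σ'.face i := hρ.trans hρ'.symm
    have h2 : σ.1.erase j = σ'.1.erase i := congrArg Prod.fst h1
    -- If the same vertex were removed from both, equal faces with equal signs would force σ = σ'.
    have hij : i ≠ j := by
      rintro rfl
      have h3 : σ.1 = σ'.1 := by rw [← Finset.insert_erase hj, h2, Finset.insert_erase hi]
      have h4 : xor σ.2 (lowerParity σ.1 i) = xor σ'.2 (lowerParity σ'.1 i) := congrArg Prod.snd h1
      rw [h3] at h4
      refine hne (Prod.ext h3 ?_)
      revert h4
      cases σ.2 <;> cases σ'.2 <;> cases lowerParity σ'.1 i <;> simp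
    have hE : IsExchange σ.1 (i, j) σ'.1 := by
      rw [isExchange_iff]
      have h3 : i ∉ σ.1 := fun h => Finset.notMem_erase i σ'.1 (h2 ▸ Finset.mem_erase.2 ⟨hij, h⟩)
      refine ⟨h3, hj, ?_⟩
      rw [Finset.erase_insert_of_ne hij, h2, Finset.insert_erase hi]
    exact ⟨(i, j), hE, (key _ hE).1 h1⟩
  · rintro ⟨p, hp, hs⟩
    have h1 := (isExchange_iff.1 hp).2.1
    have h2 := (isExchange_iff.1 hp.swap).2.1
    exact ⟨σ.face p.2, ⟨p.2, h1, rfl⟩, p.1, h2, ((key p hp).2 hs).symm⟩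

/-- The common coface is σ with `p.1` added. Its sign is fixed by σ, and removing `p.2` from it
meets the parity in σ at `p.2` plus [p.1 < p.2]. -/
theorem upAdj_iff {σ σ' : OrientedSimplex n} (hne : σ ≠ σ') :
    σ.UpAdj G k σ' ↔ ∃ p, IsExchange σ.1 p σ'.1 ∧ IsSimplex G (k + 1) (insert p.1 σ.1) ∧
      σ'.2 = xor σ.2 (Mode.up.sgn (indicatorBits σ.1) p) := by
  have key : ∀ p, IsExchange σ.1 p σ'.1 → ∀ t : Bool,
      OrientedSimplex.face (insert p.1 σ.1, t) p.1 = σ → (OrientedSimplex.face (insert p.1 σ.1, t) p.2 = σ' ↔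
      σ'.2 = xor σ.2 (Mode.up.sgn (indicatorBits σ.1) p)) := by
    intro p hp t ht
    have h1 : OrientedSimplex.face (insert p.1 σ.1, t) p.2 = σ' ↔
        xor t (lowerParity (insert p.1 σ.1) p.2) = σ'.2 := by
      rw [Prod.ext_iff]
      exact and_iff_right (isExchange_iff.1 hp).2.2.symm
    have h2 : xor t (lowerParity (insert p.1 σ.1) p.1) = σ.2 := congrArg Prod.snd ht
    rw [h1, ← h2, lowerParity_insert (isExchange_iff.1 hp).1, lowerParity_insert (isExchange_iff.1 hp).1,
      Mode.sgn, prefixParity_indicatorBits, prefixParity_indicatorBits]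
    simp only [lt_irrefl, decide_false, Bool.xor_false, Mode.before]
    cases t <;> cases σ'.2 <;> cases lowerParity σ.1 p.1 <;> cases lowerParity σ.1 p.2 <;>
      cases decide (p.1 < p.2) <;> decide
  constructor
  · rintro ⟨⟨T, t⟩, hT, ⟨i, hi, hσ⟩, j, hj, hσ'⟩
    have h1 : T.erase i = σ.1 := congrArg Prod.fst hσ
    have h2 : T.erase j = σ'.1 := congrArg Prod.fst hσ'
    have hij : i ≠ j := by
      rintro rfl
      exact hne (hσ.symm.trans hσ')
    have hE : IsExchange σ.1 (i, j) σ'.1 := by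
      rw [isExchange_iff, ← h1, ← h2]
      exact ⟨Finset.notMem_erase i T, Finset.mem_erase.2 ⟨hij.symm, hj⟩, by rw [Finset.insert_erase hi]⟩
    have hT' : T = insert i σ.1 := by rw [← h1, Finset.insert_erase hi]
    subst hT'
    exact ⟨(i, j), hE, hT, (key (i, j) hE t hσ).1 hσ'⟩
  · rintro ⟨p, hp, hT, hs⟩
    have h1 := isExchange_iff.1 hp
    have h3 : OrientedSimplex.face (insert p.1 σ.1, xor σ.2 (lowerParity (insert p.1 σ.1) p.1)) p.1 = σ := by
      refine Prod.ext (Finset.erase_insert h1.1) ?_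
      show xor (xor σ.2 (lowerParity (insert p.1 σ.1) p.1)) (lowerParity (insert p.1 σ.1) p.1) = σ.2
      rw [Bool.xor_assoc, Bool.xor_self, Bool.xor_false]
    exact ⟨(insert p.1 σ.1, xor σ.2 (lowerParity (insert p.1 σ.1) p.1)), hT,
      ⟨p.1, Finset.mem_insert_self _ _, h3⟩, p.2, Finset.mem_insert_of_mem h1.2.1, (key p hp _ h3).2 hs⟩

end Exchange

/-! ### The transition probabilities as sums over pairs -/

section Transition

variable {n : ℕ} {G : SimpleGraph (Fin n)} {k : ℕ}

/-- The vertices that contribute to the holding probability. -/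
noncomputable def Mode.loops (μ : Mode) (G : SimpleGraph (Fin n)) (k : ℕ) (S : Finset (Fin n)) :
    Finset (Fin n) :=
  match μ with
  | .up => upVertices G k S
  | .down => S
  | .harm => upVertices G k S ∪ S

/-- The adjacency of different oriented simplices in the three walks. -/
def Mode.Adj (μ : Mode) (G : SimpleGraph (Fin n)) (k : ℕ) (σ σ' : OrientedSimplex n) : Prop :=
  match μ with
  | .up => σ.UpAdj G k σ'
  | .down => σ.DownAdj σ'
  | .harm => σ.DownAdj σ' ∧ ¬ σ.UpAdj G k σ'.opp

/-- The total weight of the pairs for the simplex `S`. -/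
noncomputable def Mode.total (μ : Mode) (w : Fin n → ℝ) (S : Finset (Fin n)) : ℝ :=
  match μ with
  | .up => ∑ i ∈ Sᶜ, ∑ j ∈ insert i S, w i * w j
  | .down => ∑ i ∈ S, ∑ j ∈ (S.erase i)ᶜ, w i * w j
  | .harm => (∑ i, w i ^ 2) + ∑ i ∈ Sᶜ, ∑ j ∈ S, w i * w j

/-- The normalization factors of the three walks. -/
noncomputable def Mode.norm (μ : Mode) (G : SimpleGraph (Fin n)) (k : ℕ) (w : Fin n → ℝ) : ℝ :=
  ⨆ s : {s : Finset (Fin n) // IsSimplex G k s}, μ.total w s.1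

/-- The pair `p` contributes to the transition probability from `σ` to `σ'`. -/
def Mode.Contributes (μ : Mode) (G : SimpleGraph (Fin n)) (σ σ' : OrientedSimplex n) (p : Fin n × Fin n) :
    Prop :=
  (μ.mem (indicatorBits σ.1) p = true ∧ μ.mem (indicatorBits σ'.1) p.swap = true) ∧
    μ.bad (adjAll G (indicatorBits σ.1) p.1) p = false ∧
    μ.bad (adjAll G (indicatorBits σ'.1) p.2) p.swap = false ∧
    μ.Exchanges (indicatorBits σ.1) σ.2 p (indicatorBits σ'.1) σ'.2 ∧
    μ.Exchanges (indicatorBits σ'.1) σ'.2 p.swap (indicatorBits σ.1) σ.2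

theorem isSimplex_insert_iff {S : Finset (Fin n)} (hS : IsSimplex G k S) (i : Fin n) :
    IsSimplex G (k + 1) (insert i S) ↔ i ∉ S ∧ adjAll G (indicatorBits S) i = true := by
  classical
  unfold IsSimplex at hS ⊢
  rw [SimpleGraph.isNClique_iff] at hS ⊢
  unfold adjAll
  rw [decide_eq_true_iff, Finset.coe_insert, SimpleGraph.isClique_insert]
  simp only [indicatorBits, decide_eq_true_eq]
  constructor
  · rintro ⟨⟨-, h1⟩, h2⟩
    have hi : i ∉ S := fun h => by
      rw [Finset.insert_eq_of_mem h] at h2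
      omega
    exact ⟨hi, fun v hv hvi => (h1 v hv hvi.symm).symm⟩
  · rintro ⟨hi, h1⟩
    exact ⟨⟨hS.1, fun v hv hvi => (h1 v hv hvi.symm).symm⟩, by rw [Finset.card_insert_of_notMem hi, hS.2]⟩

theorem adjAll_of_mem {S : Finset (Fin n)} (hS : IsSimplex G k S) {i : Fin n} (hi : i ∈ S) :
    adjAll G (indicatorBits S) i = true := by
  classical
  unfold adjAll
  rw [decide_eq_true_iff]
  intro v hv hvi
  exact hS.1 (by simpa [indicatorBits] using hv) hi hvi

theorem Mode.contributes_self_iff (μ : Mode) {σ : OrientedSimplex n} (hσ : IsSimplex G k σ.1)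
    (p : Fin n × Fin n) : μ.Contributes G σ σ p ↔ p.1 = p.2 ∧ p.1 ∈ μ.loops G k σ.1 := by
  obtain ⟨i, j⟩ := p
  by_cases hp : i = j
  · subst hp
    have h1 := isSimplex_insert_iff hσ i
    have h2 : i ∈ σ.1 → adjAll G (indicatorBits σ.1) i = true := adjAll_of_mem hσ
    unfold Mode.Contributes
    rw [μ.exchanges_iff_of_diagonal σ σ (p := (i, i)) rfl, Prod.swap_prod_mk,
      μ.exchanges_iff_of_diagonal σ σ (p := (i, i)) rfl]
    cases μ
    · simp [Mode.mem, Mode.bad, Mode.loops, upVertices, h1, indicatorBits]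
    · simp [Mode.mem, Mode.bad, Mode.loops, indicatorBits]
    · simp only [Mode.mem, Mode.bad, Mode.loops, upVertices, h1, Finset.mem_union, Finset.mem_filter]
      by_cases hi : i ∈ σ.1 <;> simp [hi, h2]
  · refine iff_of_false ?_ fun h => hp h.1
    rintro ⟨⟨h1, -⟩, -, -, h2, -⟩
    simp only [Mode.mem, hp, if_false, Bool.and_eq_true, Bool.not_eq_true', indicatorBits, decide_eq_true_eq,
      decide_eq_false_iff_not] at h1
    have h3 := ((μ.exchanges_iff_of_ne σ σ (p := (i, j)) h1.1 h1.2).1 h2).1.1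
    rw [Finset.sdiff_self] at h3
    exact Finset.singleton_ne_empty _ h3.symm

theorem Mode.mem_of_ne (μ : Mode) {S : Finset (Fin n)} {p : Fin n × Fin n} (hp : p.1 ≠ p.2) :
    μ.mem (indicatorBits S) p = true ↔ p.1 ∉ S ∧ p.2 ∈ S := by
  simp [Mode.mem, hp, indicatorBits]

/-- By `Mode.sgn_up` the sign that fits a common face is opposite to the one that fits a common
coface, so the orientation condition is automatic and only the existence of the coface is left. -/
theorem IsExchange.upAdj_opp_iff {σ σ' : OrientedSimplex n} {p : Fin n × Fin n}
    (hE : IsExchange σ.1 p σ'.1) (hs : σ'.2 = xor σ.2 (Mode.down.sgn (indicatorBits σ.1) p)) :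
    σ.UpAdj G k σ'.opp ↔ IsSimplex G (k + 1) (insert p.1 σ.1) := by
  have hne : σ ≠ σ'.opp := by
    intro h
    have h1 : σ.1 = σ'.1 := by rw [h]; rfl
    have h2 := hE.1
    rw [h1, Finset.sdiff_self] at h2
    exact Finset.singleton_ne_empty _ h2.symm
  rw [upAdj_iff hne]
  constructor
  · rintro ⟨p', hE', h, -⟩
    rwa [hE.eq hE']
  · intro h
    refine ⟨p, hE, h, ?_⟩
    rw [Mode.sgn_up _ hE.ne, OrientedSimplex.opp, hs, Bool.xor_not]

theorem Mode.contributes_iff (μ : Mode) {σ σ' : OrientedSimplex n} (hσ : IsSimplex G k σ.1)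
    (hσ' : IsSimplex G k σ'.1) (hne : σ ≠ σ') (p : Fin n × Fin n) :
    μ.Contributes G σ σ' p ↔ μ.Adj G k σ σ' ∧ IsExchange σ.1 p σ'.1 := by
  constructor
  · rintro ⟨⟨h1, -⟩, h2, -, h3, -⟩
    have hp : p.1 ≠ p.2 := fun hp => hne ((μ.exchanges_iff_of_diagonal σ σ' hp).1 h3).symm
    rw [μ.mem_of_ne hp] at h1
    obtain ⟨hE, hs⟩ := (μ.exchanges_iff_of_ne σ σ' h1.1 h1.2).1 h3
    refine ⟨?_, hE⟩
    have h4 := isSimplex_insert_iff hσ p.1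
    cases μ
    · refine (upAdj_iff hne).2 ⟨p, hE, h4.2 ⟨h1.1, ?_⟩, hs⟩
      simpa [Mode.bad] using h2
    · exact (downAdj_iff hne).2 ⟨p, hE, hs⟩
    -- In the harmonic walk an off-diagonal pair is flagged exactly when the new vertex completes a
    -- coface.
    · refine ⟨(downAdj_iff hne).2 ⟨p, hE, hs⟩, ?_⟩
      rw [hE.upAdj_opp_iff hs, h4]
      intro h
      simp [Mode.bad, hp, h.2] at h2
  · rintro ⟨hadj, hE⟩
    have h1 := isExchange_iff.1 hE
    have h1' : p.2 ∉ σ'.1 ∧ p.1 ∈ σ'.1 ∧ _ := isExchange_iff.1 hE.swap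
    have hS : adjAll G (indicatorBits σ.1) p.1 = true ↔ IsSimplex G (k + 1) (insert p.1 σ.1) := by
      rw [isSimplex_insert_iff hσ, and_iff_right h1.1]
    -- Both directions of the exchange test the same union σ ∪ σ', so the two flags agree.
    have hS' : adjAll G (indicatorBits σ'.1) p.2 = true ↔ IsSimplex G (k + 1) (insert p.1 σ.1) := by
      rw [hE.insert_eq, isSimplex_insert_iff hσ', and_iff_right h1'.1]
    have hs : σ'.2 = xor σ.2 (μ.sgn (indicatorBits σ.1) p) := by
      cases μ
      · obtain ⟨p', hE', -, h⟩ := (upAdj_iff hne).1 hadj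
        rwa [hE.eq hE']
      · obtain ⟨p', hE', h⟩ := (downAdj_iff hne).1 hadj
        rwa [hE.eq hE']
      · obtain ⟨p', hE', h⟩ := (downAdj_iff hne).1 hadj.1
        rwa [hE.eq hE']
    have hs' : σ.2 = xor σ'.2 (μ.sgn (indicatorBits σ'.1) p.swap) := by
      rw [μ.sgn_swap hE, hs, Bool.xor_assoc, Bool.xor_self, Bool.xor_false]
    have hbad : μ.bad (adjAll G (indicatorBits σ.1) p.1) p = false ∧
        μ.bad (adjAll G (indicatorBits σ'.1) p.2) p.swap = false := by
      cases μ
      · obtain ⟨p', hE', h, -⟩ := (upAdj_iff hne).1 hadj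
        rw [← hE.eq hE'] at h
        rw [hS.2 h, hS'.2 h]
        exact ⟨rfl, rfl⟩
      · exact ⟨rfl, rfl⟩
      · have h := hadj.2
        rw [hE.upAdj_opp_iff hs] at h
        rw [Bool.eq_false_iff.2 (mt hS.1 h), Bool.eq_false_iff.2 (mt hS'.1 h)]
        simp [Mode.bad, hE.ne, hE.ne.symm]
    exact ⟨⟨(μ.mem_of_ne hE.ne).2 ⟨h1.1, h1.2.1⟩, (μ.mem_of_ne hE.swap.ne).2 ⟨h1'.1, h1'.2.1⟩⟩, hbad.1, hbad.2,
      (μ.exchanges_iff_of_ne σ σ' h1.1 h1.2.1).2 ⟨hE, hs⟩,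
      (μ.exchanges_iff_of_ne σ' σ h1'.1 h1'.2.1).2 ⟨hE.swap, hs'⟩⟩

theorem Mode.Adj.exists_isExchange {μ : Mode} {σ σ' : OrientedSimplex n} (h : μ.Adj G k σ σ') (hne : σ ≠ σ') :
    ∃ p, IsExchange σ.1 p σ'.1 := by
  cases μ
  · obtain ⟨p, hE, -⟩ := (upAdj_iff hne).1 h
    exact ⟨p, hE⟩
  · obtain ⟨p, hE, -⟩ := (downAdj_iff hne).1 h
    exact ⟨p, hE⟩
  · obtain ⟨p, hE, -⟩ := (downAdj_iff hne).1 h.1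
    exact ⟨p, hE⟩

open scoped Classical in
/-- The transition matrices of the three walks. -/
noncomputable def Mode.walk (μ : Mode) (G : SimpleGraph (Fin n)) (k : ℕ) (w : Fin n → ℝ)
    (σ σ' : OrientedSimplex n) : ℝ :=
  if σ = σ' then (∑ u ∈ μ.loops G k σ.1, w u ^ 2) / μ.norm G k w
  else if μ.Adj G k σ σ' then exchangeWeight w σ σ' / μ.norm G k w
  else 0

theorem Mode.walk_eq_sum (μ : Mode) (w : Fin n → ℝ) {σ σ' : OrientedSimplex n} (hσ : IsSimplex G k σ.1)
    (hσ' : IsSimplex G k σ'.1) [DecidablePred (μ.Contributes G σ σ')] :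
    μ.walk G k w σ σ' = ∑ p, if μ.Contributes G σ σ' p then w p.1 * w p.2 / μ.norm G k w else 0 := by
  classical
  by_cases hne : σ = σ'
  · subst hne
    simp only [Mode.walk, if_true, μ.contributes_self_iff hσ]
    rw [Fintype.sum_prod_type, Finset.sum_div, ← Finset.sum_filter_add_sum_filter_not Finset.univ
      (· ∈ μ.loops G k σ.1), Finset.sum_eq_zero (s := Finset.univ.filter fun i => ¬ _), add_zero,
      Finset.filter_mem_eq_inter, Finset.univ_inter]
    · refine Finset.sum_congr rfl fun i hi => ?_
      simp [hi, pow_two]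
    · intro i hi
      rw [Finset.mem_filter] at hi
      simp [hi.2]
  · simp only [Mode.walk, hne, if_false, μ.contributes_iff hσ hσ' hne]
    by_cases hadj : μ.Adj G k σ σ'
    · obtain ⟨p, hE⟩ := hadj.exists_isExchange hne
      rw [if_pos hadj, Finset.sum_eq_single p]
      · rw [if_pos ⟨hadj, hE⟩, exchangeWeight, hE.1, hE.2, Finset.prod_singleton, Finset.prod_singleton, mul_comm]
      · intro p' _ hp'
        rw [if_neg fun h => hp' (h.2.eq hE)]
      · simp
    · simp [hadj]

/-- Only diagonal pairs contribute if σ = σ', and at most one pair otherwise; in both cases the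
first component determines the pair. This bounds how often the rounding error enters an entry. -/
theorem Mode.card_contributes_le (μ : Mode) {σ σ' : OrientedSimplex n} (hσ : IsSimplex G k σ.1)
    (hσ' : IsSimplex G k σ'.1) [DecidablePred (μ.Contributes G σ σ')] :
    (Finset.univ.filter (μ.Contributes G σ σ')).card ≤ n := by
  have h := Finset.card_le_card_of_injOn (s := Finset.univ.filter (μ.Contributes G σ σ'))
    (t := (Finset.univ : Finset (Fin n))) Prod.fst (fun _ _ => Finset.mem_univ _) ?_
  · rwa [Finset.card_univ, Fintype.card_fin] at h
  · intro p hp p' hp' h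
    rw [Finset.mem_coe, Finset.mem_filter] at hp hp'
    by_cases hne : σ = σ'
    · subst hne
      have h1 := ((μ.contributes_self_iff hσ p).1 hp.2).1
      have h2 := ((μ.contributes_self_iff hσ p').1 hp'.2).1
      exact Prod.ext h (h1.symm.trans (h.trans h2))
    · exact ((μ.contributes_iff hσ hσ' hne p).1 hp.2).2.eq ((μ.contributes_iff hσ hσ' hne p').1 hp'.2).2

/-- The admissible pairs include those that the graph will rule out: they are chosen so that their
total weight is exactly the sum in the normalization factor, which lets the sampling ignore the
graph. -/
theorem Mode.sum_mem (μ : Mode) (w : Fin n → ℝ) (S : Finset (Fin n)) :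
    ∑ p, (if μ.mem (indicatorBits S) p = true then w p.1 * w p.2 else 0) = μ.total w S := by
  rw [Fintype.sum_prod_type]
  cases μ
  · rw [Mode.total, ← Finset.sum_subset (Finset.subset_univ Sᶜ)]
    · refine Finset.sum_congr rfl fun i hi => ?_
      rw [Finset.mem_compl] at hi
      rw [← Finset.sum_subset (Finset.subset_univ (insert i S))]
      · refine Finset.sum_congr rfl fun j hj => if_pos ?_
        rw [Finset.mem_insert] at hj
        by_cases h : i = j
        · subst h
          simp [Mode.mem, indicatorBits, hi]
        · rw [Mode.mem_of_ne _ h]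
          exact ⟨hi, hj.resolve_left fun e => h e.symm⟩
      · intro j _ hj
        rw [Finset.mem_insert, not_or] at hj
        refine if_neg ?_
        rw [Mode.mem_of_ne _ fun e => hj.1 e.symm]
        exact fun h => hj.2 h.2
    · intro i _ hi
      rw [Finset.mem_compl, not_not] at hi
      refine Finset.sum_eq_zero fun j _ => if_neg ?_
      by_cases h : i = j
      · subst h
        simp [Mode.mem, indicatorBits, hi]
      · rw [Mode.mem_of_ne _ h]
        exact fun h => h.1 hi
  -- The factor of the down walk sums over the removed vertex first, which is the second component
  -- of a pair.
  · rw [Finset.sum_comm, Mode.total, ← Finset.sum_subset (Finset.subset_univ S)]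
    · refine Finset.sum_congr rfl fun i hi => ?_
      rw [← Finset.sum_subset (Finset.subset_univ (S.erase i)ᶜ)]
      · refine Finset.sum_congr rfl fun j hj => ?_
        rw [Finset.mem_compl, Finset.mem_erase] at hj
        rw [if_pos, mul_comm]
        by_cases h : j = i
        · subst h
          simp [Mode.mem, indicatorBits, hi]
        · rw [Mode.mem_of_ne _ h]
          exact ⟨fun h' => hj ⟨h, h'⟩, hi⟩
      · intro j _ hj
        rw [Finset.mem_compl, not_not, Finset.mem_erase] at hj
        refine if_neg ?_
        rw [Mode.mem_of_ne _ hj.1]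
        exact fun h => h.1 hj.2
    · intro i _ hi
      refine Finset.sum_eq_zero fun j _ => if_neg ?_
      by_cases h : j = i
      · subst h
        simp [Mode.mem, indicatorBits, hi]
      · rw [Mode.mem_of_ne _ h]
        exact fun h => hi h.2
  · have h1 : ∀ i j, (if Mode.harm.mem (indicatorBits S) (i, j) = true then w i * w j else 0) =
        (if i = j then w i * w j else 0) + if i ∈ Sᶜ then (if j ∈ S then w i * w j else 0) else 0 := by
      intro i j
      by_cases h : i = j
      · subst h
        by_cases hi : i ∈ S <;> simp [Mode.mem, hi]
      · by_cases hi : i ∈ S <;> by_cases hj : j ∈ S <;> simp [Mode.mem_of_ne, h, hi, hj]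
    simp only [h1, Finset.sum_add_distrib]
    congr 1
    · simp [pow_two]
    · rw [← Finset.sum_subset (Finset.subset_univ Sᶜ)]
      · refine Finset.sum_congr rfl fun i hi => ?_
        simp [Finset.mem_compl.1 hi]
      · intro i _ hi
        simp only [hi, if_false, Finset.sum_const_zero]

theorem Mode.total_nonneg (μ : Mode) {w : Fin n → ℝ} (hw : ∀ v, 0 < w v) (S : Finset (Fin n)) :
    0 ≤ μ.total w S := by
  rw [← μ.sum_mem]
  refine Finset.sum_nonneg fun p _ => ?_
  have := hw p.1
  have := hw p.2
  split_ifs <;> positivity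

theorem Mode.norm_nonneg (μ : Mode) {w : Fin n → ℝ} (hw : ∀ v, 0 < w v) : 0 ≤ μ.norm G k w :=
  Real.iSup_nonneg fun s => μ.total_nonneg hw s.1

theorem Mode.total_le_norm (μ : Mode) (w : Fin n → ℝ) {S : Finset (Fin n)} (hS : IsSimplex G k S) :
    μ.total w S ≤ μ.norm G k w :=
  le_ciSup (f := fun s : {s : Finset (Fin n) // IsSimplex G k s} => μ.total w s.1)
    (Set.finite_range _).bddAbove ⟨S, hS⟩

/-- This is where the maximality in the normalization factor enters: every `k`-simplex is good for
the preparation. If the factor is 0, the convention x / 0 = 0 gives the claim. -/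
theorem Mode.sum_mem_div_le (μ : Mode) {w : Fin n → ℝ} (hw : ∀ v, 0 < w v) {S : Finset (Fin n)}
    (hS : IsSimplex G k S) :
    ∑ p, (if μ.mem (indicatorBits S) p = true then w p.1 * w p.2 / μ.norm G k w else 0) ≤ 1 := by
  have h : ∑ p, (if μ.mem (indicatorBits S) p = true then w p.1 * w p.2 / μ.norm G k w else 0) =
      μ.total w S / μ.norm G k w := by
    rw [← μ.sum_mem, Finset.sum_div]
    refine Finset.sum_congr rfl fun p _ => ?_
    split_ifs <;> simp
  rw [h]
  exact div_le_one_of_le₀ (μ.total_le_norm w hS) (μ.norm_nonneg hw)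

theorem Mode.weight_div_le (μ : Mode) {w : Fin n → ℝ} (hw : ∀ v, 0 < w v) {S : Finset (Fin n)}
    (hS : IsSimplex G k S) {p : Fin n × Fin n} (hp : μ.mem (indicatorBits S) p = true) :
    w p.1 * w p.2 / μ.norm G k w ≤ 1 := by
  have h := Finset.single_le_sum (s := Finset.univ)
    (f := fun p => if μ.mem (indicatorBits S) p = true then w p.1 * w p.2 / μ.norm G k w else 0)
    (fun p _ => ?_) (Finset.mem_univ p)
  · simp only [hp, if_true] at h
    exact h.trans (μ.sum_mem_div_le hw hS)
  · have h1 := hw p.1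
    have h2 := hw p.2
    have h3 := μ.norm_nonneg (G := G) (k := k) hw
    split_ifs <;> positivity

end Transition

/-! ### The walk circuits -/

section Main

variable {n : ℕ}

theorem initialKet_eq (σ : OrientedSimplex n) :
    initialKet (vertexBits n + 4) σ = startKet (indicatorBits σ.1) ![σ.2, false] := by
  refine (startKet_of_keepOnly (σ := initialKet (vertexBits n + 4) σ) ?_).symm
  funext q
  rcases q with ((q | q) | (q | q)) | (q | q)
  · exact Bool.true_and _
  · exact Bool.true_and _
  all_goals rfl

/-- The circuit is built from the given value of the factor alone; the graph enters through the
answers to the queries. The overlap is a sum of `α p * α p.swap` over the contributing pairs, and it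
is compared term by term with the transition probability. -/
theorem Mode.exists_walk_circuit (μ : Mode) (hn : 1 ≤ n) (k : ℕ) {w : Fin n → ℝ} (hw : ∀ v, 0 < w v) (κ : ℝ)
    {ε : ℝ} {s : ℕ} (hs : n * (1 / 2 : ℝ) ^ s ≤ ε) :
    ∃ (a : ℕ) (circ : QCircuit n (WalkQubit n (vertexBits n + 4) ⊕ Fin a)),
      QCircuit.cost circ ≤ 32 * (n ^ 2 * (200 * (s + 2 * vertexBits n + 2) + 40) +
        n ^ 2 * (66 * vertexBits n + 49)) + 10 * (2 * (n + 2) + 2 * (vertexBits n + 4)) + 11 ∧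
      ∀ G : SimpleGraph (Fin n), μ.norm G k w = κ →
        ∃ U ∈ Matrix.unitaryGroup (WalkQubit n (vertexBits n + 4) → Bool) ℂ,
          circ.Implements G U ∧ ∀ σ σ' : OrientedSimplex n, IsSimplex G k σ.1 → IsSimplex G k σ'.1 →
            ‖(μ.walk G k w σ σ' : ℂ) - (U.conjTranspose * swapMatrix n (vertexBits n + 4) * U)
              (initialKet (vertexBits n + 4) σ') (initialKet (vertexBits n + 4) σ)‖ ≤ ε := by
  classical
  -- The absolute value makes the probabilities nonnegative before any graph is known; when κ is the
  -- factor of a graph, it changes nothing.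
  obtain ⟨c, α, hcost, hprep, happrox⟩ := exists_prepares μ hn s (q := fun p => w p.1 * w p.2 / |κ|)
    (fun p => div_nonneg (mul_pos (hw _) (hw _)).le (abs_nonneg κ))
    (fun p => by rw [Prod.fst_swap, Prod.snd_swap, mul_comm])
  obtain ⟨a, circ, hcost', hcirc⟩ := exists_reflection μ hn hprep
  refine ⟨a, circ, ?_, fun G hG => ?_⟩
  · have := Nat.mul_le_mul_left 32 (Nat.add_le_add_right hcost (n ^ 2 * (66 * vertexBits n + 49)))
    omega
  have hκ : |κ| = μ.norm G k w := by rw [hG, abs_of_nonneg (hG ▸ μ.norm_nonneg hw)]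
  rw [hκ] at happrox hcirc
  obtain ⟨V, hU, hI, hV⟩ := hcirc G
  refine ⟨_, hU, hI, fun σ σ' hσ hσ' => ?_⟩
  have hgood : ∀ τ : OrientedSimplex n, IsSimplex G k τ.1 → ∃ γ : (Fin n → Bool) → ℂ, ∀ y,
      householder firstRegister V y (initialKet (vertexBits n + 4) τ) =
        -((∑ p, ((if μ.mem (indicatorBits τ.1) p then α p else 0 : ℝ) : ℂ) •
          ket (pairKet μ G (indicatorBits τ.1) ![τ.2, false] p) +
        ∑ u, γ u • ket (restKet (indicatorBits τ.1) ![τ.2, false] u)) y) := by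
    intro τ hτ
    obtain ⟨c₀, β, γ, h1, h2⟩ := hV (indicatorBits τ.1) ![τ.2, false]
    obtain ⟨h3, h4⟩ := h2 (μ.sum_mem_div_le hw hτ)
    refine ⟨fun u => (Real.sqrt 2 : ℂ) * γ u, fun y => ?_⟩
    rw [initialKet_eq, householder_startKet μ G h1 h3 y]
    congr! 6 with p
    rw [h4 p]
    split_ifs <;> simp
  obtain ⟨γ, h1⟩ := hgood σ hσ
  obtain ⟨γ', h2⟩ := hgood σ' hσ'
  -- The conditions for a matching pair, together with admissibility on both sides, are by
  -- definition those of `Mode.Contributes`.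
  have hM : ∀ p, (if flipRegisters (pairKet μ G (indicatorBits σ.1) ![σ.2, false] p) =
      pairKet μ G (indicatorBits σ'.1) ![σ'.2, false] p.swap then
        (if μ.mem (indicatorBits σ.1) p then α p else 0) *
          (if μ.mem (indicatorBits σ'.1) p.swap then α p.swap else 0) else 0) =
      if μ.Contributes G σ σ' p then α p * α p.swap else 0 := by
    intro p
    simp only [Mode.Contributes, flip_pairKet_iff]
    by_cases e1 : μ.mem (indicatorBits σ.1) p = true <;>
      by_cases e2 : μ.mem (indicatorBits σ'.1) p.swap = true <;> simp [e1, e2]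
  rw [conjTranspose_mul_swapMatrix_mul]
  simp only [h1, h2, star_neg, neg_mul_neg]
  rw [sum_star_flip_mul, μ.walk_eq_sum w hσ hσ', ← Complex.ofReal_sub, Complex.norm_real, Real.norm_eq_abs]
  simp only [hM]
  rw [← Finset.sum_sub_distrib]
  refine (Finset.abs_sum_le_sum_abs _ _).trans (le_trans ?_ hs)
  calc ∑ p, |(if μ.Contributes G σ σ' p then w p.1 * w p.2 / μ.norm G k w else 0) -
        if μ.Contributes G σ σ' p then α p * α p.swap else 0|
      ≤ ∑ p, if μ.Contributes G σ σ' p then (1 / 2 : ℝ) ^ s else 0 := by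
        refine Finset.sum_le_sum fun p _ => ?_
        split_ifs with h
        · exact happrox p (μ.weight_div_le hw hσ h.1.1)
        · simp
    _ ≤ n * (1 / 2 : ℝ) ^ s := by
        rw [← Finset.sum_filter, Finset.sum_const, nsmul_eq_mul]
        exact mul_le_mul_of_nonneg_right (by exact_mod_cast μ.card_contributes_le hσ hσ') (by positivity)

theorem upWalk_eq (G : SimpleGraph (Fin n)) (k : ℕ) (w : Fin n → ℝ) (σ σ' : OrientedSimplex n) :
    upWalk G k w (some σ) (some σ') = Mode.up.walk G k w σ σ' := rfl

theorem downWalk_eq (G : SimpleGraph (Fin n)) (k : ℕ) (w : Fin n → ℝ) (σ σ' : OrientedSimplex n) :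
    downWalk G k w (some σ) (some σ') = Mode.down.walk G k w σ σ' := rfl

/-- The holding probability is a sum over a disjoint union, since adding a vertex that yields a
(k+1)-simplex must enlarge the set. This uses that σ is a `k`-simplex. -/
theorem harmWalk_eq {G : SimpleGraph (Fin n)} {k : ℕ} (w : Fin n → ℝ) {σ : OrientedSimplex n}
    (hσ : IsSimplex G k σ.1) (σ' : OrientedSimplex n) :
    harmWalk G k w (some σ) (some σ') = Mode.harm.walk G k w σ σ' := by
  classical
  have hdis : Disjoint (upVertices G k σ.1) σ.1 := by
    rw [Finset.disjoint_left]
    intro u hu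
    rw [upVertices, Finset.mem_filter, isSimplex_insert_iff hσ] at hu
    exact hu.2.1
  have hnorm : normHarm G k w = Mode.harm.norm G k w := rfl
  simp only [harmWalk, withAbsorbing, Mode.walk, Mode.Adj, Mode.loops, Finset.sum_union hdis, hnorm]
  congr

theorem vertexBits_le (n : ℕ) : (vertexBits n : ℝ) ≤ 3 * Real.log (n + 2) := by
  have h2 := Real.log_two_gt_d9
  have h0 : 0 ≤ Real.log ((n : ℝ) + 2) := Real.log_nonneg (by linarith [(n.cast_nonneg : (0 : ℝ) ≤ n)])
  rcases le_or_gt n 1 with hn | hn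
  · have : vertexBits n = 0 := Nat.clog_of_right_le_one hn 2
    rw [this]
    simpa using h0
  · have h3 : 2 ^ (vertexBits n).pred < n := Nat.pow_pred_clog_lt_self (by norm_num) hn
    have h4 : 0 < vertexBits n := Nat.clog_pos (by norm_num) hn
    have h5 : 2 ^ vertexBits n ≤ (n + 2) ^ 2 := by
      obtain ⟨b, hb⟩ := Nat.exists_eq_succ_of_ne_zero h4.ne'
      rw [hb, Nat.pred_succ] at h3
      rw [hb, pow_succ]
      nlinarith
    have h6 : (2 : ℝ) ^ vertexBits n ≤ ((n : ℝ) + 2) ^ 2 := by exact_mod_cast h5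
    have h7 := Real.log_le_log (by positivity) h6
    rw [Real.log_pow, Real.log_pow] at h7
    push_cast at h7
    have h8 : (0 : ℝ) ≤ vertexBits n := Nat.cast_nonneg _
    nlinarith

/-- The first summand of the exponent absorbs the at most `n` contributing pairs, the second one
provides the precision ε. -/
theorem natCast_mul_half_pow_le {ε : ℝ} (hε : 0 < ε) :
    (n : ℝ) * (1 / 2 : ℝ) ^ (vertexBits n + ⌈Real.logb 2 (1 / ε)⌉₊) ≤ ε := by
  have h1 : (n : ℝ) ≤ 2 ^ vertexBits n := by
    exact_mod_cast Nat.le_pow_clog (by norm_num : 1 < 2) n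
  have h2 : 1 / ε ≤ 2 ^ ⌈Real.logb 2 (1 / ε)⌉₊ := by
    rw [← Real.rpow_natCast, ← Real.logb_le_iff_le_rpow (by norm_num) (by positivity)]
    exact Nat.le_ceil _
  rw [div_le_iff₀ hε] at h2
  rw [one_div, inv_pow, pow_add, ← div_eq_mul_inv, div_le_iff₀ (by positivity)]
  calc (n : ℝ) ≤ 2 ^ vertexBits n * 1 := by rwa [mul_one]
    _ ≤ 2 ^ vertexBits n * (2 ^ ⌈Real.logb 2 (1 / ε)⌉₊ * ε) := by gcongr
    _ = ε * (2 ^ vertexBits n * 2 ^ ⌈Real.logb 2 (1 / ε)⌉₊) := by ring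

theorem ceil_logb_le {ε : ℝ} (hε : 0 < ε) (hε2 : ε ≤ 1 / 2) :
    (⌈Real.logb 2 (1 / ε)⌉₊ : ℝ) ≤ 3 * Real.log (1 / ε) ∧ Real.log 2 ≤ Real.log (1 / ε) := by
  have h2 := Real.log_two_gt_d9
  have h3 : Real.log 2 ≤ Real.log (1 / ε) :=
    Real.log_le_log (by norm_num) (by rw [le_div_iff₀ hε]; linarith)
  refine ⟨?_, h3⟩
  have h4 : 0 ≤ Real.logb 2 (1 / ε) := div_nonneg (by linarith) (by linarith)
  have h5 := (Nat.ceil_lt_add_one h4).le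
  have h6 : Real.logb 2 (1 / ε) ≤ 3 / 2 * Real.log (1 / ε) := by
    rw [Real.logb, div_le_iff₀ (by linarith)]
    nlinarith
  linarith

theorem cost_bound (hn : 1 ≤ n) {ε : ℝ} (hε : 0 < ε) (hε2 : ε ≤ 1 / 2) {N : ℕ}
    (hN : N ≤ 32 * (n ^ 2 * (200 * (vertexBits n + ⌈Real.logb 2 (1 / ε)⌉₊ + 2 * vertexBits n + 2) + 40) +
        n ^ 2 * (66 * vertexBits n + 49)) + 10 * (2 * (n + 2) + 2 * (vertexBits n + 4)) + 11) :
    (N : ℝ) ≤ 400000 * ((n : ℝ) ^ 2 * Real.log (1 / ε) * Real.log (n + 2) ^ 1) := by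
  obtain ⟨t, ht⟩ : ∃ t, t = ⌈Real.logb 2 (1 / ε)⌉₊ := ⟨_, rfl⟩
  obtain ⟨h1, h2⟩ := ceil_logb_le hε hε2
  have h3 := vertexBits_le n
  have h4 := Real.log_two_gt_d9
  have h5 : Real.log 2 ≤ Real.log ((n : ℝ) + 2) :=
    Real.log_le_log (by norm_num) (by linarith [(n.cast_nonneg : (0 : ℝ) ≤ n)])
  rw [← ht] at hN h1
  generalize Real.log (1 / ε) = E at *
  generalize Real.log ((n : ℝ) + 2) = l at *
  -- All lower-order terms are absorbed using 1 ≤ n ≤ n²; the largest coefficient is the constant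
  -- one, slightly below 16000.
  have h6 : N ≤ n ^ 2 * (16000 * (t + 2 * vertexBits n + 1)) := by
    have h7 : 1 ≤ n ^ 2 := Nat.one_le_pow _ _ hn
    have h8 : n ≤ n ^ 2 := Nat.le_self_pow (by norm_num) n
    have h9 : vertexBits n ≤ n ^ 2 * vertexBits n := Nat.le_mul_of_pos_left _ h7
    have h10 : 0 ≤ n ^ 2 * t := Nat.zero_le _
    nlinarith
  have h7 : (N : ℝ) ≤ (n : ℝ) ^ 2 * (16000 * (t + 2 * vertexBits n + 1)) := by exact_mod_cast h6
  -- Both logarithms are at least log 2 because of ε ≤ 1/2 and n + 2 ≥ 2, so a sum of the two is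
  -- bounded by a multiple of their product.
  have h8 : (t : ℝ) + 2 * vertexBits n + 1 ≤ 25 * (E * l) := by
    nlinarith [mul_nonneg (sub_nonneg.2 h2) (sub_nonneg.2 h5)]
  calc (N : ℝ) ≤ (n : ℝ) ^ 2 * (16000 * (t + 2 * vertexBits n + 1)) := h7
    _ ≤ (n : ℝ) ^ 2 * (16000 * (25 * (E * l))) := by gcongr
    _ = 400000 * ((n : ℝ) ^ 2 * E * l ^ 1) := by ring

/-- The circuits for one of the three walks, with all the bounds. -/
theorem Mode.exists_circuit (μ : Mode) (n k : ℕ) {w : Fin n → ℝ} (hw : ∀ v, 0 < w v) {ε : ℝ} (hε : 0 < ε)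
    (hε2 : ε ≤ 1 / 2) (κ : ℝ)
    {P : SimpleGraph (Fin n) → Option (OrientedSimplex n) → Option (OrientedSimplex n) → ℝ}
    (hP : ∀ G, ∀ σ σ' : OrientedSimplex n, IsSimplex G k σ.1 → P G (some σ) (some σ') = μ.walk G k w σ σ') :
    ∃ (a : ℕ) (circ : QCircuit n (WalkQubit n (vertexBits n + 4) ⊕ Fin a)),
      (circ.cost : ℝ) ≤ 400000 * ((n : ℝ) ^ 2 * Real.log (1 / ε) * Real.log (n + 2) ^ 1) ∧
      ∀ G : SimpleGraph (Fin n), μ.norm G k w = κ →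
        ∃ U ∈ Matrix.unitaryGroup (WalkQubit n (vertexBits n + 4) → Bool) ℂ,
          circ.Implements G U ∧ ReproducesWalk (vertexBits n + 4) G k ε U (P G) := by
  -- Without vertices there is no simplex of dimension k ≥ 0, and the empty circuit, of cost 0,
  -- meets the bound.
  rcases Nat.eq_zero_or_pos n with rfl | hn
  · refine ⟨0, [], by simp [QCircuit.cost], fun G _ => ⟨1, one_mem _, fun x y => ?_, fun σ σ' hσ _ => ?_⟩⟩
    · have h : (x = Sum.elim y fun _ => false) ↔ (fun q => x (Sum.inl q)) = y := by
        constructor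
        · rintro rfl
          rfl
        · rintro rfl
          funext q
          rcases q with q | q
          · rfl
          · exact q.elim0
      simp [QCircuit.eval, Matrix.one_apply, h]
    · have h := hσ.2
      rw [Finset.eq_empty_of_isEmpty σ.1] at h
      simp at h
  · obtain ⟨a, circ, h1, h2⟩ := μ.exists_walk_circuit hn k hw κ (natCast_mul_half_pow_le (n := n) hε)
    refine ⟨a, circ, cost_bound hn hε hε2 h1, fun G hG => ?_⟩
    obtain ⟨U, hU, hI, h3⟩ := h2 G hG
    refine ⟨U, hU, hI, fun σ σ' hσ hσ' => ?_⟩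
    rw [hP G σ σ' hσ]
    exact h3 σ σ' hσ hσ'

end Main

theorem mainTheorem5 :
    ∃ (C : ℝ) (c : ℕ) (m : ℕ → ℕ),
      (∀ n : ℕ, (m n : ℝ) ≤ C * Real.log (n + 2)) ∧
      ∀ (n k : ℕ) (w : Fin n → ℝ) (ε : ℝ), (∀ v, 0 < w v) → 0 < ε → ε ≤ 1 / 2 →
        -- the up walk
        (∀ κ : ℝ, ∃ (a : ℕ) (circ : QCircuit n (WalkQubit n (m n) ⊕ Fin a)),
          (circ.cost : ℝ) ≤ C * ((n : ℝ) ^ 2 * Real.log (1 / ε) * Real.log (n + 2) ^ c) ∧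
          ∀ G : SimpleGraph (Fin n), normUp G k w = κ →
            ∃ U ∈ Matrix.unitaryGroup (WalkQubit n (m n) → Bool) ℂ,
              circ.Implements G U ∧ ReproducesWalk (m n) G k ε U (upWalk G k w)) ∧
        -- the down walk
        (∀ κ : ℝ, ∃ (a : ℕ) (circ : QCircuit n (WalkQubit n (m n) ⊕ Fin a)),
          (circ.cost : ℝ) ≤ C * ((n : ℝ) ^ 2 * Real.log (1 / ε) * Real.log (n + 2) ^ c) ∧
          ∀ G : SimpleGraph (Fin n), normDown G k w = κ →
            ∃ U ∈ Matrix.unitaryGroup (WalkQubit n (m n) → Bool) ℂ,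
              circ.Implements G U ∧ ReproducesWalk (m n) G k ε U (downWalk G k w)) ∧
        -- the harmonic walk
        (∀ κ : ℝ, ∃ (a : ℕ) (circ : QCircuit n (WalkQubit n (m n) ⊕ Fin a)),
          (circ.cost : ℝ) ≤ C * ((n : ℝ) ^ 2 * Real.log (1 / ε) * Real.log (n + 2) ^ c) ∧
          ∀ G : SimpleGraph (Fin n), normHarm G k w = κ →
            ∃ U ∈ Matrix.unitaryGroup (WalkQubit n (m n) → Bool) ℂ,
              circ.Implements G U ∧ ReproducesWalk (m n) G k ε U (harmWalk G k w)) := by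
  refine ⟨400000, 1, fun n => vertexBits n + 4, fun n => ?_, fun n k w ε hw hε hε2 =>
    ⟨fun κ => ?_, fun κ => ?_, fun κ => ?_⟩⟩
  · have h1 := vertexBits_le n
    have h2 := Real.log_two_gt_d9
    have h3 : Real.log 2 ≤ Real.log ((n : ℝ) + 2) :=
      Real.log_le_log (by norm_num) (by linarith [(n.cast_nonneg : (0 : ℝ) ≤ n)])
    push_cast
    linarith
  · exact Mode.up.exists_circuit n k hw hε hε2 κ fun G σ σ' _ => upWalk_eq G k w σ σ'
  · exact Mode.down.exists_circuit n k hw hε hε2 κ fun G σ σ' _ => downWalk_eq G k w σ σ'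
  · exact Mode.harm.exists_circuit n k hw hε hε2 κ fun G σ σ' hσ => harmWalk_eq w hσ σ'
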